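/- Let $d\in\{1,2,3\}$ and let $k\ge 2$ be an integer. For $t\in\mathbb R$ let $U_0(t)$ be the free wave group on the complex Hilbert space $H^1(\mathbb R^d)\times L^2(\mathbb R^d)$, $$U_0(t)=\begin{bmatrix}\cos(t|D|)&\frac{\sin(t|D|)}{|D|}\\ \Delta\frac{\sin(t|D|)}{|D|}&\cos(t|D|)\end{bmatrix},\qquad |D|=\sqrt{-\Delta},$$ and for a bounded measurable compactly supported function $V:\mathbb R^d\to\mathbb C$ (for instance a real valued one) put $$\mathbf V=\begin{bmatrix}0&0\\V&0\end{bmatrix},\qquad (\mathbf\Lambda F)(t)=\int_0^tU_0(t-s)F(s)\,ds,\qquad W_{k,V}=(\mathbf\Lambda\mathbf V)^kU_0 .$$ (So $(-1)^kW_{k,V}$ is the $k$-th term of the Duhamel series $\sum_{k\ge 0}(-\mathbf\Lambda\mathbf V)^kU_0$ for the wave group of $\partial_t^2-\Delta+V$.) There is a finite positive measure $\sigma_k$ on $(\mathbb R^d)^{k-1}=\{u'=(u_2,\dots,u_k)\}$, depending only on $d$ and $k$, with the following properties. 1. For every such $V$ and every even $\phi\in C_c^\infty(\mathbb R)$, the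 operator $\langle\phi,W_{k,V}\rangle=\int_{\mathbb R}\phi(t)W_{k,V}(t)\,dt$ (a strong integral) is bounded and trace class on $H^1(\mathbb R^d)\times L^2(\mathbb R^d)$, and $$\operatorname{trace}\,\langle\phi,W_{k,V}\rangle=\int_0^\infty t^{2k-d}\phi(t)\int_{\mathbb R^{dk}}V(u_1)\prod_{j=2}^kV(u_1+tu_j)\,d\sigma_k(u')\,du_1\,dt,$$ where the inner integrand is integrable with respect to $d\sigma_k(u')\,du_1$ for every $t>0$ and the outer integrand is integrable on $(0,\infty)$. 2. $\sigma_k$ is supported in the set $|u_2|+|u_3-u_2|+\cdots+|u_k-u_{k-1}|+|u_k|\le 1$. 3. Its total mass is $$\int d\sigma_k=\begin{cases}\bigl(2^{2k-2}\,k!\,(k-1)!\bigr)^{-1},&d=1,\\ \bigl(\pi\,k\,(2k-2)!\bigr)^{-1},&d=2,\\ \bigl(2^{2k-2}\,\pi\,k!\,(k-2)!\bigr)^{-1},&d=3.\end{cases}$$ 4. If $d=1$ or $d=2$, then $\sigma_k$ is absolutely continuous with respect to Lebesgue measure $du'$. -/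

import Mathlib

open MeasureTheory FourierTransform
open scoped ENNReal

noncomputable section

namespace WaveTrace

/-- Euclidean space `ℝ^d`. -/
abbrev E (d : ℕ) : Type := EuclideanSpace ℝ (Fin d)

/-- The complex Hilbert space `L²(ℝ^d)`. -/
abbrev L2 (d : ℕ) : Type := Lp ℂ 2 (volume : Measure (E d))

/-! ### Multiplication operators and Fourier multipliers on `L²` -/

/-- Multiplication by the bounded function `m`, as a bounded operator on `L²(ℝ^d)`. -/
def mulOp {d : ℕ} (m : E d → ℂ) (hm : MemLp m ∞ volume) : L2 d →L[ℂ] L2 d :=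
  (ContinuousLinearMap.mul ℂ ℂ).holderL volume ∞ 2 2 (hm.toLp m)

theorem coeFn_mulOp {d : ℕ} (m : E d → ℂ) (hm : MemLp m ∞ volume) (f : L2 d) :
    mulOp m hm f =ᵐ[volume] fun x => m x * f x := by
  have h1 := (ContinuousLinearMap.mul ℂ ℂ).coeFn_holder (r := 2) (hm.toLp m) f
  filter_upwards [h1, hm.coeFn_toLp] with x hx hx'
  change ((ContinuousLinearMap.mul ℂ ℂ).holder 2 (hm.toLp m) f : E d → ℂ) x = _
  rw [hx, hx']
  rfl

/-- The Fourier multiplier with bounded symbol `m`: `f ↦ 𝓕⁻¹ (m · 𝓕 f)` on `L²(ℝ^d)`. -/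
def fourierMul {d : ℕ} (m : E d → ℂ) (hm : MemLp m ∞ volume) : L2 d →L[ℂ] L2 d :=
  ((Lp.fourierTransformₗᵢ (E d) ℂ).symm.toContinuousLinearEquiv : L2 d →L[ℂ] L2 d) ∘L
    mulOp m hm ∘L ((Lp.fourierTransformₗᵢ (E d) ℂ).toContinuousLinearEquiv : L2 d →L[ℂ] L2 d)

theorem fourier_fourierMul {d : ℕ} (m : E d → ℂ) (hm : MemLp m ∞ volume) (f : L2 d) :
    𝓕 (fourierMul m hm f) = mulOp m hm (𝓕 f) :=
  (Lp.fourierTransformₗᵢ (E d) ℂ).apply_symm_apply _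

/-- The symbol of `|D| = √(-Δ)`. The Fourier transform used here is
`𝓕 f ξ = ∫ e^{-2πi⟨x,ξ⟩} f(x) dx`, so this symbol is `2π|ξ|`. -/
def absD {d : ℕ} (ξ : E d) : ℝ := 2 * Real.pi * ‖ξ‖

/-- The symbol of `⟨D⟩ = √(1-Δ)`. -/
def japD {d : ℕ} (ξ : E d) : ℝ := Real.sqrt (1 + absD ξ ^ 2)

theorem continuous_absD {d : ℕ} : Continuous (absD (d := d)) := by
  unfold absD; fun_prop

theorem continuous_japD {d : ℕ} : Continuous (japD (d := d)) := by
  have := continuous_absD (d := d)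
  unfold japD; fun_prop

theorem absD_nonneg {d : ℕ} (ξ : E d) : 0 ≤ absD ξ := by
  unfold absD; positivity

theorem japD_pos {d : ℕ} (ξ : E d) : 0 < japD ξ :=
  Real.sqrt_pos.2 (by positivity)

theorem one_le_japD {d : ℕ} (ξ : E d) : 1 ≤ japD ξ :=
  Real.one_le_sqrt.2 (by nlinarith [sq_nonneg (absD ξ)])

theorem absD_le_japD {d : ℕ} (ξ : E d) : absD ξ ≤ japD ξ :=
  Real.le_sqrt_of_sq_le (by linarith)

theorem japD_le {d : ℕ} (ξ : E d) : japD ξ ≤ 1 + absD ξ :=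
  Real.sqrt_le_iff.2 ⟨by linarith [absD_nonneg ξ], by nlinarith [absD_nonneg ξ]⟩

theorem memLp_symbol {d : ℕ} {m : E d → ℝ} (hm : Continuous m) (C : ℝ) (hC : ∀ ξ, |m ξ| ≤ C) :
    MemLp (fun ξ => (m ξ : ℂ)) ∞ (volume : Measure (E d)) :=
  memLp_top_of_bound (Complex.continuous_ofReal.comp hm).aestronglyMeasurable C
    (Filter.Eventually.of_forall fun ξ => by simpa using hC ξ)

/-! ### The Sobolev space `H¹(ℝ^d)` -/

/-- The subspace of those `f ∈ L²(ℝ^d)` with `⟨ξ⟩ 𝓕 f ∈ L²(ℝ^d)`. -/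
def H1sub (d : ℕ) : Submodule ℂ (L2 d) where
  carrier := {f | MemLp (fun ξ => (japD ξ : ℂ) * (𝓕 f : L2 d) ξ) 2 (volume : Measure (E d))}
  add_mem' := by
    intro f g hf hg
    refine (MemLp.add hf hg).ae_eq ?_
    have h : (𝓕 (f + g) : L2 d) = 𝓕 f + 𝓕 g := fourier_add f g
    rw [h]
    filter_upwards [Lp.coeFn_add (𝓕 f : L2 d) (𝓕 g : L2 d)] with ξ hξ
    rw [hξ, Pi.add_apply, Pi.add_apply, mul_add]
  zero_mem' := by
    have h : (𝓕 (0 : L2 d) : L2 d) = 0 := (Lp.fourierTransformₗᵢ (E d) ℂ).map_zero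
    refine (MemLp.zero (ε := ℂ) (p := 2) (μ := (volume : Measure (E d)))).ae_eq ?_
    rw [h]
    filter_upwards [Lp.coeFn_zero ℂ 2 (volume : Measure (E d))] with ξ hξ
    rw [hξ]
    simp
  smul_mem' := by
    intro c f hf
    refine (MemLp.const_smul hf c).ae_eq ?_
    have h : (𝓕 (c • f) : L2 d) = c • 𝓕 f := fourier_smul c f
    rw [h]
    filter_upwards [Lp.coeFn_smul c (𝓕 f : L2 d)] with ξ hξ
    rw [hξ, Pi.smul_apply, Pi.smul_apply, smul_eq_mul, smul_eq_mul]
    ring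

theorem H1sub.memLp {d : ℕ} (f : H1sub d) :
    MemLp (fun ξ => (japD ξ : ℂ) * (𝓕 (f : L2 d) : L2 d) ξ) 2 (volume : Measure (E d)) := f.2

/-- The function `⟨ξ⟩ 𝓕 f`, for `f` in the subspace `H1sub d`. -/
def H1sub.weighted {d : ℕ} : H1sub d →ₗ[ℂ] L2 d where
  toFun f := (H1sub.memLp f).toLp _
  map_add' f g := by
    rw [← MemLp.toLp_add]
    apply MemLp.toLp_congr
    have h : (𝓕 ((f + g : H1sub d) : L2 d) : L2 d) = 𝓕 f.1 + 𝓕 g.1 := fourier_add f.1 g.1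
    rw [h]
    filter_upwards [Lp.coeFn_add (𝓕 f.1 : L2 d) (𝓕 g.1 : L2 d)] with ξ hξ
    rw [hξ, Pi.add_apply, Pi.add_apply, mul_add]
  map_smul' c f := by
    rw [RingHom.id_apply, ← MemLp.toLp_const_smul]
    apply MemLp.toLp_congr
    have h : (𝓕 ((c • f : H1sub d) : L2 d) : L2 d) = c • 𝓕 f.1 := fourier_smul c f.1
    rw [h]
    filter_upwards [Lp.coeFn_smul c (𝓕 f.1 : L2 d)] with ξ hξ
    rw [hξ, Pi.smul_apply, Pi.smul_apply, smul_eq_mul, smul_eq_mul]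
    ring

/-- The Sobolev space `H¹(ℝ^d)`; it carries the inner product
`⟪f, g⟫ = ∫ ⟨ξ⟩² conj(𝓕 f) 𝓕 g dξ` defined below. -/
def H1 (d : ℕ) : Type := H1sub d

instance (d : ℕ) : AddCommGroup (H1 d) := inferInstanceAs (AddCommGroup (H1sub d))

instance (d : ℕ) : Module ℂ (H1 d) := inferInstanceAs (Module ℂ (H1sub d))

/-- The inclusion `H¹(ℝ^d) → L²(ℝ^d)`. -/
def H1.incl {d : ℕ} : H1 d →ₗ[ℂ] L2 d := (H1sub d).subtype

theorem H1.incl_injective {d : ℕ} : Function.Injective (H1.incl (d := d)) :=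
  (H1sub d).subtype_injective

/-- The function `⟨ξ⟩ 𝓕 f`, for `f ∈ H¹(ℝ^d)`. -/
def H1.weighted {d : ℕ} : H1 d →ₗ[ℂ] L2 d := H1sub.weighted

theorem H1.coeFn_weighted {d : ℕ} (f : H1 d) :
    H1.weighted f =ᵐ[volume] fun ξ => (japD ξ : ℂ) * (𝓕 (H1.incl f) : L2 d) ξ :=
  MemLp.coeFn_toLp f.2

theorem memLp_inv_japD (d : ℕ) :
    MemLp (fun ξ => (((japD ξ)⁻¹ : ℝ) : ℂ)) ∞ (volume : Measure (E d)) :=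
  memLp_symbol (continuous_japD.inv₀ fun ξ => (japD_pos ξ).ne') 1 fun ξ => by
    rw [abs_of_pos (inv_pos.2 (japD_pos ξ))]
    exact inv_le_one_of_one_le₀ (one_le_japD ξ)

theorem H1.mulOp_weighted {d : ℕ} (f : H1 d) :
    mulOp _ (memLp_inv_japD d) (H1.weighted f) = 𝓕 (H1.incl f) := by
  apply Lp.ext
  filter_upwards [coeFn_mulOp _ (memLp_inv_japD d) (H1.weighted f), H1.coeFn_weighted f]
    with ξ h1 h2
  have : (japD ξ : ℂ) ≠ 0 := by exact_mod_cast (japD_pos ξ).ne'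
  rw [h1, h2]
  push_cast
  field_simp

theorem H1.weighted_injective {d : ℕ} : Function.Injective (H1.weighted (d := d)) := by
  intro f g hfg
  apply H1.incl_injective
  apply (Lp.fourierTransformₗᵢ (E d) ℂ).injective
  change (𝓕 (H1.incl f) : L2 d) = 𝓕 (H1.incl g)
  rw [← H1.mulOp_weighted, ← H1.mulOp_weighted, hfg]

theorem H1.weighted_surjective {d : ℕ} : Function.Surjective (H1.weighted (d := d)) := by
  intro w
  set f : L2 d := 𝓕⁻ (mulOp _ (memLp_inv_japD d) w) with hf
  have hF : (𝓕 f : L2 d) = mulOp _ (memLp_inv_japD d) w :=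
    (Lp.fourierTransformₗᵢ (E d) ℂ).apply_symm_apply _
  have hae : (fun ξ => (japD ξ : ℂ) * (𝓕 f : L2 d) ξ) =ᵐ[volume] w := by
    rw [hF]
    filter_upwards [coeFn_mulOp _ (memLp_inv_japD d) w] with ξ h1
    have : (japD ξ : ℂ) ≠ 0 := by exact_mod_cast (japD_pos ξ).ne'
    rw [h1]
    push_cast
    field_simp
  have hmem : f ∈ H1sub d := (Lp.memLp w).ae_eq hae.symm
  refine ⟨⟨f, hmem⟩, ?_⟩
  apply Lp.ext
  exact (MemLp.coeFn_toLp hmem).trans hae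

instance (d : ℕ) : NormedAddCommGroup (H1 d) :=
  NormedAddCommGroup.induced (H1 d) (L2 d) (H1.weighted (d := d)) H1.weighted_injective

theorem H1.norm_def {d : ℕ} (f : H1 d) : ‖f‖ = ‖H1.weighted f‖ := rfl

instance (d : ℕ) : InnerProductSpace ℂ (H1 d) where
  norm_smul_le c f := by
    rw [H1.norm_def, H1.norm_def, map_smul, norm_smul]
  inner f g := inner ℂ (H1.weighted f) (H1.weighted g)
  norm_sq_eq_re_inner f := norm_sq_eq_re_inner (𝕜 := ℂ) (H1.weighted f)
  conj_inner_symm f g := inner_conj_symm (𝕜 := ℂ) (H1.weighted f) (H1.weighted g)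
  add_left f g h := by
    rw [map_add, inner_add_left]
  smul_left f g c := by
    rw [map_smul, inner_smul_left]

/-- The unitary operator `⟨D⟩ : H¹(ℝ^d) → L²(ℝ^d)`, `f ↦ 𝓕⁻¹ (⟨ξ⟩ 𝓕 f)`. -/
def H1.jap {d : ℕ} : H1 d ≃ₗᵢ[ℂ] L2 d :=
  (LinearIsometryEquiv.ofSurjective
    { toLinearMap := H1.weighted (d := d), norm_map' := fun _ => rfl }
    H1.weighted_surjective).trans (Lp.fourierTransformₗᵢ (E d) ℂ).symm

/-- `⟨D⟩` as a bounded operator `H¹(ℝ^d) → L²(ℝ^d)`. -/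
def H1.japL {d : ℕ} : H1 d →L[ℂ] L2 d :=
  (H1.jap (d := d)).toContinuousLinearEquiv.toContinuousLinearMap

/-- `⟨D⟩⁻¹` as a bounded operator `L²(ℝ^d) → H¹(ℝ^d)`. -/
def H1.japInvL {d : ℕ} : L2 d →L[ℂ] H1 d :=
  (H1.jap (d := d)).symm.toContinuousLinearEquiv.toContinuousLinearMap

instance (d : ℕ) : CompleteSpace (H1 d) :=
  (completeSpace_congr (e := (H1.jap (d := d)).toLinearEquiv.toEquiv)
    (H1.jap (d := d)).isometry.isUniformEmbedding).2 inferInstance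

/-! ### The free wave group -/

theorem memLp_cos (d : ℕ) (t : ℝ) :
    MemLp (fun ξ => ((Real.cos (t * absD ξ) : ℝ) : ℂ)) ∞ (volume : Measure (E d)) :=
  memLp_symbol (by have := continuous_absD (d := d); fun_prop) 1 fun ξ => Real.abs_cos_le_one _

theorem abs_mul_sinc_le {a t : ℝ} (ha : 0 ≤ a) : a * |t * Real.sinc (t * a)| ≤ 1 := by
  rcases eq_or_ne (t * a) 0 with h | h
  · rcases mul_eq_zero.1 h with h | h <;> simp [h]
  · have ht : t ≠ 0 := left_ne_zero_of_mul h
    have ha' : a ≠ 0 := right_ne_zero_of_mul h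
    rw [Real.sinc_of_ne_zero h]
    have : t * (Real.sin (t * a) / (t * a)) = Real.sin (t * a) / a := by field_simp
    rw [this, abs_div, abs_of_nonneg ha, mul_div_cancel₀ _ ha']
    exact Real.abs_sin_le_one _

theorem memLp_japD_sinc (d : ℕ) (t : ℝ) :
    MemLp (fun ξ => ((japD ξ * (t * Real.sinc (t * absD ξ)) : ℝ) : ℂ)) ∞
      (volume : Measure (E d)) :=
  memLp_symbol
    (by
      have := continuous_absD (d := d)
      have := continuous_japD (d := d)
      have := Real.continuous_sinc
      fun_prop)
    (|t| + 1) fun ξ => by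
      have h1 : |t * Real.sinc (t * absD ξ)| ≤ |t| := by
        rw [abs_mul]
        exact mul_le_of_le_one_right (abs_nonneg t) (Real.abs_sinc_le_one _)
      have h2 := abs_mul_sinc_le (t := t) (absD_nonneg ξ)
      rw [abs_mul, abs_of_pos (japD_pos ξ)]
      nlinarith [japD_le ξ, abs_nonneg (t * Real.sinc (t * absD ξ))]

theorem memLp_absD_sin (d : ℕ) (t : ℝ) :
    MemLp (fun ξ => ((-(absD ξ * Real.sin (t * absD ξ)) / japD ξ : ℝ) : ℂ)) ∞
      (volume : Measure (E d)) :=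
  memLp_symbol
    (by
      have h1 := continuous_absD (d := d)
      have h2 := continuous_japD (d := d)
      exact Continuous.div (by fun_prop) h2 fun ξ => (japD_pos ξ).ne')
    1 fun ξ => by
      rw [abs_div, abs_neg, abs_mul, abs_of_nonneg (absD_nonneg ξ), abs_of_pos (japD_pos ξ),
        div_le_one (japD_pos ξ)]
      nlinarith [absD_le_japD ξ, absD_nonneg ξ, Real.abs_sin_le_one (t * absD ξ)]

/-- `C(t) = cos(t|D|)` on `L²(ℝ^d)`. -/
def cosL2 {d : ℕ} (t : ℝ) : L2 d →L[ℂ] L2 d := fourierMul _ (memLp_cos d t)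

/-- `C(t) = cos(t|D|)` on `H¹(ℝ^d)`, written as `⟨D⟩⁻¹ cos(t|D|) ⟨D⟩`. -/
def cosH1 {d : ℕ} (t : ℝ) : H1 d →L[ℂ] H1 d :=
  H1.japInvL ∘L cosL2 t ∘L
    H1.japL

/-- `S(t) = sin(t|D|)/|D|` from `L²(ℝ^d)` to `H¹(ℝ^d)`, written as `⟨D⟩⁻¹ (⟨D⟩ sin(t|D|)/|D|)`;
the function `sin(tr)/r` is `t sinc(tr)`. -/
def sinL2H1 {d : ℕ} (t : ℝ) : L2 d →L[ℂ] H1 d :=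
  H1.japInvL ∘L fourierMul _ (memLp_japD_sinc d t)

/-- `Δ S(t) = -|D| sin(t|D|)` from `H¹(ℝ^d)` to `L²(ℝ^d)`,
written as `(-|D| sin(t|D|) ⟨D⟩⁻¹) ⟨D⟩`. -/
def lapSinH1L2 {d : ℕ} (t : ℝ) : H1 d →L[ℂ] L2 d :=
  fourierMul _ (memLp_absD_sin d t) ∘L H1.japL

/-- The state space `H¹(ℝ^d) × L²(ℝ^d)` with its Hilbert space structure. -/
abbrev State (d : ℕ) : Type := WithLp 2 (H1 d × L2 d)

/-- The free wave group `U₀(t) = [[C(t), S(t)], [Δ S(t), C(t)]]`. -/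
def freeWave {d : ℕ} (t : ℝ) (h : State d) : State d :=
  WithLp.toLp 2 (cosH1 t h.fst + sinL2H1 t h.snd, lapSinH1L2 t h.fst + cosL2 t h.snd)

/-! ### The Duhamel terms -/

/-- The operator `[[0, 0], [V, 0]]` on `H¹(ℝ^d) × L²(ℝ^d)`, for bounded `V`. -/
def potential {d : ℕ} (V : E d → ℂ) (hV : MemLp V ∞ volume) (h : State d) : State d :=
  WithLp.toLp 2 (0, mulOp V hV (H1.incl h.fst))

/-- The operator `(Λ F)(t) = ∫₀ᵗ U₀(t-s) F(s) ds` on functions of time with values in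
`H¹(ℝ^d) × L²(ℝ^d)`. -/
def duhamel {d : ℕ} (F : ℝ → State d) (t : ℝ) : State d :=
  ∫ s in (0 : ℝ)..t, freeWave (t - s) (F s)

/-- The `k`-th Duhamel term `t ↦ W_{k,V}(t) h = ((Λ 𝐕)^k U₀ h)(t)`. -/
def duhamelTerm {d : ℕ} (V : E d → ℂ) (hV : MemLp V ∞ volume) (k : ℕ) (h : State d) :
    ℝ → State d :=
  (fun F : ℝ → State d => duhamel fun s => potential V hV (F s))^[k] fun t => freeWave t h

/-- `A` is the bounded operator `⟨φ, W_{k,V}⟩ = ∫ φ(t) W_{k,V}(t) dt` on `H¹(ℝ^d) × L²(ℝ^d)`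
(the integral converges in the strong sense, that is, when applied to each vector). -/
def IsPairing {d : ℕ} (φ : ℝ → ℂ) (V : E d → ℂ) (hV : MemLp V ∞ volume) (k : ℕ)
    (A : State d →L[ℂ] State d) : Prop :=
  ∀ h : State d, Integrable (fun t => φ t • duhamelTerm V hV k h t) ∧
    A h = ∫ t, φ t • duhamelTerm V hV k h t

/-! ### Traces -/

/-- A bounded operator on a Hilbert space is trace class if it is a sum
`∑ ⟪x_n, ·⟫ y_n` of operators of rank one with `∑ ‖x_n‖ ‖y_n‖ < ∞`. -/
def IsTraceClass {H : Type} [NormedAddCommGroup H] [InnerProductSpace ℂ H]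
    (A : H →L[ℂ] H) : Prop :=
  ∃ x y : ℕ → H, Summable (fun n => ‖x n‖ * ‖y n‖) ∧
    ∀ h : H, HasSum (fun n => inner ℂ (x n) h • y n) (A h)

/-- `A` is trace class, with trace `τ`: in every Hilbert basis `b`, the series
`∑ ⟪b_i, A b_i⟫` converges to `τ`. -/
def HasTrace {H : Type} [NormedAddCommGroup H] [InnerProductSpace ℂ H]
    (A : H →L[ℂ] H) (τ : ℂ) : Prop :=
  IsTraceClass A ∧ ∀ (ι : Type) (b : HilbertBasis ι ℂ H),
    HasSum (fun i => inner ℂ (b i) (A (b i))) τ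

/-! ### The geometry of the support -/

/-- For `u = (u_2, …, u_k)` with `n = k - 1` entries, the length
`|u_2| + |u_3 - u_2| + ⋯ + |u_k - u_{k-1}| + |u_k|` of the closed polygon
`0, u_2, …, u_k, 0`. -/
def loopLength {d n : ℕ} (u : Fin n → E d) : ℝ :=
  ∑ i : Fin (n + 1), ‖(Fin.snoc (Fin.cons 0 u : Fin (n + 1) → E d) 0 : Fin (n + 2) → E d) i.succ -
    (Fin.snoc (Fin.cons 0 u : Fin (n + 1) → E d) 0 : Fin (n + 2) → E d) i.castSucc‖

/-- The function `(u_1, u') ↦ V(u_1) ∏_{j=2}^k V(u_1 + t u_j)`, with `u' = (u_2, …, u_k)`. -/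
def potentialProduct {d n : ℕ} (V : E d → ℂ) (t : ℝ) (p : E d × (Fin n → E d)) : ℂ :=
  V p.1 * ∏ j, V (p.1 + t • p.2 j)

end WaveTrace

end

/-! Let R = (p² - Δ)⁻¹ with p = 1 - 2πis. The Laplace transform in time turns the Duhamel
convolutions into products: the transform of W_k is Out (VR)^k In, with In (f, g) = pf + g and Out v
= (Rv, pRv) (`laplace_duhamelTerm`). Since φ(t)e^t has a rapidly decreasing Fourier transform, φ(t)
is a superposition over s of the weights e^{-pt}, so the integral of φ W_k over (0, ∞) is a
superposition of these transforms (`integral_expHat_smul_laplace`).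

For k ≥ 2 write (VR)^k = (VR)^{k-2} V (RV) R. The factor RV is an integral over y of rank one pieces
built from the Green function with pole y, which is square integrable because d ≤ 3. Hence the
half-line operator has the form ∫ ⟨x_z, ·⟩ y_z dz with x and y square integrable in z = (s, y). This
is a product of two Hilbert-Schmidt operators, so it is trace class with trace ∫ ⟨x_z, y_z⟩ dz
(`hasTrace_of_integral`, `exists_hasTrace_integral_Ioi`). As In Out = 2pR, the trace is formally
that of (VR)^{k-1} V (2pR²): one of the k resolvents is replaced by 2pR² = -dR/dp.

By descent from dimension 3, the kernel of R on ℝ^d is the integral over ℝ^m, m = 3 - d, of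
e^{-pr}/(4πr), and that of 2pR² is the integral of e^{-pr}/(4π); the only difference is a factor r.
So the trace is an integral over closed polygons with k vertices in ℝ^d whose edges carry extra
coordinates in ℝ^m: V at the vertices, 1/(4πr) along the edges, e^{-pℓ} for the total length ℓ, and
the length of one edge. By cyclic symmetry that length may be replaced by ℓ/k
(`integral_potentialProduct_len_mul`). Integration over s turns e^{-pℓ} back into φ(ℓ). The
reflection (f, g) ↦ (f, -g) reverses time, so for even φ the negative half line contributes the same
trace.

The measure on polygons is homogeneous of degree (k-1)d + k(3-d) - k = 2k - d. In polar coordinates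
with radius ℓ it is t^{2k-d-1} dt times a finite measure on shapes (`map_loopMeasure`), and σ_k is
2/k times the shape measure.

Support: an edge in ℝ^d is no longer than the edge with its extra coordinates. Mass: ∫ e^{-ℓ} is
(2k-d-1)! times the mass of shapes and also, by Plancherel, ∫ (1 + |2πξ|²)^{-k} dξ, a quotient of
Gamma values (`shapeMeasure_real_univ`). Absolute continuity: if m ≥ 1, then for a fixed polygon in
ℝ^d the length pulls null sets back to null sets in the extra coordinates (`volume_len_mem`). -/

namespace WaveTrace

/-! ### Trace class operators as integrals of rank one operators -/

section TraceClass

variable {H : Type} [NormedAddCommGroup H] [InnerProductSpace ℂ H]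

/-- Distinct basis vectors are at distance √2, so the balls of radius 1/2 around them are disjoint
open sets, and a separable space has only countably many of these. -/
theorem countable_of_hilbertBasis {K : Type*} [NormedAddCommGroup K] [InnerProductSpace ℂ K]
    [TopologicalSpace.SeparableSpace K] {ι : Type*} (b : HilbertBasis ι ℂ K) : Countable ι := by
  have hd : (Set.univ : Set ι).PairwiseDisjoint fun i => Metric.ball (b i) (1 / 2) := by
    intro i _ j _ hij
    apply Metric.ball_disjoint_ball
    have h1 : ‖b i - b j‖ ^ 2 = 2 := by
      have h := norm_sub_sq (𝕜 := ℂ) (b i) (b j)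
      rw [b.orthonormal.1 i, b.orthonormal.1 j, b.orthonormal.2 hij] at h
      rw [h]; norm_num
    rw [dist_eq_norm]
    nlinarith [norm_nonneg (b i - b j)]
  have := hd.countable_of_isOpen (fun i _ => Metric.isOpen_ball)
    (fun i _ => ⟨b i, Metric.mem_ball_self (by norm_num)⟩)
  exact Set.countable_univ_iff.1 this

theorem hasSum_norm_inner_sq {K : Type*} [NormedAddCommGroup K] [InnerProductSpace ℂ K]
    {ι : Type*} (b : HilbertBasis ι ℂ K) (u : K) :
    HasSum (fun i => ‖inner ℂ u (b i)‖ ^ 2) (‖u‖ ^ 2) := by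
  have := (Complex.hasSum_iff _ _).1 (b.hasSum_inner_mul_inner u u)
  convert this.1 using 1
  · funext j
    rw [← inner_conj_symm (b j) u, Complex.mul_conj, Complex.normSq_eq_norm_sq, Complex.ofReal_re]
  · exact norm_sq_eq_re_inner (𝕜 := ℂ) u

theorem tsum_enorm_inner_sq {K : Type*} [NormedAddCommGroup K] [InnerProductSpace ℂ K]
    {ι : Type*} (b : HilbertBasis ι ℂ K) (u : K) :
    ∑' i, ‖inner ℂ u (b i)‖ₑ ^ 2 = ‖u‖ₑ ^ 2 := by
  have h2 := hasSum_norm_inner_sq b u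
  have h3 := ENNReal.ofReal_tsum_of_nonneg (fun j => by positivity) h2.summable
  rw [h2.tsum_eq] at h3
  simp only [ENNReal.ofReal_pow (norm_nonneg _), ofReal_norm] at h3
  exact h3.symm

theorem isTraceClass_of_countable {ι : Type*} [Countable ι] {A : H →L[ℂ] H} (x y : ι → H)
    (hs : Summable fun i => ‖x i‖ * ‖y i‖) (hA : ∀ h,
      HasSum (fun i => inner ℂ (x i) h • y i) (A h)) :
    IsTraceClass A := by
  obtain ⟨f, hf⟩ := exists_injective_nat ι
  refine ⟨Function.extend f x 0, Function.extend f y 0, ?_, fun h => ?_⟩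
  · have : (fun n => ‖Function.extend f x 0 n‖ * ‖Function.extend f y 0 n‖) =
        Function.extend f (fun i => ‖x i‖ * ‖y i‖) 0 := by
      funext n
      by_cases hn : ∃ i, f i = n
      · obtain ⟨i, rfl⟩ := hn
        simp only [hf.extend_apply]
      · simp [Function.extend_apply' _ _ _ hn]
    rw [this]
    exact (summable_extend_zero hf).2 hs
  · have : (fun n => inner ℂ (Function.extend f x 0 n) h • Function.extend f y 0 n) =
        Function.extend f (fun i => inner ℂ (x i) h • y i) 0 := by
      funext n
      by_cases hn : ∃ i, f i = n
      · obtain ⟨i, rfl⟩ := hn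
        simp only [hf.extend_apply]
      · simp [Function.extend_apply' _ _ _ hn]
    rw [this]
    exact (hasSum_extend_zero hf).2 (hA h)

theorem IsTraceClass.add {A B : H →L[ℂ] H} (hA : IsTraceClass A) (hB : IsTraceClass B) :
    IsTraceClass (A + B) := by
  obtain ⟨x, y, hs, hxy⟩ := hA
  obtain ⟨x', y', hs', hxy'⟩ := hB
  refine isTraceClass_of_countable (ι := ℕ ⊕ ℕ) (Sum.elim x x') (Sum.elim y y') ?_ fun h => ?_
  · exact (HasSum.sum (f := fun i => ‖Sum.elim x x' i‖ * ‖Sum.elim y y' i‖)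
      hs.hasSum hs'.hasSum).summable
  · exact HasSum.sum (f := fun i => inner ℂ (Sum.elim x x' i) h • Sum.elim y y' i)
      (hxy h) (hxy' h)

theorem HasTrace.add {A B : H →L[ℂ] H} {a b : ℂ} (hA : HasTrace A a) (hB : HasTrace B b) :
    HasTrace (A + B) (a + b) := by
  refine ⟨hA.1.add hB.1, fun ι e => ?_⟩
  simpa only [add_apply, inner_add_right] using (hA.2 ι e).add (hB.2 ι e)

variable {Z : Type*} [MeasurableSpace Z] {μ : Measure Z}

theorem memLp_inner_left {x : Z → H} (hx : MemLp x 2 μ) (h : H) :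
    MemLp (fun z => inner ℂ (x z) h) 2 μ :=
  (hx.const_inner h).star.ae_eq (Filter.Eventually.of_forall fun z => by simp)

theorem integrable_smul_of_memLp_two {f : Z → ℂ} {y : Z → H} (hf : MemLp f 2 μ)
    (hy : MemLp y 2 μ) : Integrable (fun z => f z • y z) μ := by
  rw [← memLp_one_iff_integrable]
  exact MemLp.smul hy hf

variable [CompleteSpace H]

/-- The operator `f ↦ ∫ f y` from `L²` to `H` given by a square integrable function `y`. -/
noncomputable def l2Map {y : Z → H} (hy : MemLp y 2 μ) : Lp ℂ 2 μ →L[ℂ] H :=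
  ((ContinuousLinearMap.lsmul ℂ ℂ).lpPairing μ 2 2).flip (hy.toLp y)

theorem l2Map_apply {y : Z → H} (hy : MemLp y 2 μ) (f : Lp ℂ 2 μ) :
    l2Map hy f = ∫ z, f z • y z ∂μ := by
  rw [l2Map, ContinuousLinearMap.flip_apply, ContinuousLinearMap.lpPairing_eq_integral]
  apply integral_congr_ae
  filter_upwards [hy.coeFn_toLp] with z hz
  rw [hz]; rfl

theorem inner_l2Map {x : Z → H} (hx : MemLp x 2 μ) (f : Lp ℂ 2 μ) (h : H) :
    inner ℂ (l2Map hx f) h = inner ℂ f ((memLp_inner_left hx h).toLp _) := by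
  rw [l2Map_apply, ← inner_conj_symm, ← integral_inner
    (integrable_smul_of_memLp_two (Lp.memLp f) hx), ← integral_conj, L2.inner_def]
  apply integral_congr_ae
  filter_upwards [(memLp_inner_left hx h).coeFn_toLp] with z hz
  rw [hz, inner_conj_symm, inner_smul_left, RCLike.inner_apply, mul_comm]

/-- This is the Hilbert-Schmidt property of `l2Map hx`. Expanding in a basis of `H` and applying
Parseval in both spaces gives a double sum of nonnegative terms, whose value after interchange is
the integral of ‖x‖². -/
theorem summable_norm_sq_l2Map [TopologicalSpace.SeparableSpace H] {x : Z → H} (hx : MemLp x 2 μ)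
    {ι : Type*} (b : HilbertBasis ι ℂ (Lp ℂ 2 μ)) :
    Summable fun i => ‖l2Map hx (b i)‖ ^ 2 := by
  obtain ⟨w, e, -⟩ := exists_hilbertBasis ℂ H
  have hw : Countable w := countable_of_hilbertBasis e
  have hL : ∀ f : Lp ℂ 2 μ, ∑' i, ‖inner ℂ (b i) f‖ₑ ^ 2 = ∫⁻ z, ‖f z‖ₑ ^ 2 ∂μ := by
    intro f
    have h3 := tsum_enorm_inner_sq b f
    have h4 : ∀ i, ‖inner ℂ (b i) f‖ₑ = ‖inner ℂ f (b i)‖ₑ := fun i => by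
      rw [← ofReal_norm, ← ofReal_norm, norm_inner_symm]
    simp_rw [h4]
    rw [h3, Lp.enorm_def, eLpNorm_eq_lintegral_rpow_enorm_toReal (by simp) (by simp)]
    rw [← ENNReal.rpow_natCast, ← ENNReal.rpow_mul]
    simp
  have hfin : ∑' i, ‖l2Map hx (b i)‖ₑ ^ 2 ≠ ∞ := by
    have : ∑' i, ‖l2Map hx (b i)‖ₑ ^ 2 = ∫⁻ z, ‖x z‖ₑ ^ 2 ∂μ := by
      simp_rw [← tsum_enorm_inner_sq e, inner_l2Map hx]
      rw [ENNReal.tsum_comm]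
      simp_rw [hL]
      rw [← lintegral_tsum]
      · apply lintegral_congr_ae
        have : ∀ᵐ z ∂μ, ∀ j : w, (memLp_inner_left hx (e j)).toLp _ z = inner ℂ (x z) (e j) :=
          ae_all_iff.2 fun j => (memLp_inner_left hx (e j)).coeFn_toLp
        filter_upwards [this] with z hz
        simp_rw [hz]
      · intro j
        exact (Lp.aestronglyMeasurable _).enorm.pow_const _
    rw [this]
    have h2 := hx.2
    rw [eLpNorm_lt_top_iff_lintegral_rpow_enorm_lt_top (by simp) (by simp)] at h2
    simpa using h2.ne
  have := ENNReal.summable_toReal hfin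
  simpa using this

/-- The operator is `l2Map hy` composed with the adjoint of `l2Map hx`. Inserting a basis of L²
between the two Hilbert-Schmidt factors gives the rank one series. In a basis b of `H`, the diagonal
sum is the integral of ∑ ⟨x, b_i⟩⟨b_i, y⟩, which is ⟨x, y⟩ pointwise; the interchange is dominated
by Parseval sums of total size ‖x‖² + ‖y‖². -/
theorem hasTrace_of_integral [TopologicalSpace.SeparableSpace H]
    [TopologicalSpace.SeparableSpace (Lp ℂ 2 μ)] {x y : Z → H} (hx : MemLp x 2 μ)
    (hy : MemLp y 2 μ) {A : H →L[ℂ] H} (hA : ∀ h, A h = ∫ z, inner ℂ (x z) h • y z ∂μ) :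
    HasTrace A (∫ z, inner ℂ (x z) (y z) ∂μ) := by
  constructor
  · obtain ⟨w, b, -⟩ := exists_hilbertBasis ℂ (Lp ℂ 2 μ)
    have hw : Countable w := countable_of_hilbertBasis b
    refine isTraceClass_of_countable (fun i => l2Map hx (b i)) (fun i => l2Map hy (b i)) ?_ ?_
    · refine Summable.of_nonneg_of_le (fun i => by positivity) (fun i => ?_)
        ((summable_norm_sq_l2Map hx b).add (summable_norm_sq_l2Map hy b))
      nlinarith [sq_nonneg (‖l2Map hx (b i)‖ - ‖l2Map hy (b i)‖), sq_nonneg ‖l2Map hx (b i)‖,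
        sq_nonneg ‖l2Map hy (b i)‖]
    · intro h
      have h1 := (b.hasSum_repr ((memLp_inner_left hx h).toLp _)).mapL (l2Map hy)
      have h2 : l2Map hy ((memLp_inner_left hx h).toLp _) = A h := by
        rw [hA, l2Map_apply]
        apply integral_congr_ae
        filter_upwards [(memLp_inner_left hx h).coeFn_toLp] with z hz
        rw [hz]
      rw [h2] at h1
      convert h1 using 1
      funext i
      rw [map_smul, inner_l2Map, b.repr_apply_apply]
  · intro ι b
    have : Countable ι := countable_of_hilbertBasis b
    have hint : ∀ i, Integrable (fun z =>
      inner ℂ (x z) (b i) * inner ℂ (b i) (y z)) μ := fun i => by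
      exact (memLp_inner_left hx (b i)).integrable_mul (hy.const_inner (b i))
    have hAi : ∀ i, inner ℂ (b i) (A (b i)) =
      ∫ z, inner ℂ (x z) (b i) * inner ℂ (b i) (y z) ∂μ := by
      intro i
      rw [hA, ← integral_inner (integrable_smul_of_memLp_two (memLp_inner_left hx (b i)) hy)]
      simp only [inner_smul_right]
    simp_rw [hAi]
    have hbd : Integrable (fun z => ‖x z‖ ^ 2 + ‖y z‖ ^ 2) μ :=
      (hx.integrable_norm_pow (by simp)).add (hy.integrable_norm_pow (by simp))
    have := hasSum_integral_of_dominated_convergence (μ := μ)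
      (F := fun i z => inner ℂ (x z) (b i) * inner ℂ (b i) (y z))
      (f := fun z => inner ℂ (x z) (y z))
      (fun i z => ‖inner ℂ (x z) (b i)‖ ^ 2 + ‖inner ℂ (y z) (b i)‖ ^ 2)
      (fun i => (hint i).1) (fun i => Filter.Eventually.of_forall fun z => ?_)
      (Filter.Eventually.of_forall fun z =>
        ((hasSum_norm_inner_sq b _).add (hasSum_norm_inner_sq b _)).summable) ?_
      (Filter.Eventually.of_forall fun z => b.hasSum_inner_mul_inner _ _)
    · exact this
    · rw [norm_mul, ← norm_inner_symm (y z)]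
      nlinarith [sq_nonneg (‖inner ℂ (x z) (b i)‖ - ‖inner ℂ (y z) (b i)‖),
        sq_nonneg ‖inner ℂ (x z) (b i)‖, sq_nonneg ‖inner ℂ (y z) (b i)‖]
    · convert hbd using 1
      funext z
      exact ((hasSum_norm_inner_sq b _).add (hasSum_norm_inner_sq b _)).tsum_eq

end TraceClass

end WaveTrace

namespace WaveTrace

/-! ### Agreement of the L² and the integral Fourier transforms -/

section FourierL2

variable {d : ℕ}

theorem integral_fourier_mul_flip {f g : E d → ℂ} (hf : Integrable f) (hg : Integrable g) :
    ∫ x, 𝓕 f x * g x = ∫ x, f x * 𝓕 g x := by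
  have := VectorFourier.integral_fourierIntegral_smul_eq_flip (L := innerₗ (E d))
    (μ := (volume : Measure (E d))) (ν := (volume : Measure (E d)))
    Real.continuous_fourierChar continuous_inner hf hg
  rw [flip_innerₗ] at this
  exact this

theorem continuous_fourier_of_integrable {f : E d → ℂ} (hf : Integrable f) : Continuous (𝓕 f) :=
  VectorFourier.fourierIntegral_continuous Real.continuous_fourierChar
    (L := innerₗ (E d)) continuous_inner hf

theorem continuous_fourierInv_of_integrable {f : E d → ℂ} (hf : Integrable f) :
    Continuous (𝓕⁻ f) := by
  have : 𝓕⁻ f = fun w => 𝓕 f (-w) := by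
    funext w; exact Real.fourierInv_eq_fourier_neg f w
  rw [this]
  exact (continuous_fourier_of_integrable hf).comp continuous_neg

theorem ae_eq_of_integral_schwartz {f g : E d → ℂ} (hf : LocallyIntegrable f)
    (hg : LocallyIntegrable g)
    (h : ∀ ψ : SchwartzMap (E d) ℂ, ∫ x, ψ x * f x = ∫ x, ψ x * g x) : f =ᵐ[volume] g := by
  refine ae_eq_of_integral_contDiff_smul_eq hf hg fun ψ hψ hc => ?_
  have h1 : HasCompactSupport fun x => (ψ x : ℂ) := hc.comp_left (g := Complex.ofReal) rfl
  have h2 : ContDiff ℝ (⊤ : ℕ∞) fun x => (ψ x : ℂ) := Complex.ofRealCLM.contDiff.comp hψ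
  simpa using h (h1.toSchwartzMap h2)

theorem integral_schwartz_mul_fourierInv (r : L2 d) (ψ : SchwartzMap (E d) ℂ) :
    ∫ x, ψ x * (𝓕⁻ r : L2 d) x = ∫ x, (𝓕⁻ ψ) x * r x := by
  have h := congrArg (fun T => T ψ) (Lp.fourierInv_toTemperedDistribution_eq r)
  simp only [TemperedDistribution.fourierInv_apply, Lp.toTemperedDistribution_apply,
    smul_eq_mul] at h
  exact h.symm

theorem locallyIntegrable_L2 (f : L2 d) : LocallyIntegrable f (volume : Measure (E d)) :=
  (Lp.memLp f).locallyIntegrable (by norm_num)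

/-- An integrable function whose Fourier transform lies in `L²` is the inverse `L²`-Fourier
transform of it. -/
theorem fourierInv_ae_eq_of_fourier_ae_eq {f : E d → ℂ} (hf : Integrable f) {r : L2 d}
    (hr : 𝓕 f =ᵐ[volume] r) : (𝓕⁻ r : L2 d) =ᵐ[volume] f := by
  refine ae_eq_of_integral_schwartz (locallyIntegrable_L2 _) hf.locallyIntegrable fun ψ => ?_
  rw [integral_schwartz_mul_fourierInv]
  have h1 : ∫ x, (𝓕⁻ ψ) x * r x = ∫ x, (𝓕⁻ ψ) x * 𝓕 f x := by
    apply integral_congr_ae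
    filter_upwards [hr] with x hx
    rw [hx]
  rw [h1, ← integral_fourier_mul_flip (𝓕⁻ ψ).integrable hf, ← SchwartzMap.fourier_coe,
    FourierTransform.fourier_fourierInv_eq]

/-- Both versions of the inverse transform move onto a Schwartz test function in the same way, and
Schwartz functions separate locally integrable functions. -/
theorem fourierInv_ae_eq_of_integrable {r : L2 d} (hr : Integrable r (volume : Measure (E d))) :
    (𝓕⁻ r : L2 d) =ᵐ[volume] 𝓕⁻ (r : E d → ℂ) := by
  refine ae_eq_of_integral_schwartz (locallyIntegrable_L2 _)
    (continuous_fourierInv_of_integrable hr).locallyIntegrable fun ψ => ?_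
  rw [integral_schwartz_mul_fourierInv]
  have h2 : ∀ x, 𝓕⁻ (r : E d → ℂ) x = 𝓕 (fun y => r (-y)) x := fun x => by
    rw [Real.fourierInv_eq_fourier_comp_neg]
  have h3 : Integrable (fun y => r (-y)) (volume : Measure (E d)) := hr.comp_neg
  simp_rw [h2]
  rw [← integral_fourier_mul_flip ψ.integrable h3]
  rw [← integral_neg_eq_self]
  congr 1
  funext x
  rw [SchwartzMap.fourierInv_coe, Real.fourierInv_eq_fourier_neg, neg_neg]

end FourierL2

end WaveTrace

namespace WaveTrace

/-! ### Fourier transform of the Yukawa potential in dimension three -/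

section Yukawa

open Filter Topology

/-- The function `x ↦ e^{-p r} / (4 π r)`, the Yukawa potential as function of the radius. -/
noncomputable def yukawa (p : ℂ) (r : ℝ) : ℂ := Complex.exp (-p * r) / (4 * Real.pi * r)

theorem norm_yukawa (p : ℂ) {r : ℝ} (hr : 0 ≤ r) :
    ‖yukawa p r‖ = Real.exp (-p.re * r) / (4 * Real.pi * r) := by
  rw [yukawa, norm_div, Complex.norm_exp]
  congr 1
  · simp
  · simp [abs_of_nonneg hr, abs_of_pos Real.pi_pos]

theorem yukawa_ofReal (c r : ℝ) :
    yukawa c r = ((Real.exp (-c * r) / (4 * Real.pi * r) : ℝ) : ℂ) := by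
  simp [yukawa]

theorem measurable_yukawa (p : ℂ) : Measurable (yukawa p) := by
  unfold yukawa; fun_prop

/-- In polar coordinates the integrand of the Yukawa potential over a plane at height s is an exact
derivative, so its integral is elementary. -/
theorem hasDerivAt_exp_sqrt (p : ℂ) (hp : p ≠ 0) (s : ℝ) {r : ℝ} (hr : 0 < r) :
    HasDerivAt (fun r : ℝ => -Complex.exp (-p * Real.sqrt (s ^ 2 + r ^ 2)) / (4 * Real.pi * p))
      (r * yukawa p (Real.sqrt (s ^ 2 + r ^ 2))) r := by
  have hpos : 0 < s ^ 2 + r ^ 2 := by positivity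
  have h1 : HasDerivAt (fun r : ℝ => Real.sqrt (s ^ 2 + r ^ 2))
      (r / Real.sqrt (s ^ 2 + r ^ 2)) r := by
    have : HasDerivAt (fun r : ℝ => s ^ 2 + r ^ 2) (2 * r) r := by
      simpa using (hasDerivAt_pow 2 r).const_add (s ^ 2)
    refine (this.sqrt hpos.ne').congr_deriv ?_
    field_simp
  have h2 := ((h1.ofReal_comp.const_mul (-p)).cexp.neg.div_const (4 * Real.pi * p))
  refine h2.congr_deriv ?_
  have h3 : (Real.sqrt (s ^ 2 + r ^ 2) : ℂ) ≠ 0 := by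
    exact_mod_cast (Real.sqrt_pos.2 hpos).ne'
  have h4 : (Real.pi : ℂ) ≠ 0 := by exact_mod_cast Real.pi_ne_zero
  rw [yukawa]
  push_cast
  field_simp

theorem tendsto_sqrt_add_atTop (s : ℝ) :
    Tendsto (fun r : ℝ => Real.sqrt (s ^ 2 + r ^ 2)) atTop atTop := by
  refine tendsto_atTop_mono (fun r => ?_) tendsto_id
  exact Real.le_sqrt_of_sq_le (by simp only [id]; nlinarith [sq_nonneg s])

theorem tendsto_exp_sqrt {p : ℂ} (hp : 0 < p.re) (s : ℝ) :
    Tendsto (fun r : ℝ => -Complex.exp (-p * Real.sqrt (s ^ 2 + r ^ 2)) / (4 * Real.pi * p))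
      atTop (𝓝 0) := by
  have h1 : Tendsto (fun r : ℝ => Complex.exp (-p * Real.sqrt (s ^ 2 + r ^ 2))) atTop (𝓝 0) := by
    rw [tendsto_zero_iff_norm_tendsto_zero]
    simp only [Complex.norm_exp]
    refine Real.tendsto_exp_atBot.comp ?_
    have : Tendsto (fun r : ℝ => -(p.re * Real.sqrt (s ^ 2 + r ^ 2))) atTop atBot :=
      tendsto_neg_atTop_atBot.comp ((tendsto_sqrt_add_atTop s).const_mul_atTop hp)
    refine this.congr fun r => ?_
    simp
  simpa using (h1.neg.div_const (4 * Real.pi * p))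

theorem integrableOn_yukawa_sqrt {p : ℂ} (hp : 0 < p.re) (s : ℝ) :
    IntegrableOn (fun r : ℝ => r * yukawa p (Real.sqrt (s ^ 2 + r ^ 2))) (Set.Ioi 0) := by
  have hreal : IntegrableOn (fun r : ℝ => r * (Real.exp (-p.re * Real.sqrt (s ^ 2 + r ^ 2)) /
      (4 * Real.pi * Real.sqrt (s ^ 2 + r ^ 2)))) (Set.Ioi 0) := by
    have hp0 : (p.re : ℂ) ≠ 0 := by exact_mod_cast hp.ne'
    refine integrableOn_Ioi_deriv_of_nonneg (l := 0)
      (g := fun r : ℝ => -Real.exp (-p.re * Real.sqrt (s ^ 2 + r ^ 2)) / (4 * Real.pi * p.re))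
      ?_ ?_ ?_ ?_
    · apply Continuous.continuousWithinAt; fun_prop
    · intro r hr
      have := Complex.reCLM.hasFDerivAt.comp_hasDerivAt r (hasDerivAt_exp_sqrt p.re hp0 s hr)
      have e1 : (fun r : ℝ => -Real.exp (-p.re * Real.sqrt (s ^ 2 + r ^ 2)) /
          (4 * Real.pi * p.re)) = Complex.reCLM ∘ fun r : ℝ =>
            -Complex.exp (-p.re * Real.sqrt (s ^ 2 + r ^ 2)) / (4 * Real.pi * p.re) := by
        funext r
        simp only [Function.comp, Complex.reCLM_apply]
        norm_cast
      rw [e1]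
      refine this.congr_deriv ?_
      rw [yukawa_ofReal, Complex.reCLM_apply]
      norm_cast
    · intro r hr
      have : (0 : ℝ) < r := hr
      positivity
    · have := tendsto_exp_sqrt (p := p.re) (by simpa using hp) s
      have := (Complex.continuous_re.tendsto _).comp this
      refine this.congr fun r => ?_
      simp only [Function.comp]
      norm_cast
  refine Integrable.mono' hreal ?_ ?_
  · apply Measurable.aestronglyMeasurable
    have := measurable_yukawa p
    fun_prop
  · refine (ae_restrict_iff' measurableSet_Ioi).2 (Eventually.of_forall fun r hr => ?_)
    have : (0 : ℝ) < r := hr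
    rw [norm_mul, norm_yukawa _ (Real.sqrt_nonneg _)]
    simp [abs_of_pos this]

theorem integral_yukawa_sqrt {p : ℂ} (hp : 0 < p.re) (s : ℝ) :
    ∫ r in Set.Ioi (0 : ℝ), r * yukawa p (Real.sqrt (s ^ 2 + r ^ 2)) =
      Complex.exp (-p * |s|) / (4 * Real.pi * p) := by
  have hp0 : p ≠ 0 := by rintro rfl; simp at hp
  rw [integral_Ioi_of_hasDerivAt_of_tendsto
    (Continuous.continuousWithinAt (by fun_prop)) (fun r hr => hasDerivAt_exp_sqrt p hp0 s hr)
    (integrableOn_yukawa_sqrt hp s) (tendsto_exp_sqrt hp s)]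
  simp [Real.sqrt_sq_eq_abs, neg_div]

/-- Integrating out two of the three dimensions leaves the one-dimensional Green function
e^{-p|s|}/(2p). -/
theorem integral_yukawa_plane {p : ℂ} (hp : 0 < p.re) (s : ℝ) :
    ∫ x : E 2, yukawa p (Real.sqrt (s ^ 2 + ‖x‖ ^ 2)) = Complex.exp (-p * |s|) / (2 * p) := by
  have hp0 : p ≠ 0 := by rintro rfl; simp at hp
  rw [integral_fun_norm_addHaar volume (fun r => yukawa p (Real.sqrt (s ^ 2 + r ^ 2)))]
  have hball : (volume : Measure (E 2)).real (Metric.ball 0 1) = Real.pi := by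
    simp [Measure.real, EuclideanSpace.volume_ball, Real.pi_pos.le, one_add_one_eq_two]
  have h4 : (Real.pi : ℂ) ≠ 0 := by exact_mod_cast Real.pi_ne_zero
  have h := integral_yukawa_sqrt hp s
  simp only [finrank_euclideanSpace, Fintype.card_fin, Nat.reduceSub, pow_one, hball,
    Complex.real_smul, h]
  simp only [nsmul_eq_mul]
  push_cast
  field_simp
  norm_num

theorem integrable_exp_abs {p : ℂ} (hp : 0 < p.re) (b : ℝ) :
    Integrable fun s : ℝ => Complex.exp (-p * |s|) * Complex.exp (-(b * s) * Complex.I) := by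
  have h2 : Integrable fun s : ℝ => Real.exp (-p.re * |s|) := by
    have := integrable_fun_norm_addHaar (volume : Measure ℝ) (f := fun s => Real.exp (-p.re * s))
    simp only [Module.finrank_self, Nat.sub_self, pow_zero, one_smul, Real.norm_eq_abs] at this
    exact this.2 (exp_neg_integrableOn_Ioi 0 hp)
  refine h2.mono' (by fun_prop) (Eventually.of_forall fun s => ?_)
  rw [norm_mul, Complex.norm_exp, Complex.norm_exp]
  simp

theorem integral_exp_abs {p : ℂ} (hp : 0 < p.re) (b : ℝ) :
    ∫ s : ℝ, Complex.exp (-p * |s|) * Complex.exp (-(b * s) * Complex.I) =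
      2 * p / (p ^ 2 + b ^ 2) := by
  have hi := integrable_exp_abs hp b
  have ha : (-p - b * Complex.I).re < 0 := by simpa using hp
  have hb : (-p + b * Complex.I).re < 0 := by simpa using hp
  have ha0 : -p - b * Complex.I ≠ 0 := by intro h; rw [h] at ha; simp at ha
  have hb0 : -p + b * Complex.I ≠ 0 := by intro h; rw [h] at hb; simp at hb
  rw [← intervalIntegral.integral_Iic_add_Ioi (b := 0) hi.integrableOn hi.integrableOn]
  have e1 : ∫ s in Set.Ioi (0 : ℝ), Complex.exp (-p * |s|) *
      Complex.exp (-(b * s) * Complex.I) = -1 / (-p - b * Complex.I) := by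
    have := integral_exp_mul_complex_Ioi ha 0
    simp only [Complex.ofReal_zero, mul_zero, Complex.exp_zero] at this
    rw [← this]
    refine setIntegral_congr_fun measurableSet_Ioi fun s hs => ?_
    simp only [abs_of_pos (Set.mem_Ioi.1 hs), ← Complex.exp_add]
    congr 1; ring
  have e2 : ∫ s in Set.Iic (0 : ℝ), Complex.exp (-p * |s|) *
      Complex.exp (-(b * s) * Complex.I) = -1 / (-p + b * Complex.I) := by
    have := integral_exp_mul_complex_Ioi hb 0
    simp only [Complex.ofReal_zero, mul_zero, Complex.exp_zero] at this
    rw [← this, ← neg_zero, ← integral_comp_neg_Iic, neg_zero]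
    refine setIntegral_congr_fun measurableSet_Iic fun s hs => ?_
    simp only [abs_of_nonpos (Set.mem_Iic.1 hs), ← Complex.exp_add]
    congr 1; push_cast; ring
  have hab : p ^ 2 + (b : ℂ) ^ 2 = (-p - b * Complex.I) * (-p + b * Complex.I) := by
    ring_nf; rw [Complex.I_sq]; ring
  rw [e1, e2, hab]
  field_simp
  ring

/-- Two vectors of equal norm are exchanged by the reflection in the hyperplane orthogonal to their
difference. The space is kept abstract so that it can be the product of `E d` and `E m` for every d
+ m = 3. -/
theorem exists_isometry_apply_eq {W : Type*} [NormedAddCommGroup W] [InnerProductSpace ℝ W]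
    [FiniteDimensional ℝ W] (hW : Module.finrank ℝ W = 3) (ξ : W) :
    ∃ A : W ≃ₗᵢ[ℝ] WithLp 2 (ℝ × E 2), A ξ = WithLp.toLp 2 (‖ξ‖, 0) := by
  have hV : Module.finrank ℝ (WithLp 2 (ℝ × E 2)) = 3 := by
    rw [(WithLp.linearEquiv 2 ℝ (ℝ × E 2)).finrank_eq]; simp
  let B : W ≃ₗᵢ[ℝ] WithLp 2 (ℝ × E 2) :=
    (stdOrthonormalBasis ℝ W).equiv (stdOrthonormalBasis ℝ (WithLp 2 (ℝ × E 2)))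
      (finCongr (hW.trans hV.symm))
  have hn : ‖B ξ‖ = ‖(WithLp.toLp 2 (‖ξ‖, 0) : WithLp 2 (ℝ × E 2))‖ := by
    rw [B.norm_map, WithLp.prod_norm_eq_of_L2]
    simp [Real.sqrt_sq]
  exact ⟨B.trans (Submodule.reflection (Submodule.span ℝ
    {B ξ - (WithLp.toLp 2 (‖ξ‖, 0) : WithLp 2 (ℝ × E 2))})ᗮ), Submodule.reflection_sub hn⟩

variable {W : Type*} [NormedAddCommGroup W] [InnerProductSpace ℝ W] [FiniteDimensional ℝ W]
  [MeasurableSpace W] [BorelSpace W]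

theorem integrable_yukawa_norm (hW : Module.finrank ℝ W = 3) {p : ℂ} (hp : 0 < p.re) :
    Integrable fun Y : W => yukawa p ‖Y‖ := by
  have : Nontrivial W := Module.nontrivial_of_finrank_pos (R := ℝ) (by omega)
  rw [integrable_fun_norm_addHaar volume (f := yukawa p), hW]
  have h2 : IntegrableOn (fun r : ℝ => (4 * Real.pi : ℂ)⁻¹ * (r * Complex.exp (-p * r)))
      (Set.Ioi 0) := by
    refine Integrable.const_mul ?_ _
    have h3 := integrableOn_rpow_mul_exp_neg_mul_rpow (s := 1) (p := 1) (b := p.re)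
      (by norm_num) one_pos hp
    simp only [Real.rpow_one] at h3
    refine Integrable.mono' h3 (by fun_prop) ?_
    refine (ae_restrict_iff' measurableSet_Ioi).2 (Eventually.of_forall fun r hr => ?_)
    rw [norm_mul, Complex.norm_exp]
    simp [abs_of_pos (Set.mem_Ioi.1 hr)]
  refine h2.congr_fun (fun r hr => ?_) measurableSet_Ioi
  have hr' : (r : ℂ) ≠ 0 := by exact_mod_cast (Set.mem_Ioi.1 hr).ne'
  have h4 : (Real.pi : ℂ) ≠ 0 := by exact_mod_cast Real.pi_ne_zero
  simp only [yukawa, Complex.real_smul]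
  push_cast
  field_simp

/-- The potential is radial, so ξ may be rotated onto the first axis. The phase then depends on one
coordinate only; the two others are integrated out and a one-dimensional Fourier integral remains.
-/
theorem integral_yukawa_mul_exp (hW : Module.finrank ℝ W = 3) {p : ℂ} (hp : 0 < p.re) (ξ : W) :
    ∫ Y : W, yukawa p ‖Y‖ * Complex.exp (-(2 * Real.pi * inner ℝ Y ξ : ℝ) * Complex.I) =
      1 / (p ^ 2 + (2 * Real.pi * ‖ξ‖ : ℝ) ^ 2) := by
  obtain ⟨A, hA⟩ := exists_isometry_apply_eq hW ξ
  have hp0 : p ≠ 0 := by rintro rfl; simp at hp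
  set b : ℝ := 2 * Real.pi * ‖ξ‖ with hb
  have e1 : ∫ Y : W, yukawa p ‖Y‖ * Complex.exp (-(2 * Real.pi * inner ℝ Y ξ : ℝ) * Complex.I) =
      ∫ Z : WithLp 2 (ℝ × E 2), yukawa p ‖Z‖ * Complex.exp (-(b * Z.fst) * Complex.I) := by
    rw [← A.measurePreserving.integral_comp A.toHomeomorph.measurableEmbedding]
    congr 1
    funext Y
    rw [A.norm_map, ← A.inner_map_map Y ξ, hA, WithLp.prod_inner_apply]
    congr 3
    simp [hb]; ring
  have e2 : ∫ Z : WithLp 2 (ℝ × E 2), yukawa p ‖Z‖ * Complex.exp (-(b * Z.fst) * Complex.I) =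
      ∫ q : ℝ × E 2, yukawa p (Real.sqrt (q.1 ^ 2 + ‖q.2‖ ^ 2)) *
        Complex.exp (-(b * q.1) * Complex.I) := by
    rw [← (WithLp.volume_preserving_toLp ℝ (E 2)).integral_comp
      (MeasurableEquiv.toLp 2 (ℝ × E 2)).measurableEmbedding]
    congr 1
    funext q
    rw [WithLp.prod_norm_eq_of_L2]
    simp
  have hV : Module.finrank ℝ (WithLp 2 (ℝ × E 2)) = 3 := by
    rw [(WithLp.linearEquiv 2 ℝ (ℝ × E 2)).finrank_eq]; simp
  have hint : Integrable (fun q : ℝ × E 2 => yukawa p (Real.sqrt (q.1 ^ 2 + ‖q.2‖ ^ 2)) *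
        Complex.exp (-(b * q.1) * Complex.I)) := by
    have h1 := integrable_yukawa_norm hV hp
    rw [← (WithLp.volume_preserving_toLp ℝ (E 2)).integrable_comp_emb
      (MeasurableEquiv.toLp 2 (ℝ × E 2)).measurableEmbedding] at h1
    refine Integrable.mono h1 ?_ (Eventually.of_forall fun q => ?_)
    · have := measurable_yukawa p
      exact Measurable.aestronglyMeasurable (by fun_prop)
    · rw [norm_mul, Complex.norm_exp, Function.comp, WithLp.prod_norm_eq_of_L2]
      simp
  rw [e1, e2, Measure.volume_eq_prod, integral_prod _ hint]
  have e3 : ∀ s : ℝ, ∫ x : E 2, yukawa p (Real.sqrt (s ^ 2 + ‖x‖ ^ 2)) *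
      Complex.exp (-(b * s) * Complex.I) =
      (1 / (2 * p)) * (Complex.exp (-p * |s|) * Complex.exp (-(b * s) * Complex.I)) := fun s => by
    rw [integral_mul_const, integral_yukawa_plane hp]; ring
  simp_rw [e3]
  rw [integral_const_mul, integral_exp_abs hp]
  field_simp

theorem integrable_exp_norm (hW : Module.finrank ℝ W = 3) {p : ℂ} (hp : 0 < p.re) :
    Integrable fun Y : W => Complex.exp (-p * ‖Y‖) / (4 * Real.pi) := by
  have : Nontrivial W := Module.nontrivial_of_finrank_pos (R := ℝ) (by omega)
  rw [integrable_fun_norm_addHaar volume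
    (f := fun r : ℝ => Complex.exp (-p * r) / (4 * Real.pi)), hW]
  have h3 := integrableOn_rpow_mul_exp_neg_mul_rpow (s := 2) (p := 1) (b := p.re)
    (by norm_num) one_pos hp
  simp only [Real.rpow_one, Real.rpow_ofNat] at h3
  refine Integrable.mono' h3 (by fun_prop) ?_
  refine Eventually.of_forall fun r => ?_
  rw [norm_smul, norm_div, Complex.norm_exp]
  have h4 : (1 : ℝ) ≤ ‖(4 * Real.pi : ℂ)‖ := by
    simp [abs_of_pos Real.pi_pos]
    linarith [Real.pi_gt_three]
  have h5 : Real.exp (-p * r).re / ‖(4 * Real.pi : ℂ)‖ ≤ Real.exp (-p.re * r) := by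
    refine (div_le_self (Real.exp_pos _).le h4).trans (le_of_eq ?_)
    simp
  simp only [Nat.add_one_sub_one, norm_pow, Real.norm_eq_abs, sq_abs]
  gcongr

/-- Differentiation of `integral_yukawa_mul_exp` in p: the derivative removes the singular
denominator of e^{-pr}/(4πr) on the left and yields -2p/(p² + b²)² on the right. -/
theorem integral_exp_norm_mul_exp (hW : Module.finrank ℝ W = 3) {p : ℂ} (hp : 0 < p.re) (ξ : W) :
    ∫ Y : W, Complex.exp (-p * ‖Y‖) / (4 * Real.pi) *
        Complex.exp (-(2 * Real.pi * inner ℝ Y ξ : ℝ) * Complex.I) =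
      2 * p / (p ^ 2 + (2 * Real.pi * ‖ξ‖ : ℝ) ^ 2) ^ 2 := by
  have hc : 0 < p.re / 2 := by positivity
  have : Nontrivial W := Module.nontrivial_of_finrank_pos (R := ℝ) (by omega)
  -- On the half plane Re q > Re p / 2 the derivatives are dominated by the exponential of rate Re p
  -- / 2, which is integrable.
  have hs : {q : ℂ | p.re / 2 < q.re} ∈ 𝓝 p :=
    (isOpen_lt continuous_const Complex.continuous_re).mem_nhds (by
      simp only [Set.mem_ofPred_eq]; linarith)
  have hmy := measurable_yukawa
  have hint : Integrable fun Y : W => yukawa p ‖Y‖ *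
      Complex.exp (-(2 * Real.pi * inner ℝ Y ξ : ℝ) * Complex.I) := by
    refine Integrable.mono (integrable_yukawa_norm hW hp) ?_ (Eventually.of_forall fun q => ?_)
    · have := hmy p
      exact Measurable.aestronglyMeasurable (by fun_prop)
    · rw [norm_mul, Complex.norm_exp]
      simp
  have key := (hasDerivAt_integral_of_dominated_loc_of_deriv_le (𝕜 := ℂ) (μ := (volume : Measure W))
    (F := fun q Y => yukawa q ‖Y‖ * Complex.exp (-(2 * Real.pi * inner ℝ Y ξ : ℝ) * Complex.I))
    (F' := fun q Y => -(Complex.exp (-q * ‖Y‖) / (4 * Real.pi) *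
      Complex.exp (-(2 * Real.pi * inner ℝ Y ξ : ℝ) * Complex.I)))
    (bound := fun Y => ‖Complex.exp (-(p.re / 2 : ℝ) * ‖Y‖) / (4 * Real.pi)‖) hs
    (Eventually.of_forall fun q => ?_) hint ?_ (Eventually.of_forall fun Y q hq => ?_)
    (integrable_exp_norm hW (by simpa using hp)).norm ?_).2
  · have h2 : HasDerivAt (fun q : ℂ => 1 / (q ^ 2 + ((2 * Real.pi * ‖ξ‖ : ℝ) : ℂ) ^ 2))
        (-(2 * p / (p ^ 2 + (2 * Real.pi * ‖ξ‖ : ℝ) ^ 2) ^ 2)) p := by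
      have h0 : p ^ 2 + ((2 * Real.pi * ‖ξ‖ : ℝ) : ℂ) ^ 2 ≠ 0 := by
        intro h
        have hab : p ^ 2 + ((2 * Real.pi * ‖ξ‖ : ℝ) : ℂ) ^ 2 =
            (p + (2 * Real.pi * ‖ξ‖ : ℝ) * Complex.I) *
              (p - (2 * Real.pi * ‖ξ‖ : ℝ) * Complex.I) := by
          ring_nf; rw [Complex.I_sq]; ring
        rw [hab, mul_eq_zero] at h
        rcases h with h | h
        · have := congrArg Complex.re h; simp at this; linarith
        · have := congrArg Complex.re h; simp at this; linarith
      have h3 := ((hasDerivAt_pow 2 p).add_const (((2 * Real.pi * ‖ξ‖ : ℝ) : ℂ) ^ 2)).inv h0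
      simp only [one_div]
      refine h3.congr_deriv ?_
      simp [neg_div]
    have h4 := h2.unique (key.congr_of_eventuallyEq ?_)
    · rw [integral_neg, neg_inj] at h4
      exact h4.symm
    · filter_upwards [hs] with q hq
      exact (integral_yukawa_mul_exp hW (hc.trans hq) ξ).symm
  · have := hmy q
    exact Measurable.aestronglyMeasurable (by fun_prop)
  · exact Measurable.aestronglyMeasurable (by fun_prop)
  · have h1 : p.re / 2 < q.re := hq
    rw [norm_neg, norm_mul, norm_div, norm_div, Complex.norm_exp, Complex.norm_exp,
      Complex.norm_exp]
    have h2 : (-(2 * Real.pi * inner ℝ Y ξ : ℝ) * Complex.I : ℂ).re = 0 := by simp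
    rw [h2, Real.exp_zero, mul_one]
    refine div_le_div_of_nonneg_right (Real.exp_le_exp.2 ?_) (norm_nonneg _)
    simp only [Complex.mul_re, Complex.neg_re, Complex.ofReal_re, Complex.ofReal_im, mul_zero,
      sub_zero, Complex.neg_im]
    nlinarith [norm_nonneg Y]
  · have h0 : ∀ᵐ Y : W, Y ≠ 0 := by
      simp [ae_iff]
    filter_upwards [h0] with Y hY q hq
    have hY' : (‖Y‖ : ℂ) ≠ 0 := by simpa using hY
    have h4 : (Real.pi : ℂ) ≠ 0 := by exact_mod_cast Real.pi_ne_zero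
    have h1 : HasDerivAt (fun q : ℂ => yukawa q ‖Y‖)
        (-(Complex.exp (-q * ‖Y‖) / (4 * Real.pi))) q := by
      refine ((((hasDerivAt_neg q).mul_const (‖Y‖ : ℂ)).cexp).div_const
        (4 * Real.pi * ‖Y‖)).congr_deriv ?_
      field_simp
    exact (h1.mul_const _).congr_deriv (by ring)

end Yukawa

end WaveTrace

namespace WaveTrace

/-! ### Green functions in dimension at most three by descent -/

section Green

open Filter Topology

variable {d m : ℕ}

/-- The length `√(|y|² + |z|²)`. -/
noncomputable def rho (y : E d) (z : E m) : ℝ := Real.sqrt (‖y‖ ^ 2 + ‖z‖ ^ 2)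

theorem continuous_rho : Continuous fun q : E d × E m => rho q.1 q.2 := by
  unfold rho; fun_prop

theorem rho_nonneg (y : E d) (z : E m) : 0 ≤ rho y z := Real.sqrt_nonneg _

theorem norm_le_rho (y : E d) (z : E m) : ‖y‖ ≤ rho y z :=
  Real.le_sqrt_of_sq_le (by nlinarith [sq_nonneg ‖z‖])

theorem rho_eq_norm (y : E d) (z : E m) :
    rho y z = ‖(WithLp.toLp 2 (y, z) : WithLp 2 (E d × E m))‖ := by
  rw [WithLp.prod_norm_eq_of_L2]; rfl

theorem rho_neg (y : E d) (z : E m) : rho (-y) z = rho y z := by simp [rho]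

theorem finrank_withLp_prod (h : d + m = 3) : Module.finrank ℝ (WithLp 2 (E d × E m)) = 3 := by
  rw [(WithLp.linearEquiv 2 ℝ (E d × E m)).finrank_eq]; simpa using h

theorem integrable_comp_rho_iff {f : ℝ → ℂ} :
    Integrable (fun q : E d × E m => f (rho q.1 q.2)) ↔
      Integrable fun Y : WithLp 2 (E d × E m) => f ‖Y‖ := by
  rw [← (WithLp.volume_preserving_toLp (E d) (E m)).integrable_comp_emb
    (MeasurableEquiv.toLp 2 (E d × E m)).measurableEmbedding]
  simp only [Function.comp_def, rho_eq_norm]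

theorem integrable_yukawa_rho (h : d + m = 3) {p : ℂ} (hp : 0 < p.re) :
    Integrable fun q : E d × E m => yukawa p (rho q.1 q.2) :=
  integrable_comp_rho_iff.2 (integrable_yukawa_norm (finrank_withLp_prod h) hp)

theorem integrable_exp_rho (h : d + m = 3) {p : ℂ} (hp : 0 < p.re) :
    Integrable fun q : E d × E m => Complex.exp (-p * rho q.1 q.2) / (4 * Real.pi) :=
  integrable_comp_rho_iff (f := fun r => Complex.exp (-p * r) / (4 * Real.pi)).2
    (integrable_exp_norm (finrank_withLp_prod h) hp)

/-- The function on `ℝ^d` with values `∫ f(√(|y|² + |z|²)) dz`. -/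
noncomputable def descent (m : ℕ) (f : ℝ → ℂ) (y : E d) : ℂ := ∫ z : E m, f (rho y z)

/-- Integrating out the coordinates in ℝ^m corresponds to restricting the Fourier transform to
frequencies (ξ, 0). -/
theorem fourier_descent {f : ℝ → ℂ}
    (hf : Integrable fun q : E d × E m => f (rho q.1 q.2)) (ξ : E d) :
    𝓕 (descent m f) ξ = ∫ Y : WithLp 2 (E d × E m), f ‖Y‖ * Complex.exp
      (-(2 * Real.pi * inner ℝ Y (WithLp.toLp 2 (ξ, 0)) : ℝ) * Complex.I) := by
  rw [Real.fourier_eq', ← (WithLp.volume_preserving_toLp (E d) (E m)).integral_comp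
    (MeasurableEquiv.toLp 2 (E d × E m)).measurableEmbedding]
  have hrho : ∀ q : E d × E m, ‖(WithLp.toLp 2 q : WithLp 2 (E d × E m))‖ = rho q.1 q.2 :=
    fun q => (rho_eq_norm q.1 q.2).symm
  simp only [hrho, WithLp.prod_inner_apply, inner_zero_right, add_zero, smul_eq_mul]
  rw [Measure.volume_eq_prod, integral_prod]
  · congr 1
    funext y
    rw [descent, ← integral_const_mul]
    congr 1
    funext z
    rw [mul_comm]
    congr 3
    push_cast
    ring
  · refine Integrable.mono hf ?_ (Eventually.of_forall fun q => ?_)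
    · exact hf.1.mul (Continuous.aestronglyMeasurable (f := fun q : E d × E m =>
        Complex.exp (-(2 * Real.pi * inner ℝ q.1 ξ : ℝ) * Complex.I)) (by fun_prop))
    · rw [norm_mul, Complex.norm_exp]
      simp

/-- The integral kernel of `(p² - Δ)⁻¹` on `ℝ^d`, where `d + m = 3`. -/
noncomputable def green (m : ℕ) (p : ℂ) : E d → ℂ := descent m (yukawa p)

/-- The integral kernel of `2p (p² - Δ)⁻²` on `ℝ^d`, where `d + m = 3`. -/
noncomputable def greenSq (m : ℕ) (p : ℂ) : E d → ℂ :=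
  descent m fun r => Complex.exp (-p * r) / (4 * Real.pi)

/-- The symbol of `(p² - Δ)⁻¹`. -/
noncomputable def resSymbol (p : ℂ) (ξ : E d) : ℂ := 1 / (p ^ 2 + absD ξ ^ 2)

theorem integrable_green (h : d + m = 3) {p : ℂ} (hp : 0 < p.re) :
    Integrable (green m p : E d → ℂ) :=
  (integrable_yukawa_rho h hp).integral_prod_left

theorem integrable_greenSq (h : d + m = 3) {p : ℂ} (hp : 0 < p.re) :
    Integrable (greenSq m p : E d → ℂ) :=
  (integrable_exp_rho h hp).integral_prod_left

theorem norm_toLp_left (ξ : E d) :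
    ‖(WithLp.toLp 2 (ξ, 0) : WithLp 2 (E d × E m))‖ = ‖ξ‖ := by
  rw [← rho_eq_norm, rho]; simp [Real.sqrt_sq]

theorem fourier_green (h : d + m = 3) {p : ℂ} (hp : 0 < p.re) (ξ : E d) :
    𝓕 (green m p) ξ = resSymbol p ξ := by
  rw [green, fourier_descent (integrable_yukawa_rho h hp),
    integral_yukawa_mul_exp (finrank_withLp_prod h) hp, norm_toLp_left]
  rfl

theorem fourier_greenSq (h : d + m = 3) {p : ℂ} (hp : 0 < p.re) (ξ : E d) :
    𝓕 (greenSq m p) ξ = 2 * p * resSymbol p ξ ^ 2 := by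
  rw [greenSq, fourier_descent (integrable_exp_rho h hp),
    integral_exp_norm_mul_exp (finrank_withLp_prod h) hp, norm_toLp_left, resSymbol, absD]
  rw [one_div, inv_pow, div_eq_mul_inv]

theorem stronglyMeasurable_green (p : ℂ) : StronglyMeasurable (green m p : E d → ℂ) := by
  have h1 : Measurable fun q : E d × E m => yukawa p (rho q.1 q.2) :=
    (measurable_yukawa p).comp continuous_rho.measurable
  exact h1.stronglyMeasurable.integral_prod_right

theorem descent_neg (f : ℝ → ℂ) (y : E d) : descent m f (-y) = descent m f y := by
  simp [descent, rho_neg]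

theorem green_sub_comm (p : ℂ) (x y : E d) : green m p (x - y) = green m p (y - x) := by
  rw [← neg_sub, green, descent_neg]

theorem greenSq_sub_comm (p : ℂ) (x y : E d) : greenSq m p (x - y) = greenSq m p (y - x) := by
  rw [← neg_sub, greenSq, descent_neg]

/-! ### The points of the line `Re p = 1` -/

/-- The point `1 - 2πis`. -/
noncomputable def pt (s : ℝ) : ℂ := 1 - 2 * Real.pi * s * Complex.I

theorem pt_re (s : ℝ) : (pt s).re = 1 := by simp [pt]

theorem pt_re_pos (s : ℝ) : 0 < (pt s).re := by simp [pt_re]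

theorem pt_zero : pt 0 = 1 := by simp [pt]

theorem conj_pt (s : ℝ) : (starRingEnd ℂ) (pt s) = pt (-s) := by
  simp only [pt, map_sub, map_one, map_mul, map_ofNat, Complex.conj_ofReal, Complex.conj_I,
    Complex.ofReal_neg]
  ring

theorem continuous_pt : Continuous pt := by unfold pt; fun_prop

/-- Both factors of (p + ia)(p - ia) have real part 1. -/
theorem one_le_norm_pt_sq_add (s a : ℝ) : 1 ≤ ‖pt s ^ 2 + (a : ℂ) ^ 2‖ := by
  have hab : pt s ^ 2 + (a : ℂ) ^ 2 = (pt s + a * Complex.I) * (pt s - a * Complex.I) := by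
    ring_nf; rw [Complex.I_sq]; ring
  have h1 : 1 ≤ ‖pt s + a * Complex.I‖ := by
    refine le_trans ?_ (Complex.abs_re_le_norm _)
    simp [pt_re]
  have h2 : 1 ≤ ‖pt s - a * Complex.I‖ := by
    refine le_trans ?_ (Complex.abs_re_le_norm _)
    simp [pt_re]
  rw [hab, norm_mul]
  nlinarith

theorem pt_sq_add_ne_zero (s a : ℝ) : pt s ^ 2 + (a : ℂ) ^ 2 ≠ 0 := fun h => by
  have := one_le_norm_pt_sq_add s a
  rw [h, norm_zero] at this
  linarith

theorem norm_resSymbol_le_one (s : ℝ) (ξ : E d) : ‖resSymbol (pt s) ξ‖ ≤ 1 := by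
  rw [resSymbol, norm_div, norm_one]
  exact (div_le_one (by linarith [one_le_norm_pt_sq_add s (absD ξ)])).2 (one_le_norm_pt_sq_add s _)

/-- The resolvent gains two derivatives with a constant that grows only polynomially in s; this
growth is later absorbed by the rapid decay of `expHat`. -/
theorem sq_japD_mul_norm_resSymbol_le (s : ℝ) (ξ : E d) :
    japD ξ ^ 2 * ‖resSymbol (pt s) ξ‖ ≤ 2 + ‖pt s‖ ^ 2 := by
  have h1 := one_le_norm_pt_sq_add s (absD ξ)
  rw [resSymbol, norm_div, norm_one, mul_one_div, div_le_iff₀ (by linarith), japD,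
    Real.sq_sqrt (by positivity)]
  have h2 : absD ξ ^ 2 ≤ ‖pt s ^ 2 + (absD ξ : ℂ) ^ 2‖ + ‖pt s‖ ^ 2 := by
    have : ((absD ξ ^ 2 : ℝ) : ℂ) = (pt s ^ 2 + (absD ξ : ℂ) ^ 2) - pt s ^ 2 := by
      push_cast; ring
    calc absD ξ ^ 2 = ‖((absD ξ ^ 2 : ℝ) : ℂ)‖ := by
          rw [Complex.norm_real, Real.norm_of_nonneg (sq_nonneg _)]
      _ ≤ _ := by rw [this, ← norm_pow]; exact norm_sub_le _ _
  nlinarith [sq_nonneg ‖pt s‖]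

theorem continuous_resSymbol_right (s : ℝ) : Continuous fun ξ : E d => resSymbol (pt s) ξ :=
  continuous_const.div (continuous_const.add
    ((Complex.continuous_ofReal.comp continuous_absD).pow 2)) fun _ => pt_sq_add_ne_zero _ _

theorem memLp_resSymbol_top (s : ℝ) : MemLp (resSymbol (pt s)) ∞ (volume : Measure (E d)) :=
  memLp_top_of_bound (continuous_resSymbol_right s).aestronglyMeasurable 1
    (Eventually.of_forall (norm_resSymbol_le_one s))

/-- Its square decays like |ξ|⁻⁴, which is integrable exactly in dimensions below 4. This is what
makes the Green functions square integrable. -/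
theorem memLp_inv_sq_japD (hd : d ≤ 3) :
    MemLp (fun ξ => ((japD ξ ^ 2)⁻¹ : ℝ)) 2 (volume : Measure (E d)) := by
  have hc : Continuous fun ξ : E d => (japD ξ ^ 2)⁻¹ :=
    (continuous_japD.pow 2).inv₀ fun ξ => (pow_pos (japD_pos ξ) 2).ne'
  rw [memLp_two_iff_integrable_sq hc.aestronglyMeasurable]
  have h1 : Integrable (fun ξ : E d => ((1 : ℝ) + ‖ξ‖ ^ 2) ^ (-(4 : ℝ) / 2)) :=
    integrable_rpow_neg_one_add_norm_sq (by
      rw [finrank_euclideanSpace_fin]; exact_mod_cast Nat.lt_succ_of_le hd)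
  refine h1.mono' (hc.pow 2).aestronglyMeasurable (Eventually.of_forall fun ξ => ?_)
  have h2 : 0 < 1 + ‖ξ‖ ^ 2 := by positivity
  have h3 : 1 + ‖ξ‖ ^ 2 ≤ japD ξ ^ 2 := by
    rw [japD, Real.sq_sqrt (by positivity), absD]
    have : (1 : ℝ) ≤ (2 * Real.pi) ^ 2 := by nlinarith [Real.pi_gt_three]
    nlinarith [sq_nonneg ‖ξ‖]
  rw [show (-(4 : ℝ) / 2) = -((2 : ℕ) : ℝ) by norm_num, Real.rpow_neg h2.le, Real.rpow_natCast,
    Real.norm_of_nonneg (by positivity), inv_pow]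
  gcongr

theorem memLp_resSymbol_two (hd : d ≤ 3) (s : ℝ) :
    MemLp (resSymbol (pt s)) 2 (volume : Measure (E d)) := by
  refine MemLp.of_le_mul (c := 2 + ‖pt s‖ ^ 2) (memLp_inv_sq_japD hd)
    (continuous_resSymbol_right s).aestronglyMeasurable (Eventually.of_forall fun ξ => ?_)
  have h1 := sq_japD_mul_norm_resSymbol_le s ξ
  have h2 : 0 < japD ξ ^ 2 := pow_pos (japD_pos ξ) 2
  rw [Real.norm_of_nonneg (by positivity), ← div_eq_mul_inv, le_div_iff₀ h2]
  linarith

end Green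

end WaveTrace

namespace WaveTrace

/-! ### Strong continuity of multipliers and the resolvent as integral operator -/

section Multipliers

open Filter Topology

variable {d m : ℕ}

theorem norm_mulOp_le {a : E d → ℂ} (ha : MemLp a ∞ volume) {C : ℝ}
    (h : ∀ᵐ ξ, ‖a ξ‖ ≤ C) (v : L2 d) : ‖mulOp a ha v‖ ≤ C * ‖v‖ := by
  refine Lp.norm_le_mul_norm_of_ae_le_mul ?_
  filter_upwards [coeFn_mulOp a ha v, h] with ξ hξ h
  rw [hξ, norm_mul]
  gcongr

theorem norm_fourierMul_le {a : E d → ℂ} (ha : MemLp a ∞ volume) {C : ℝ}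
    (h : ∀ ξ, ‖a ξ‖ ≤ C) (v : L2 d) : ‖fourierMul a ha v‖ ≤ C * ‖v‖ := by
  rw [← Lp.norm_fourier_eq, fourier_fourierMul, ← Lp.norm_fourier_eq v]
  exact norm_mulOp_le ha (Eventually.of_forall h) _

theorem norm_L2_sq (f : L2 d) : ‖f‖ ^ 2 = ∫ x, ‖f x‖ ^ 2 := by
  rw [norm_sq_eq_re_inner (𝕜 := ℂ), L2.inner_def]
  have : ∀ x, inner ℂ (f x) (f x) = ((‖f x‖ ^ 2 : ℝ) : ℂ) := fun x => by
    rw [inner_self_eq_norm_sq_to_K]; norm_cast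
  simp_rw [this]
  rw [integral_complex_ofReal]
  simp

/-- For a fixed vector this is dominated convergence; joint continuity follows because the operator
norms are bounded by a continuous function of the parameter. -/
theorem continuous_mulOp {X : Type*} [TopologicalSpace X] [FirstCountableTopology X]
    {a : X → E d → ℂ} (ha : ∀ x, MemLp (a x) ∞ volume) (hc : ∀ ξ, Continuous fun x => a x ξ)
    {C : X → ℝ} (hC : Continuous C) (hb : ∀ x ξ, ‖a x ξ‖ ≤ C x) :
    Continuous fun q : X × L2 d => mulOp (a q.1) (ha q.1) q.2 := by
  have key : ∀ v : L2 d, Continuous fun x => mulOp (a x) (ha x) v := by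
    intro v
    rw [continuous_iff_continuousAt]
    intro x₀
    have h1 : ∀ x, ‖mulOp (a x) (ha x) v - mulOp (a x₀) (ha x₀) v‖ ^ 2 =
        ∫ ξ, (‖a x ξ - a x₀ ξ‖ * ‖v ξ‖) ^ 2 := by
      intro x
      rw [norm_L2_sq]
      apply integral_congr_ae
      filter_upwards [coeFn_mulOp _ (ha x) v, coeFn_mulOp _ (ha x₀) v,
        Lp.coeFn_sub (mulOp (a x) (ha x) v) (mulOp (a x₀) (ha x₀) v)] with ξ h1 h2 h3
      rw [h3, Pi.sub_apply, h1, h2, ← sub_mul, norm_mul]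
    have h2 : Tendsto (fun x => ∫ ξ, (‖a x ξ - a x₀ ξ‖ * ‖v ξ‖) ^ 2) (𝓝 x₀)
        (𝓝 (∫ _ξ : E d, (0 : ℝ))) := by
      have hbd : ∀ᶠ x in 𝓝 x₀, C x ≤ C x₀ + 1 :=
        (hC.tendsto x₀).eventually_le_const (by linarith)
      refine tendsto_integral_filter_of_dominated_convergence
        (fun ξ => (2 * C x₀ + 1) ^ 2 * ‖v ξ‖ ^ 2) ?_ ?_ ?_ ?_
      · exact Eventually.of_forall fun x =>
          ((((ha x).1.sub (ha x₀).1).norm).mul (Lp.aestronglyMeasurable v).norm).pow 2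
      · filter_upwards [hbd] with x hx
        refine Eventually.of_forall fun ξ => ?_
        rw [Real.norm_of_nonneg (by positivity), mul_pow]
        gcongr
        refine (norm_sub_le _ _).trans ?_
        linarith [hb x ξ, hb x₀ ξ]
      · exact ((Lp.memLp v).integrable_norm_pow (by simp)).const_mul _
      · refine Eventually.of_forall fun ξ => ?_
        have := (((((hc ξ).tendsto x₀).sub_const (a x₀ ξ)).norm.mul_const ‖v ξ‖).pow 2)
        simpa using this
    rw [integral_zero] at h2
    rw [ContinuousAt, tendsto_iff_norm_sub_tendsto_zero]
    have h3 := (Real.continuous_sqrt.tendsto _).comp h2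
    rw [Real.sqrt_zero] at h3
    refine h3.congr fun x => ?_
    rw [Function.comp, ← h1, Real.sqrt_sq (norm_nonneg _)]
  rw [continuous_iff_continuousAt]
  rintro ⟨x₀, v₀⟩
  rw [ContinuousAt, tendsto_iff_norm_sub_tendsto_zero]
  have h1 : Tendsto (fun q : X × L2 d => C q.1 * ‖q.2 - v₀‖ +
      ‖mulOp (a q.1) (ha q.1) v₀ - mulOp (a x₀) (ha x₀) v₀‖) (𝓝 (x₀, v₀)) (𝓝 0) := by
    have h2 : Continuous fun q : X × L2 d => C q.1 * ‖q.2 - v₀‖ +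
        ‖mulOp (a q.1) (ha q.1) v₀ - mulOp (a x₀) (ha x₀) v₀‖ := by
      have := (key v₀).comp (continuous_fst (X := X) (Y := L2 d))
      exact ((hC.comp continuous_fst).mul (continuous_snd.sub continuous_const).norm).add
        (this.sub continuous_const).norm
    simpa using h2.tendsto (x₀, v₀)
  refine squeeze_zero (fun _ => norm_nonneg _) (fun q => ?_) h1
  have h3 : mulOp (a q.1) (ha q.1) q.2 - mulOp (a x₀) (ha x₀) v₀ =
      mulOp (a q.1) (ha q.1) (q.2 - v₀) +
        (mulOp (a q.1) (ha q.1) v₀ - mulOp (a x₀) (ha x₀) v₀) := by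
    rw [map_sub]; abel
  rw [h3]
  exact (norm_add_le _ _).trans (add_le_add_left
    (norm_mulOp_le (ha q.1) (Eventually.of_forall (hb q.1)) _) _)

theorem continuous_fourierMul {X : Type*} [TopologicalSpace X] [FirstCountableTopology X]
    {a : X → E d → ℂ} (ha : ∀ x, MemLp (a x) ∞ volume) (hc : ∀ ξ, Continuous fun x => a x ξ)
    {C : X → ℝ} (hC : Continuous C) (hb : ∀ x ξ, ‖a x ξ‖ ≤ C x) :
    Continuous fun q : X × L2 d => fourierMul (a q.1) (ha q.1) q.2 :=
  (Lp.fourierTransformₗᵢ (E d) ℂ).symm.continuous.comp ((continuous_mulOp ha hc hC hb).comp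
    (continuous_fst.prodMk ((Lp.fourierTransformₗᵢ (E d) ℂ).continuous.comp continuous_snd)))

/-- The character `ξ ↦ e^{-2πi⟨y, ξ⟩}`. -/
noncomputable def phase (y ξ : E d) : ℂ :=
  Complex.exp ((-2 * Real.pi * inner ℝ y ξ : ℝ) * Complex.I)

theorem norm_phase (y ξ : E d) : ‖phase y ξ‖ = 1 := Complex.norm_exp_ofReal_mul_I _

theorem continuous_phase : Continuous fun q : E d × E d => phase q.1 q.2 := by
  unfold phase; fun_prop

theorem memLp_phase_mul {a : E d → ℂ} (ha : MemLp a 2 volume) (y : E d) :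
    MemLp (fun ξ => phase y ξ * a ξ) 2 volume :=
  ha.of_le ((continuous_phase.comp (Continuous.prodMk_right y)).aestronglyMeasurable.mul ha.1)
    (Eventually.of_forall fun ξ => by rw [norm_mul, norm_phase, one_mul])

/-- The translate by `y` of the inverse Fourier transform of `a`. -/
noncomputable def shiftVec {a : E d → ℂ} (ha : MemLp a 2 volume) (y : E d) : L2 d :=
  𝓕⁻ ((memLp_phase_mul ha y).toLp _)

theorem fourier_shiftVec {a : E d → ℂ} (ha : MemLp a 2 volume) (y : E d) :
    (𝓕 (shiftVec ha y) : L2 d) =ᵐ[volume] fun ξ => phase y ξ * a ξ := by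
  rw [shiftVec, fourier_fourierInv_eq]
  exact MemLp.coeFn_toLp _

theorem shiftVec_ae_eq {a : E d → ℂ} (ha : MemLp a 2 volume) {f : E d → ℂ} (hf : Integrable f)
    (hfa : ∀ ξ, 𝓕 f ξ = a ξ) (y : E d) : shiftVec ha y =ᵐ[volume] fun x => f (x - y) := by
  refine fourierInv_ae_eq_of_fourier_ae_eq (hf.comp_sub_right y) ?_
  filter_upwards [(memLp_phase_mul ha y).coeFn_toLp] with ξ hξ
  rw [hξ, ← hfa, Real.fourier_eq', Real.fourier_eq', ← integral_const_mul,
    ← integral_add_right_eq_self _ y]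
  congr 1
  funext x
  rw [add_sub_cancel_right, phase, smul_eq_mul, smul_eq_mul, ← mul_assoc, ← Complex.exp_add,
    inner_add_left]
  congr 2
  push_cast
  ring

theorem inner_shiftVec {a : E d → ℂ} (ha : MemLp a 2 volume) (y : E d) (u : L2 d) :
    inner ℂ (shiftVec ha y) u =
      ∫ ξ, (starRingEnd ℂ) (phase y ξ) * ((starRingEnd ℂ) (a ξ) * (𝓕 u : L2 d) ξ) := by
  rw [← Lp.inner_fourier_eq, L2.inner_def]
  apply integral_congr_ae
  filter_upwards [fourier_shiftVec ha y] with ξ hξ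
  rw [hξ, RCLike.inner_apply, map_mul]
  ring

/-- Dividing by the fixed function b turns a family of L² vectors into bounded multipliers applied
to the single vector b, so strong continuity of multipliers applies. -/
theorem continuous_shiftVec {X : Type*} [TopologicalSpace X] [FirstCountableTopology X]
    {a : X → E d → ℂ} (ha : ∀ x, MemLp (a x) 2 volume) {b : E d → ℂ} (hb : MemLp b 2 volume)
    (hcont : ∀ x, Continuous (a x)) (hc : ∀ ξ, Continuous fun x => a x ξ)
    (hbc : Continuous b) (hb0 : ∀ ξ, b ξ ≠ 0)
    {C : X → ℝ} (hC : Continuous C) (hab : ∀ x ξ, ‖a x ξ‖ ≤ C x * ‖b ξ‖) :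
    (Continuous fun q : X × E d => shiftVec (ha q.1) q.2) ∧
      ∀ x y, ‖shiftVec (ha x) y‖ ≤ C x * ‖hb.toLp b‖ := by
  have hbd : ∀ (q : X × E d) (ξ : E d), ‖phase q.2 ξ * (a q.1 ξ / b ξ)‖ ≤ C q.1 := fun q ξ => by
    rw [norm_mul, norm_phase, one_mul, norm_div, div_le_iff₀ (norm_pos_iff.2 (hb0 ξ))]
    exact hab q.1 ξ
  have hM : ∀ q : X × E d, MemLp (fun ξ => phase q.2 ξ * (a q.1 ξ / b ξ)) ∞ volume := fun q =>
    memLp_top_of_bound (Continuous.aestronglyMeasurable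
      ((continuous_phase.comp (Continuous.prodMk_right q.2)).mul ((hcont q.1).div hbc hb0)))
      (C q.1) (Eventually.of_forall (hbd q))
  have heq : ∀ q : X × E d, shiftVec (ha q.1) q.2 = 𝓕⁻ (mulOp _ (hM q) (hb.toLp b)) := fun q => by
    rw [shiftVec]
    congr 1
    apply Lp.ext
    filter_upwards [(memLp_phase_mul (ha q.1) q.2).coeFn_toLp, coeFn_mulOp _ (hM q) (hb.toLp b),
      hb.coeFn_toLp] with ξ h1 h2 h3
    rw [h1, h2, h3, mul_assoc, div_mul_cancel₀ _ (hb0 ξ)]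
  constructor
  · have := (continuous_mulOp hM (C := fun q => C q.1) (fun ξ => ?_) (hC.comp continuous_fst)
      hbd).comp (continuous_id.prodMk (continuous_const (y := hb.toLp b)))
    · simp_rw [heq]
      exact (Lp.fourierTransformₗᵢ (E d) ℂ).symm.continuous.comp this
    · exact (continuous_phase.comp (continuous_snd.prodMk continuous_const)).mul
        (((hc ξ).comp continuous_fst).div_const _)
  · intro x y
    rw [heq (x, y)]
    refine ((Lp.fourierTransformₗᵢ (E d) ℂ).symm.norm_map _).le.trans ?_
    exact norm_mulOp_le _ (Eventually.of_forall (hbd (x, y))) _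

/-- The operator `(p² - Δ)⁻¹`, for `p = 1 - 2πis`. -/
noncomputable def resolvent (s : ℝ) : L2 d →L[ℂ] L2 d := fourierMul _ (memLp_resSymbol_top s)

/-- The function `green p (· - y)` for `p = 1 - 2πis`, as an element of `L²`. -/
noncomputable def greenVec (hd : d ≤ 3) (s : ℝ) (y : E d) : L2 d :=
  shiftVec (memLp_resSymbol_two hd s) y

theorem conj_resSymbol (s : ℝ) (ξ : E d) :
    (starRingEnd ℂ) (resSymbol (pt s) ξ) = resSymbol (pt (-s)) ξ := by
  simp [resSymbol, conj_pt]

theorem greenVec_ae_eq (hd : d + m = 3) (s : ℝ) (y : E d) :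
    greenVec (d := d) (by omega) s y =ᵐ[volume] fun x => green m (pt s) (x - y) :=
  shiftVec_ae_eq _ (integrable_green hd (pt_re_pos s)) (fourier_green hd (pt_re_pos s)) y

theorem exists_norm_greenVec_le (hd : d ≤ 3) :
    (Continuous fun q : ℝ × E d => greenVec hd q.1 q.2) ∧
      ∃ C, 0 ≤ C ∧ ∀ s (y : E d), ‖greenVec hd s y‖ ≤ (2 + ‖pt s‖ ^ 2) * C := by
  have hb := (memLp_inv_sq_japD hd).ofReal (K := ℂ)
  have h0 : ∀ ξ : E d, (japD ξ ^ 2)⁻¹ ≠ 0 := fun ξ => inv_ne_zero (pow_pos (japD_pos ξ) 2).ne'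
  have h := continuous_shiftVec (memLp_resSymbol_two hd) hb
    (C := fun s => 2 + ‖pt s‖ ^ 2) continuous_resSymbol_right (fun ξ => ?_) ?_ (fun ξ => ?_) ?_
    fun s ξ => ?_
  · exact ⟨h.1, _, norm_nonneg _, h.2⟩
  · exact continuous_const.div ((continuous_pt.pow 2).add continuous_const)
      fun s => pt_sq_add_ne_zero s _
  · exact Complex.continuous_ofReal.comp
      ((continuous_japD.pow 2).inv₀ fun ξ => (pow_pos (japD_pos ξ) 2).ne')
  · exact Complex.ofReal_ne_zero.2 (h0 ξ)
  · have := continuous_pt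
    fun_prop
  · have h1 := sq_japD_mul_norm_resSymbol_le s ξ
    have h2 : 0 < japD ξ ^ 2 := pow_pos (japD_pos ξ) 2
    have h3 : ‖(((japD ξ ^ 2)⁻¹ : ℝ) : ℂ)‖ = (japD ξ ^ 2)⁻¹ := by
      rw [Complex.norm_real, Real.norm_of_nonneg (inv_nonneg.2 h2.le)]
    change _ ≤ _ * ‖(((japD ξ ^ 2)⁻¹ : ℝ) : ℂ)‖
    rw [h3, ← div_eq_mul_inv, le_div_iff₀ h2]
    linarith

theorem conj_phase (y ξ : E d) :
    (starRingEnd ℂ) (phase y ξ) = Complex.exp ((2 * Real.pi * inner ℝ ξ y : ℝ) * Complex.I) := by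
  rw [phase, ← Complex.exp_conj, map_mul, Complex.conj_ofReal, Complex.conj_I, real_inner_comm]
  congr 1
  push_cast
  ring

/-- The symbol is square integrable, so its product with 𝓕 u is integrable and the inverse transform
is a genuine integral at each point. The parameter -s compensates the conjugation in the first
argument of the inner product. -/
theorem resolvent_ae_eq_inner (hd : d ≤ 3) (s : ℝ) (u : L2 d) :
    resolvent s u =ᵐ[volume] fun y => inner ℂ (greenVec hd (-s) y) u := by
  have hr := coeFn_mulOp _ (memLp_resSymbol_top s) (𝓕 u : L2 d)
  have hi : Integrable (mulOp _ (memLp_resSymbol_top s) (𝓕 u : L2 d)) (volume : Measure (E d)) :=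
    ((memLp_resSymbol_two hd s).integrable_mul (Lp.memLp (𝓕 u : L2 d))).congr hr.symm
  filter_upwards [fourierInv_ae_eq_of_integrable hi] with y hy
  refine hy.trans ?_
  rw [greenVec, inner_shiftVec, Real.fourierInv_eq']
  apply integral_congr_ae
  filter_upwards [hr] with ξ hξ
  rw [hξ, conj_phase, conj_resSymbol, neg_neg, smul_eq_mul]

theorem conj_descent (f : ℝ → ℂ) (y : E d) :
    (starRingEnd ℂ) (descent m f y) = descent m (fun r => (starRingEnd ℂ) (f r)) y :=
  integral_conj.symm

theorem conj_green (s : ℝ) (y : E d) :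
    (starRingEnd ℂ) (green m (pt s) y) = green m (pt (-s)) y := by
  rw [green, conj_descent, green]
  congr 1
  funext r
  simp [yukawa, ← Complex.exp_conj, conj_pt, map_ofNat (starRingEnd ℂ) 4]

theorem conj_greenSq (s : ℝ) (y : E d) :
    (starRingEnd ℂ) (greenSq m (pt s) y) = greenSq m (pt (-s)) y := by
  rw [greenSq, conj_descent, greenSq]
  congr 1
  funext r
  simp [← Complex.exp_conj, conj_pt, map_ofNat (starRingEnd ℂ) 4]

theorem inner_greenVec (hd : d + m = 3) (s : ℝ) (y : E d) (u : L2 d) :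
    inner ℂ (greenVec (by omega) (-s) y) u = ∫ x, green m (pt s) (y - x) * u x := by
  rw [L2.inner_def]
  apply integral_congr_ae
  filter_upwards [greenVec_ae_eq hd (-s) y] with x hx
  rw [hx, RCLike.inner_apply, conj_green, neg_neg, green_sub_comm, mul_comm]

theorem memLp_green (hd : d + m = 3) (s : ℝ) (y : E d) :
    MemLp (fun x => green m (pt s) (y - x)) 2 (volume : Measure (E d)) := by
  refine (Lp.memLp (greenVec (d := d) (by omega) s y)).ae_eq ?_
  filter_upwards [greenVec_ae_eq hd s y] with x hx
  rw [hx, green_sub_comm]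

theorem resolvent_ae_eq (hd : d + m = 3) (s : ℝ) (u : L2 d) :
    resolvent s u =ᵐ[volume] fun y => ∫ x, green m (pt s) (y - x) * u x := by
  filter_upwards [resolvent_ae_eq_inner (by omega) s u] with y hy
  rw [hy, inner_greenVec hd]

theorem memLp_resSymbol_sq_two (hd : d ≤ 3) (s : ℝ) :
    MemLp (fun ξ => 2 * pt s * resSymbol (pt s) ξ ^ 2) 2 (volume : Measure (E d)) := by
  refine MemLp.of_le_mul (c := ‖2 * pt s‖) (memLp_resSymbol_two hd s)
    (continuous_const.mul ((continuous_resSymbol_right s).pow 2)).aestronglyMeasurable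
    (Eventually.of_forall fun ξ => ?_)
  rw [norm_mul, norm_pow, sq]
  have := norm_resSymbol_le_one s ξ
  gcongr
  exact mul_le_of_le_one_left (norm_nonneg _) this

theorem greenSqVec_ae_eq (hd : d + m = 3) (s : ℝ) (y : E d) :
    shiftVec (d := d) (memLp_resSymbol_sq_two (by omega) s) y =ᵐ[volume]
      fun x => greenSq m (pt s) (x - y) :=
  shiftVec_ae_eq _ (integrable_greenSq hd (pt_re_pos s)) (fourier_greenSq hd (pt_re_pos s)) y

theorem memLp_greenSq (hd : d + m = 3) (s : ℝ) (y : E d) :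
    MemLp (fun x => greenSq m (pt s) (y - x)) 2 (volume : Measure (E d)) := by
  refine (Lp.memLp (shiftVec (d := d) (memLp_resSymbol_sq_two (by omega) s) y)).ae_eq ?_
  filter_upwards [greenSqVec_ae_eq hd s y] with x hx
  rw [hx, greenSq_sub_comm]

/-- The two resolvents combine to the symbol of 2p(p² - Δ)⁻², whose kernel is `greenSq`. -/
theorem inner_greenVec_resolvent (hd : d + m = 3) (s : ℝ) (y : E d) (u : L2 d) :
    inner ℂ (greenVec (by omega) (-s) y) ((2 * pt s) • resolvent s u) =
      ∫ x, greenSq m (pt s) (y - x) * u x := by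
  have h1 : inner ℂ (greenVec (by omega) (-s) y) ((2 * pt s) • resolvent s u) =
      inner ℂ (shiftVec (memLp_resSymbol_sq_two (by omega) (-s)) y) u := by
    rw [inner_smul_right, greenVec, inner_shiftVec, inner_shiftVec, resolvent, fourier_fourierMul,
      ← integral_const_mul]
    apply integral_congr_ae
    filter_upwards [coeFn_mulOp _ (memLp_resSymbol_top s) (𝓕 u : L2 d)] with ξ hξ
    rw [hξ, map_mul, map_mul, map_pow, conj_resSymbol, conj_pt, neg_neg,
      map_ofNat (starRingEnd ℂ) 2]
    ring
  rw [h1, L2.inner_def]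
  apply integral_congr_ae
  filter_upwards [greenSqVec_ae_eq hd (-s) y] with x hx
  rw [hx, RCLike.inner_apply, conj_greenSq, neg_neg, greenSq_sub_comm, mul_comm]

end Multipliers

end WaveTrace

namespace WaveTrace

/-! ### Laplace transforms of families of Fourier multipliers -/

section LaplaceMultipliers

open Filter Topology

variable {d : ℕ}

theorem continuous_fourierMul_left {X : Type*} [TopologicalSpace X] [FirstCountableTopology X]
    {a : X → E d → ℂ} (ha : ∀ x, MemLp (a x) ∞ volume) (hc : ∀ ξ, Continuous fun x => a x ξ)
    {C : X → ℝ} (hC : Continuous C) (hb : ∀ x ξ, ‖a x ξ‖ ≤ C x) (v : L2 d) :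
    Continuous fun x => fourierMul (a x) (ha x) v :=
  Continuous.comp (g := fun q : X × L2 d => fourierMul (a q.1) (ha q.1) q.2)
    (f := fun x => (x, v)) (continuous_fourierMul ha hc hC hb) (Continuous.prodMk_left v)

/-- Tested against a vector u, Plancherel turns the statement into a double integral in t and ξ,
where Fubini leaves the Laplace transform of the scalar symbol. -/
theorem integral_fourierMul {a : ℝ → E d → ℂ} (ha : ∀ t, MemLp (a t) ∞ volume)
    (hc : Continuous fun q : ℝ × E d => a q.1 q.2) {C : ℝ → ℝ} (hC : Continuous C)
    (hb : ∀ t ξ, ‖a t ξ‖ ≤ C t) {w : ℝ → ℂ} (hw : Continuous w)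
    (hwC : IntegrableOn (fun t => ‖w t‖ * C t) (Set.Ioi 0)) {b : E d → ℂ} (hbm : MemLp b ∞ volume)
    (hab : ∀ᵐ ξ, ∫ t in Set.Ioi (0 : ℝ), w t * a t ξ = b ξ) (v : L2 d) :
    IntegrableOn (fun t => w t • fourierMul (a t) (ha t) v) (Set.Ioi 0) ∧
      ∫ t in Set.Ioi (0 : ℝ), w t • fourierMul (a t) (ha t) v = fourierMul b hbm v := by
  have hc1 : ∀ ξ, Continuous fun t => a t ξ := fun ξ => hc.comp (Continuous.prodMk_left ξ)
  have hcont : Continuous fun t => w t • fourierMul (a t) (ha t) v :=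
    hw.smul (continuous_fourierMul_left ha hc1 hC hb v)
  have hint : IntegrableOn (fun t => w t • fourierMul (a t) (ha t) v) (Set.Ioi 0) := by
    refine Integrable.mono' (hwC.mul_const ‖v‖) hcont.aestronglyMeasurable
      (Eventually.of_forall fun t => ?_)
    rw [norm_smul, mul_assoc]
    exact mul_le_mul_of_nonneg_left (norm_fourierMul_le (ha t) (hb t) v) (norm_nonneg _)
  refine ⟨hint, ?_⟩
  refine ext_inner_left ℂ fun u => ?_
  rw [← integral_inner hint, ← Lp.inner_fourier_eq u (fourierMul b hbm v), fourier_fourierMul,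
    L2.inner_def]
  have h1 : ∀ t, inner ℂ u (w t • fourierMul (a t) (ha t) v) =
      ∫ ξ, w t * a t ξ * inner ℂ ((𝓕 u : L2 d) ξ) ((𝓕 v : L2 d) ξ) := fun t => by
    rw [inner_smul_right, ← Lp.inner_fourier_eq, fourier_fourierMul, L2.inner_def,
      ← integral_const_mul]
    apply integral_congr_ae
    filter_upwards [coeFn_mulOp _ (ha t) (𝓕 v : L2 d)] with ξ hξ
    rw [hξ, RCLike.inner_apply, RCLike.inner_apply]
    ring
  have huv := L2.integrable_inner (𝕜 := ℂ) (𝓕 u : L2 d) (𝓕 v : L2 d)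
  have hprod : Integrable (fun q : ℝ × E d => w q.1 * a q.1 q.2 *
      inner ℂ ((𝓕 u : L2 d) q.2) ((𝓕 v : L2 d) q.2))
        ((volume.restrict (Set.Ioi (0 : ℝ))).prod volume) := by
    have h2 := Integrable.mul_prod hwC huv.norm
    refine h2.mono' ?_ (Eventually.of_forall fun q => ?_)
    · exact ((hw.comp continuous_fst).mul hc).aestronglyMeasurable.mul huv.1.comp_snd
    · rw [norm_mul, norm_mul]
      exact mul_le_mul_of_nonneg_right
        (mul_le_mul_of_nonneg_left (hb _ _) (norm_nonneg _)) (norm_nonneg _)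
  simp_rw [h1]
  rw [integral_integral_swap (f := fun t ξ => w t * a t ξ *
      inner ℂ ((𝓕 u : L2 d) ξ) ((𝓕 v : L2 d) ξ)) hprod]
  apply integral_congr_ae
  filter_upwards [coeFn_mulOp _ hbm (𝓕 v : L2 d), hab] with ξ hξ hab
  rw [hξ, integral_mul_const, hab, RCLike.inner_apply, RCLike.inner_apply]
  ring

/-- The weight `t ↦ e^{-pt}` with `p = 1 - 2πis`. -/
noncomputable def lapWeight (s t : ℝ) : ℂ := Complex.exp (-pt s * t)

theorem norm_lapWeight (s t : ℝ) : ‖lapWeight s t‖ = Real.exp (-t) := by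
  rw [lapWeight, Complex.norm_exp]; simp [pt_re]

theorem continuous_lapWeight (s : ℝ) : Continuous (lapWeight s) := by
  unfold lapWeight; fun_prop

theorem integrableOn_exp_mul_affine (A B : ℝ) :
    IntegrableOn (fun t : ℝ => Real.exp (-t) * (A + B * |t|)) (Set.Ioi 0) := by
  have h0 := integrableOn_exp_neg_Ioi 0
  have h1 : IntegrableOn (fun t : ℝ => Real.exp (-t) * t) (Set.Ioi 0) := by
    have := Real.GammaIntegral_convergent (s := 2) (by norm_num)
    norm_num at this
    exact this
  have h2 := (Integrable.const_mul h0 A).add (Integrable.const_mul h1 B)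
  refine IntegrableOn.congr_fun h2 (fun t ht => ?_) measurableSet_Ioi
  simp only [Pi.add_apply, abs_of_pos (Set.mem_Ioi.1 ht)]
  ring

theorem integrableOn_lapWeight_mul (s A B : ℝ) :
    IntegrableOn (fun t : ℝ => ‖lapWeight s t‖ * (A + B * |t|)) (Set.Ioi 0) := by
  simp_rw [norm_lapWeight]
  exact integrableOn_exp_mul_affine A B

theorem integral_exp_mul_cexp_I (s a : ℝ) :
    IntegrableOn (fun t : ℝ => lapWeight s t * Complex.exp (a * t * Complex.I)) (Set.Ioi 0) ∧
    ∫ t in Set.Ioi (0 : ℝ), lapWeight s t * Complex.exp (a * t * Complex.I) =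
      1 / (pt s - a * Complex.I) := by
  have hre : (-pt s + a * Complex.I).re < 0 := by simp [pt_re]
  have h1 : ∀ t : ℝ, lapWeight s t * Complex.exp (a * t * Complex.I) =
      Complex.exp ((-pt s + a * Complex.I) * t) := fun t => by
    rw [lapWeight, ← Complex.exp_add]; congr 1; ring
  simp_rw [h1]
  refine ⟨integrableOn_exp_mul_complex_Ioi hre 0, ?_⟩
  rw [integral_exp_mul_complex_Ioi hre 0]
  have h0 : -pt s + a * Complex.I ≠ 0 := by intro h; rw [h] at hre; simp at hre
  have h0' : pt s - a * Complex.I ≠ 0 := by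
    intro h; apply h0; linear_combination -h
  simp only [Complex.ofReal_zero, mul_zero, Complex.exp_zero]
  field_simp
  ring

theorem pt_factors (s a : ℝ) : pt s - a * Complex.I ≠ 0 ∧ pt s + a * Complex.I ≠ 0 ∧
    pt s ^ 2 + (a : ℂ) ^ 2 = (pt s - a * Complex.I) * (pt s + a * Complex.I) := by
  refine ⟨fun h => ?_, fun h => ?_, ?_⟩
  · simpa [pt_re] using congrArg Complex.re h
  · simpa [pt_re] using congrArg Complex.re h
  · ring_nf; rw [Complex.I_sq]; ring

theorem integral_lapWeight_mul_cos (s a : ℝ) :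
    ∫ t in Set.Ioi (0 : ℝ), lapWeight s t * (Real.cos (t * a) : ℝ) =
      pt s * (1 / (pt s ^ 2 + (a : ℂ) ^ 2)) := by
  obtain ⟨i1, e1⟩ := integral_exp_mul_cexp_I s a
  obtain ⟨i2, e2⟩ := integral_exp_mul_cexp_I s (-a)
  have h1 : ∀ t : ℝ, lapWeight s t * (Real.cos (t * a) : ℝ) =
      (1 / 2) * (lapWeight s t * Complex.exp (a * t * Complex.I) +
        lapWeight s t * Complex.exp ((-a : ℝ) * t * Complex.I)) := fun t => by
    rw [Complex.ofReal_cos, Complex.cos]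
    push_cast
    ring_nf
  simp_rw [h1]
  rw [integral_const_mul, integral_add i1 i2, e1, e2]
  obtain ⟨h2, h3, h4⟩ := pt_factors s a
  rw [h4]
  have h3' : pt s - (-a : ℝ) * Complex.I = pt s + a * Complex.I := by push_cast; ring
  rw [h3']
  field_simp
  ring

theorem integral_lapWeight_mul_sinc (s : ℝ) {a : ℝ} (ha : a ≠ 0) :
    ∫ t in Set.Ioi (0 : ℝ), lapWeight s t * (t * Real.sinc (t * a) : ℝ) =
      1 / (pt s ^ 2 + (a : ℂ) ^ 2) := by
  obtain ⟨i1, e1⟩ := integral_exp_mul_cexp_I s a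
  obtain ⟨i2, e2⟩ := integral_exp_mul_cexp_I s (-a)
  have ha' : (a : ℂ) ≠ 0 := Complex.ofReal_ne_zero.2 ha
  have h1 : ∀ t ∈ Set.Ioi (0 : ℝ), lapWeight s t * (t * Real.sinc (t * a) : ℝ) =
      (1 / (2 * a * Complex.I)) * (lapWeight s t * Complex.exp (a * t * Complex.I) -
        lapWeight s t * Complex.exp ((-a : ℝ) * t * Complex.I)) := fun t ht => by
    have ht' : (t : ℂ) ≠ 0 := Complex.ofReal_ne_zero.2 (Set.mem_Ioi.1 ht).ne'
    rw [Real.sinc_of_ne_zero (mul_ne_zero (Set.mem_Ioi.1 ht).ne' ha)]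
    push_cast
    rw [Complex.sin]
    have e3 : Complex.exp (-(t * a : ℂ) * Complex.I) = Complex.exp (-(a : ℂ) * t * Complex.I) := by
      congr 1; ring
    have e4 : Complex.exp ((t * a : ℂ) * Complex.I) = Complex.exp ((a : ℂ) * t * Complex.I) := by
      congr 1; ring
    rw [e3, e4]
    have hI := Complex.I_ne_zero
    field_simp
    rw [Complex.I_sq]
    ring
  rw [setIntegral_congr_fun measurableSet_Ioi h1, integral_const_mul, integral_sub i1 i2, e1, e2]
  obtain ⟨h2, h3, h4⟩ := pt_factors s a
  rw [h4]
  have h3' : pt s - (-a : ℝ) * Complex.I = pt s + a * Complex.I := by push_cast; ring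
  rw [h3']
  have hI := Complex.I_ne_zero
  field_simp
  ring

end LaplaceMultipliers

end WaveTrace

namespace WaveTrace

/-! ### Continuity, bounds and Laplace transform of the free wave group -/

section WaveGroup

open Filter Topology

variable {d : ℕ}

theorem mulOp_mulOp {a b c : E d → ℂ} (ha : MemLp a ∞ volume) (hb : MemLp b ∞ volume)
    (hc : MemLp c ∞ volume) (h : ∀ ξ, a ξ * b ξ = c ξ) (v : L2 d) :
    mulOp a ha (mulOp b hb v) = mulOp c hc v := by
  apply Lp.ext
  filter_upwards [coeFn_mulOp a ha (mulOp b hb v), coeFn_mulOp b hb v, coeFn_mulOp c hc v]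
    with ξ h1 h2 h3
  rw [h1, h2, h3, ← mul_assoc, h]

theorem mulOp_smul {a b : E d → ℂ} (ha : MemLp a ∞ volume) (hb : MemLp b ∞ volume) {c : ℂ}
    (h : ∀ ξ, b ξ = c * a ξ) (v : L2 d) : mulOp b hb v = c • mulOp a ha v := by
  apply Lp.ext
  filter_upwards [coeFn_mulOp a ha v, coeFn_mulOp b hb v, Lp.coeFn_smul c (mulOp a ha v)]
    with ξ h1 h2 h3
  rw [h3, Pi.smul_apply, h1, h2, h, smul_eq_mul, mul_assoc]

theorem fourier_injective {u v : L2 d} (h : (𝓕 u : L2 d) = 𝓕 v) : u = v :=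
  (Lp.fourierTransformₗᵢ (E d) ℂ).injective h

theorem fourierMul_smul {a b : E d → ℂ} (ha : MemLp a ∞ volume) (hb : MemLp b ∞ volume) {c : ℂ}
    (h : ∀ ξ, b ξ = c * a ξ) (v : L2 d) : fourierMul b hb v = c • fourierMul a ha v := by
  apply fourier_injective
  rw [fourier_fourierMul, mulOp_smul ha hb h, ← fourier_fourierMul, fourier_smul]

theorem norm_japInvL (v : L2 d) : ‖H1.japInvL v‖ = ‖v‖ := (H1.jap (d := d)).symm.norm_map v

theorem norm_japL (f : H1 d) : ‖H1.japL f‖ = ‖f‖ := (H1.jap (d := d)).norm_map f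

theorem fourier_japL (f : H1 d) : (𝓕 (H1.japL f) : L2 d) = H1.weighted f :=
  (Lp.fourierTransformₗᵢ (E d) ℂ).apply_symm_apply _

theorem japL_japInvL (v : L2 d) : H1.japL (H1.japInvL v) = v :=
  (H1.jap (d := d)).apply_symm_apply v

theorem fourier_incl (f : H1 d) :
    (𝓕 (H1.incl f) : L2 d) = mulOp _ (memLp_inv_japD d) (𝓕 (H1.japL f)) := by
  rw [fourier_japL, H1.mulOp_weighted]

theorem incl_eq (f : H1 d) : H1.incl f = fourierMul _ (memLp_inv_japD d) (H1.japL f) := by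
  apply fourier_injective
  rw [fourier_incl, fourier_fourierMul]

/-- The inclusion `H¹(ℝ^d) → L²(ℝ^d)` as a bounded operator. -/
noncomputable def inclL : H1 d →L[ℂ] L2 d := fourierMul _ (memLp_inv_japD d) ∘L H1.japL

theorem inclL_apply (f : H1 d) : inclL f = H1.incl f := (incl_eq f).symm

theorem inclL_japInvL_fourierMul {a b : E d → ℂ} (ha : MemLp a ∞ volume) (hb : MemLp b ∞ volume)
    (h : ∀ ξ, a ξ = japD ξ * b ξ) (v : L2 d) :
    inclL (H1.japInvL (fourierMul a ha v)) = fourierMul b hb v := by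
  apply fourier_injective
  rw [inclL, ContinuousLinearMap.comp_apply, japL_japInvL, fourier_fourierMul, fourier_fourierMul,
    fourier_fourierMul, mulOp_mulOp _ _ hb]
  intro ξ
  have : (japD ξ : ℂ) ≠ 0 := Complex.ofReal_ne_zero.2 (japD_pos ξ).ne'
  rw [h]
  push_cast
  field_simp

theorem inclL_japInvL_fourierMul_japL {a : E d → ℂ} (ha : MemLp a ∞ volume) (f : H1 d) :
    inclL (H1.japInvL (fourierMul a ha (H1.japL f))) = fourierMul a ha (inclL f) := by
  apply fourier_injective
  have hc : MemLp (fun ξ => (((japD ξ)⁻¹ : ℝ) : ℂ) * a ξ) ∞ (volume : Measure (E d)) := by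
    refine MemLp.of_le ha ((memLp_inv_japD d).1.mul ha.1) (Eventually.of_forall fun ξ => ?_)
    rw [norm_mul, Complex.norm_real, Real.norm_of_nonneg (inv_nonneg.2 (japD_pos ξ).le)]
    exact mul_le_of_le_one_left (norm_nonneg _) (inv_le_one_of_one_le₀ (one_le_japD ξ))
  rw [inclL, ContinuousLinearMap.comp_apply, ContinuousLinearMap.comp_apply, japL_japInvL,
    fourier_fourierMul, fourier_fourierMul, fourier_fourierMul, fourier_fourierMul,
    mulOp_mulOp _ _ hc fun _ => rfl, mulOp_mulOp _ _ hc fun _ => mul_comm _ _]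

/-! ### Operators on the state space -/

/-- The operator with the given components. -/
noncomputable def statePair {X : Type*} [NormedAddCommGroup X] [NormedSpace ℂ X]
    (A : X →L[ℂ] H1 d) (B : X →L[ℂ] L2 d) : X →L[ℂ] State d :=
  ((WithLp.prodContinuousLinearEquiv 2 ℂ (H1 d) (L2 d)).symm : H1 d × L2 d →L[ℂ] State d) ∘L
    A.prod B

theorem norm_toLp_le (f : H1 d) (g : L2 d) : ‖(WithLp.toLp 2 (f, g) : State d)‖ ≤ ‖f‖ + ‖g‖ := by
  rw [WithLp.prod_norm_eq_of_L2]
  refine Real.sqrt_le_iff.2 ⟨by positivity, ?_⟩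
  simp only [WithLp.toLp_fst, WithLp.toLp_snd]
  nlinarith [norm_nonneg f, norm_nonneg g]

theorem continuous_cosL2 : Continuous fun q : ℝ × L2 d => cosL2 q.1 q.2 :=
  continuous_fourierMul (memLp_cos d) (fun ξ => by fun_prop) (C := fun _ => 1) continuous_const
    fun t ξ => by rw [Complex.norm_real]; exact Real.abs_cos_le_one _

theorem norm_sinc_symbol_le (t : ℝ) (ξ : E d) :
    ‖((japD ξ * (t * Real.sinc (t * absD ξ)) : ℝ) : ℂ)‖ ≤ 1 + |t| := by
  rw [Complex.norm_real, Real.norm_eq_abs]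
  have h1 : |t * Real.sinc (t * absD ξ)| ≤ |t| := by
    rw [abs_mul]
    exact mul_le_of_le_one_right (abs_nonneg t) (Real.abs_sinc_le_one _)
  have h2 := abs_mul_sinc_le (t := t) (absD_nonneg ξ)
  rw [abs_mul, abs_of_pos (japD_pos ξ)]
  nlinarith [japD_le ξ, abs_nonneg (t * Real.sinc (t * absD ξ))]

theorem norm_absD_sin_symbol_le (t : ℝ) (ξ : E d) :
    ‖((-(absD ξ * Real.sin (t * absD ξ)) / japD ξ : ℝ) : ℂ)‖ ≤ 1 := by
  rw [Complex.norm_real, Real.norm_eq_abs, abs_div, abs_neg, abs_mul,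
    abs_of_nonneg (absD_nonneg ξ), abs_of_pos (japD_pos ξ), div_le_one (japD_pos ξ)]
  nlinarith [absD_le_japD ξ, absD_nonneg ξ, Real.abs_sin_le_one (t * absD ξ)]

theorem continuous_sinL2H1 : Continuous fun q : ℝ × L2 d => sinL2H1 q.1 q.2 := by
  have := continuous_fourierMul (memLp_japD_sinc d)
    (fun ξ => by have := Real.continuous_sinc; fun_prop) (C := fun t => 1 + |t|) (by fun_prop)
    norm_sinc_symbol_le
  simp only [sinL2H1, ContinuousLinearMap.comp_apply]
  exact (H1.japInvL (d := d)).continuous.comp' this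

theorem continuous_cosH1 : Continuous fun q : ℝ × H1 d => cosH1 q.1 q.2 := by
  have h1 : Continuous fun q : ℝ × H1 d => (q.1, H1.japL q.2) :=
    continuous_fst.prodMk ((H1.japL (d := d)).continuous.comp continuous_snd)
  have h2 := Continuous.comp' (g := fun q : ℝ × L2 d => cosL2 q.1 q.2) continuous_cosL2 h1
  simp only [cosH1, ContinuousLinearMap.comp_apply]
  exact (H1.japInvL (d := d)).continuous.comp' h2

theorem continuous_lapSinH1L2 : Continuous fun q : ℝ × H1 d => lapSinH1L2 q.1 q.2 := by
  have h1 : Continuous fun q : ℝ × H1 d => (q.1, H1.japL q.2) :=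
    continuous_fst.prodMk ((H1.japL (d := d)).continuous.comp continuous_snd)
  have := continuous_fourierMul (memLp_absD_sin d) (fun ξ => by fun_prop) (C := fun _ => 1)
    continuous_const norm_absD_sin_symbol_le
  have h2 := Continuous.comp'
    (g := fun q : ℝ × L2 d => fourierMul _ (memLp_absD_sin d q.1) q.2) this h1
  simp only [lapSinH1L2, ContinuousLinearMap.comp_apply]
  exact h2

theorem continuous_freeWave : Continuous fun q : ℝ × State d => freeWave q.1 q.2 := by
  have hf : Continuous fun q : ℝ × State d => (q.1, q.2.fst) :=
    continuous_fst.prodMk ((WithLp.continuous_fst 2 _ _).comp continuous_snd)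
  have hs : Continuous fun q : ℝ × State d => (q.1, q.2.snd) :=
    continuous_fst.prodMk ((WithLp.continuous_snd 2 _ _).comp continuous_snd)
  have h1 := Continuous.comp' (g := fun q : ℝ × H1 d => cosH1 q.1 q.2) continuous_cosH1 hf
  have h2 := Continuous.comp' (g := fun q : ℝ × L2 d => sinL2H1 q.1 q.2) continuous_sinL2H1 hs
  have h3 := Continuous.comp' (g := fun q : ℝ × H1 d => lapSinH1L2 q.1 q.2) continuous_lapSinH1L2 hf
  have h4 := Continuous.comp' (g := fun q : ℝ × L2 d => cosL2 q.1 q.2) continuous_cosL2 hs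
  unfold freeWave
  exact Continuous.comp' (WithLp.prod_continuous_toLp 2 (H1 d) (L2 d))
    ((h1.add h2).prodMk (h3.add h4))

theorem norm_cosL2_le (t : ℝ) (v : L2 d) : ‖cosL2 t v‖ ≤ ‖v‖ := by
  have := norm_fourierMul_le (memLp_cos d t) (C := 1)
    (fun ξ => by rw [Complex.norm_real]; exact Real.abs_cos_le_one _) v
  rwa [one_mul] at this

theorem norm_sinL2H1_le (t : ℝ) (v : L2 d) : ‖sinL2H1 t v‖ ≤ (1 + |t|) * ‖v‖ := by
  rw [sinL2H1, ContinuousLinearMap.comp_apply, norm_japInvL]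
  exact norm_fourierMul_le _ (norm_sinc_symbol_le t) v

theorem norm_freeWave_le (t : ℝ) (h : State d) : ‖freeWave t h‖ ≤ (4 + |t|) * ‖h‖ := by
  have hf : ‖h.fst‖ ≤ ‖h‖ := WithLp.norm_fst_le (p := 2) _ h
  have hs : ‖h.snd‖ ≤ ‖h‖ := WithLp.norm_snd_le (p := 2) _ h
  have h1 : ‖cosH1 t h.fst‖ ≤ ‖h.fst‖ := by
    rw [cosH1, ContinuousLinearMap.comp_apply, norm_japInvL, ContinuousLinearMap.comp_apply,
      ← norm_japL h.fst]
    exact norm_cosL2_le t _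
  have h2 := norm_sinL2H1_le t h.snd
  have h3 : ‖lapSinH1L2 t h.fst‖ ≤ ‖h.fst‖ := by
    rw [lapSinH1L2, ContinuousLinearMap.comp_apply, ← norm_japL h.fst]
    simpa using norm_fourierMul_le (memLp_absD_sin d t) (norm_absD_sin_symbol_le t) (H1.japL h.fst)
  have h4 := norm_cosL2_le t h.snd
  refine (norm_toLp_le _ _).trans ?_
  have h5 := norm_add_le (cosH1 t h.fst) (sinL2H1 t h.snd)
  have h6 := norm_add_le (lapSinH1L2 t h.fst) (cosL2 t h.snd)
  nlinarith [abs_nonneg t]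

theorem potential_eq {V : E d → ℂ} (hV : MemLp V ∞ volume) (h : State d) :
    potential V hV h = WithLp.toLp 2 (0, mulOp V hV (inclL h.fst)) := by
  rw [inclL_apply]; rfl

/-! ### Laplace transforms -/

theorem memLp_japD_resSymbol (s : ℝ) :
    MemLp (fun ξ => (japD ξ : ℂ) * resSymbol (pt s) ξ) ∞ (volume : Measure (E d)) := by
  refine memLp_top_of_bound ((Complex.continuous_ofReal.comp continuous_japD).mul
    (continuous_resSymbol_right s)).aestronglyMeasurable (2 + ‖pt s‖ ^ 2)
    (Eventually.of_forall fun ξ => ?_)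
  rw [norm_mul, Complex.norm_real, Real.norm_of_nonneg (japD_pos ξ).le]
  refine le_trans ?_ (sq_japD_mul_norm_resSymbol_le s ξ)
  gcongr
  nlinarith [one_le_japD ξ]

theorem norm_japD_resSymbol_le (s : ℝ) (ξ : E d) :
    ‖(japD ξ : ℂ) * resSymbol (pt s) ξ‖ ≤ 2 + ‖pt s‖ ^ 2 := by
  rw [norm_mul, Complex.norm_real, Real.norm_of_nonneg (japD_pos ξ).le]
  refine le_trans ?_ (sq_japD_mul_norm_resSymbol_le s ξ)
  gcongr
  nlinarith [one_le_japD ξ]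

theorem memLp_pt_resSymbol (s : ℝ) :
    MemLp (fun ξ => pt s * resSymbol (pt s) ξ) ∞ (volume : Measure (E d)) :=
  (memLp_resSymbol_top s).const_mul _

/-- The operator `v ↦ ((p² - Δ)⁻¹ v, p (p² - Δ)⁻¹ v)` with `p = 1 - 2πis`. -/
noncomputable def waveOut (s : ℝ) : L2 d →L[ℂ] State d :=
  statePair (H1.japInvL ∘L fourierMul _ (memLp_japD_resSymbol s)) (pt s • resolvent s)

/-- The operator `(f, g) ↦ p f + g` with `p = 1 - 2πis`. -/
noncomputable def waveIn (s : ℝ) : State d →L[ℂ] L2 d :=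
  pt s • (inclL ∘L WithLp.fstL 2 ℂ (H1 d) (L2 d)) + WithLp.sndL 2 ℂ (H1 d) (L2 d)

theorem inclL_fst_waveOut (s : ℝ) (v : L2 d) : inclL (waveOut s v).fst = resolvent s v :=
  inclL_japInvL_fourierMul _ _ (fun _ => rfl) v

/-- Under the trace the outer factors meet in this order. Position and velocity each contribute pR,
and the sum 2pR is what later puts the length of one edge into the trace. -/
theorem waveIn_waveOut (s : ℝ) (v : L2 d) :
    waveIn s (waveOut s v) = (2 * pt s) • resolvent s v := by
  have : waveIn s (waveOut s v) = pt s • inclL (waveOut s v).fst + (waveOut s v).snd := rfl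
  rw [this, inclL_fst_waveOut]
  change _ + pt s • resolvent s v = _
  rw [← add_smul, two_mul]

theorem ae_absD_ne_zero (hd : 1 ≤ d) : ∀ᵐ ξ : E d, absD ξ ≠ 0 := by
  have : Nontrivial (E d) := Module.nontrivial_of_finrank_pos (R := ℝ) (by simp; omega)
  have h0 : ∀ᵐ ξ : E d, ξ ≠ 0 := by simp [ae_iff]
  filter_upwards [h0] with ξ hξ
  have := norm_pos_iff.2 hξ
  have := Real.pi_pos
  unfold absD
  positivity

theorem laplace_cosL2 (s : ℝ) (v : L2 d) :
    IntegrableOn (fun t => lapWeight s t • cosL2 t v) (Set.Ioi 0) ∧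
      ∫ t in Set.Ioi (0 : ℝ), lapWeight s t • cosL2 t v =
        fourierMul _ (memLp_pt_resSymbol s) v :=
  integral_fourierMul (memLp_cos d)
    (by have := continuous_absD (d := d); fun_prop) (C := fun _ => 1) continuous_const
    (fun t ξ => by rw [Complex.norm_real]; exact Real.abs_cos_le_one _) (continuous_lapWeight s)
    (by simpa using integrableOn_lapWeight_mul s 1 0) (memLp_pt_resSymbol s)
    (Eventually.of_forall fun ξ => integral_lapWeight_mul_cos s (absD ξ)) v

theorem laplace_sinL2H1 (hd : 1 ≤ d) (s : ℝ) (v : L2 d) :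
    IntegrableOn (fun t => lapWeight s t • sinL2H1 t v) (Set.Ioi 0) ∧
      ∫ t in Set.Ioi (0 : ℝ), lapWeight s t • sinL2H1 t v =
        H1.japInvL (fourierMul _ (memLp_japD_resSymbol s) v) := by
  have h := integral_fourierMul (memLp_japD_sinc d)
    (by
      have := continuous_absD (d := d)
      have := continuous_japD (d := d)
      have := Real.continuous_sinc
      fun_prop) (C := fun t => 1 + |t|) (by fun_prop) norm_sinc_symbol_le (continuous_lapWeight s)
    (by simpa using integrableOn_lapWeight_mul s 1 1) (memLp_japD_resSymbol s)
    (by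
      filter_upwards [ae_absD_ne_zero hd] with ξ hξ
      rw [resSymbol, ← integral_lapWeight_mul_sinc s hξ, ← integral_const_mul]
      congr 1
      funext t
      push_cast
      ring) v
  have h2 : ∀ t, lapWeight s t • sinL2H1 t v =
      H1.japInvL (lapWeight s t • fourierMul _ (memLp_japD_sinc d t) v) := fun t => by
    rw [map_smul]; rfl
  simp_rw [h2]
  refine ⟨(H1.japInvL (d := d)).integrable_comp h.1, ?_⟩
  rw [ContinuousLinearMap.integral_comp_comm _ h.1, h.2]

end WaveGroup

end WaveTrace

namespace WaveTrace

/-! ### Laplace transform of the Duhamel terms -/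

section DuhamelLaplace

open Filter Topology

variable {d : ℕ}

theorem continuous_freeWave_comp {X : Type*} [TopologicalSpace X] {f : X → ℝ} {g : X → State d}
    (hf : Continuous f) (hg : Continuous g) : Continuous fun x => freeWave (f x) (g x) := by
  have := Continuous.comp' (g := fun q : ℝ × State d => freeWave q.1 q.2)
    (f := fun x => (f x, g x)) continuous_freeWave (hf.prodMk hg)
  exact this

/-- The free wave with data `(0, v)`. -/
noncomputable def sourceWave (t : ℝ) (v : L2 d) : State d := freeWave t (WithLp.toLp 2 (0, v))

theorem sourceWave_eq (t : ℝ) (v : L2 d) :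
    sourceWave t v = WithLp.toLp 2 (sinL2H1 t v, cosL2 t v) := by
  simp [sourceWave, freeWave]

theorem continuous_sourceWave {X : Type*} [TopologicalSpace X] {f : X → ℝ} {g : X → L2 d}
    (hf : Continuous f) (hg : Continuous g) : Continuous fun x => sourceWave (f x) (g x) := by
  have h : Continuous fun x => (WithLp.toLp 2 ((0 : H1 d), g x) : State d) := by
    have := Continuous.comp' (f := fun x => ((0 : H1 d), g x))
      (WithLp.prod_continuous_toLp 2 (H1 d) (L2 d)) (continuous_const.prodMk hg)
    exact this
  exact continuous_freeWave_comp hf h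

theorem norm_sourceWave_le (t : ℝ) (v : L2 d) : ‖sourceWave t v‖ ≤ (4 + |t|) * ‖v‖ := by
  refine (norm_freeWave_le t _).trans (le_of_eq ?_)
  rw [WithLp.norm_toLp_snd]

theorem sourceWave_smul (t : ℝ) (c : ℂ) (v : L2 d) :
    sourceWave t (c • v) = c • sourceWave t v := by
  rw [sourceWave_eq, sourceWave_eq, map_smul, map_smul]; rfl

theorem integrableOn_lapWeight_freeWave (s : ℝ) (h : State d) :
    IntegrableOn (fun t => lapWeight s t • freeWave t h) (Set.Ioi 0) := by
  refine Integrable.mono' ((integrableOn_lapWeight_mul s 4 1).mul_const ‖h‖)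
    ((continuous_lapWeight s).smul
      (continuous_freeWave_comp continuous_id continuous_const)).aestronglyMeasurable
        (Eventually.of_forall fun t => ?_)
  rw [norm_smul, mul_assoc, one_mul]
  exact mul_le_mul_of_nonneg_left (norm_freeWave_le t h) (norm_nonneg _)

theorem laplace_sourceWave (hd : 1 ≤ d) (s : ℝ) (v : L2 d) :
    ∫ t in Set.Ioi (0 : ℝ), lapWeight s t • sourceWave t v = waveOut s v := by
  obtain ⟨i1, e1⟩ := laplace_sinL2H1 hd s v
  obtain ⟨i2, e2⟩ := laplace_cosL2 s v
  set L : H1 d × L2 d →L[ℂ] State d :=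
    (WithLp.prodContinuousLinearEquiv 2 ℂ (H1 d) (L2 d)).symm.toContinuousLinearMap
  have h1 : ∀ t, lapWeight s t • sourceWave t v =
      L (lapWeight s t • sinL2H1 t v, lapWeight s t • cosL2 t v) := fun t => by
    rw [sourceWave_eq]; rfl
  simp_rw [h1]
  rw [ContinuousLinearMap.integral_comp_comm _ (i1.prodMk i2), integral_pair i1 i2, e1, e2,
    fourierMul_smul (memLp_resSymbol_top s) (memLp_pt_resSymbol s) (fun _ => rfl) v]
  rfl

theorem laplace_freeWave (hd : 1 ≤ d) (s : ℝ) (h : State d) :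
    inclL (∫ t in Set.Ioi (0 : ℝ), lapWeight s t • freeWave t h).fst =
      resolvent s (waveIn s h) := by
  obtain ⟨i1, e1⟩ := laplace_sinL2H1 hd s h.snd
  obtain ⟨i2, e2⟩ := laplace_cosL2 s (H1.japL h.fst)
  set L : State d →L[ℂ] L2 d := inclL ∘L WithLp.fstL 2 ℂ (H1 d) (L2 d)
  change L (∫ t in Set.Ioi (0 : ℝ), lapWeight s t • freeWave t h) = _
  rw [← ContinuousLinearMap.integral_comp_comm _ (integrableOn_lapWeight_freeWave s h)]
  set L' : L2 d →L[ℂ] L2 d := inclL ∘L H1.japInvL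
  have h1 : ∀ t, L (lapWeight s t • freeWave t h) =
      L' (lapWeight s t • cosL2 t (H1.japL h.fst)) + inclL (lapWeight s t • sinL2H1 t h.snd) :=
    fun t => by
      rw [map_smul, map_smul, map_smul, ← smul_add]
      congr 1
      change inclL (cosH1 t h.fst + sinL2H1 t h.snd) = _
      rw [map_add]
      rfl
  simp_rw [h1]
  rw [integral_add (L'.integrable_comp i2) ((inclL (d := d)).integrable_comp i1),
    ContinuousLinearMap.integral_comp_comm _ i2, ContinuousLinearMap.integral_comp_comm _ i1,
    e1, e2, inclL_japInvL_fourierMul (memLp_japD_resSymbol s) (memLp_resSymbol_top s)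
      (fun _ => rfl)]
  change inclL (H1.japInvL _) + _ = _
  rw [inclL_japInvL_fourierMul_japL, fourierMul_smul (memLp_resSymbol_top s)
    (memLp_pt_resSymbol s) (fun _ => rfl)]
  have : waveIn s h = pt s • inclL h.fst + h.snd := rfl
  rw [this, map_add, map_smul]
  rfl

theorem lapWeight_mul (s a b : ℝ) : lapWeight s a * lapWeight s b = lapWeight s (a + b) := by
  rw [lapWeight, lapWeight, lapWeight, ← Complex.exp_add]
  congr 1
  push_cast
  ring

/-- The convolution theorem: since e^{-pt} = e^{-pσ}e^{-p(t-σ)}, the double integral over 0 < σ < t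
becomes a product integral over a quadrant. -/
theorem laplace_duhamel (hd : 1 ≤ d) (s : ℝ) {v : ℝ → L2 d} (hv : Continuous v)
    (hi : IntegrableOn (fun t => lapWeight s t • v t) (Set.Ioi 0)) :
    IntegrableOn (fun t => lapWeight s t • ∫ σ in (0 : ℝ)..t, sourceWave (t - σ) (v σ))
        (Set.Ioi 0) ∧
      ∫ t in Set.Ioi (0 : ℝ), lapWeight s t • ∫ σ in (0 : ℝ)..t, sourceWave (t - σ) (v σ) =
        waveOut s (∫ t in Set.Ioi (0 : ℝ), lapWeight s t • v t) := by
  set f : ℝ × ℝ → State d := fun q => lapWeight s q.2 • sourceWave q.2 (lapWeight s q.1 • v q.1)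
    with hf
  have hfc : Continuous f := by
    refine ((continuous_lapWeight s).comp continuous_snd).smul ?_
    exact continuous_sourceWave continuous_snd (((continuous_lapWeight s).comp continuous_fst).smul
      (hv.comp continuous_fst))
  have hfi : IntegrableOn f (Set.Ioi 0 ×ˢ Set.Ioi 0) (volume.prod volume) := by
    rw [IntegrableOn, ← Measure.prod_restrict]
    refine Integrable.mono' (Integrable.mul_prod hi.norm (integrableOn_lapWeight_mul s 4 1))
      hfc.aestronglyMeasurable (Eventually.of_forall fun q => ?_)
    rw [hf, norm_smul]
    have := norm_sourceWave_le q.2 (lapWeight s q.1 • v q.1)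
    calc _ ≤ ‖lapWeight s q.2‖ * ((4 + |q.2|) * ‖lapWeight s q.1 • v q.1‖) :=
          mul_le_mul_of_nonneg_left this (norm_nonneg _)
      _ = _ := by ring
  have hms : MeasurableSet (Set.Ioi (0 : ℝ) ×ˢ Set.Ioi (0 : ℝ)) :=
    measurableSet_Ioi.prod measurableSet_Ioi
  set F : ℝ × ℝ → State d := (Set.Ioi 0 ×ˢ Set.Ioi 0).indicator f with hF
  have hFi : Integrable F (volume.prod volume) := (integrable_indicator_iff hms).2 hfi
  -- The shear (σ, t) ↦ (σ, t - σ) carries the region 0 < σ < t onto the quadrant.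
  have hmp : MeasurePreserving (fun z : ℝ × ℝ => (z.1, -z.1 + z.2)) (volume.prod volume)
    (volume.prod volume) := measurePreserving_prod_neg_add volume volume
  have hGi : Integrable (fun z : ℝ × ℝ => F (z.1, -z.1 + z.2)) (volume.prod volume) :=
    hmp.integrable_comp_of_integrable hFi
  have hFG : ∫ z : ℝ × ℝ, F (z.1, -z.1 + z.2) ∂(volume.prod volume) =
      ∫ z, F z ∂(volume.prod volume) := by
    refine hmp.integral_comp ?_ F
    exact (MeasurableEquiv.shearAddRight ℝ).symm.measurableEmbedding
  have hF1 : ∫ z, F z ∂(volume.prod volume) =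
      waveOut s (∫ t in Set.Ioi (0 : ℝ), lapWeight s t • v t) := by
    have h1 : ∀ σ, ∫ τ in Set.Ioi (0 : ℝ), f (σ, τ) = waveOut s (lapWeight s σ • v σ) :=
      fun σ => by
        simp only [hf]
        exact laplace_sourceWave hd s (lapWeight s σ • v σ)
    rw [hF, integral_indicator hms, setIntegral_prod _ hfi]
    simp_rw [h1]
    exact ContinuousLinearMap.integral_comp_comm _ hi
  have hG : ∀ t, ∫ σ, F (σ, -σ + t) = (Set.Ioi (0 : ℝ)).indicator
      (fun t => lapWeight s t • ∫ σ in (0 : ℝ)..t, sourceWave (t - σ) (v σ)) t := by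
    intro t
    have h1 : ∀ σ, F (σ, -σ + t) = (Set.Ioo 0 t).indicator
        (fun σ => lapWeight s t • sourceWave (t - σ) (v σ)) σ := by
      intro σ
      by_cases hσ : σ ∈ Set.Ioo 0 t
      · rw [Set.indicator_of_mem hσ, hF, Set.indicator_of_mem, hf]
        · simp only
          rw [sourceWave_smul, smul_smul, lapWeight_mul]
          congr 2
          · ring
          · ring
        · exact ⟨hσ.1, by simp only [Set.mem_Ioi]; linarith [hσ.2]⟩
      · rw [Set.indicator_of_notMem hσ, hF, Set.indicator_of_notMem]
        rintro ⟨h1, h2⟩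
        simp only [Set.mem_Ioi] at h1 h2
        exact hσ ⟨h1, by linarith⟩
    simp_rw [h1]
    rw [integral_indicator measurableSet_Ioo, integral_smul]
    by_cases ht : t ∈ Set.Ioi (0 : ℝ)
    · rw [Set.indicator_of_mem ht, intervalIntegral.integral_of_le (le_of_lt ht),
        integral_Ioc_eq_integral_Ioo]
    · rw [Set.indicator_of_notMem ht, Set.Ioo_eq_empty (by simpa using ht)]
      simp
  have hGi' := hGi.integral_prod_right
  simp_rw [hG] at hGi'
  refine ⟨(integrable_indicator_iff measurableSet_Ioi).1 hGi', ?_⟩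
  rw [← hF1, ← hFG, integral_prod_symm _ hGi]
  simp_rw [hG]
  rw [integral_indicator measurableSet_Ioi]

variable {V : E d → ℂ} (hV : MemLp V ∞ volume)

theorem duhamelTerm_zero (h : State d) : duhamelTerm V hV 0 h = fun t => freeWave t h := rfl

theorem duhamelTerm_succ (k : ℕ) (h : State d) (t : ℝ) : duhamelTerm V hV (k + 1) h t =
    ∫ σ in (0 : ℝ)..t, sourceWave (t - σ) (mulOp V hV (inclL (duhamelTerm V hV k h σ).fst)) := by
  simp only [duhamelTerm, Function.iterate_succ_apply', duhamel, potential_eq, sourceWave]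

theorem continuous_mulOp_inclL_fst {F : ℝ → State d} (hF : Continuous F) :
    Continuous fun t => mulOp V hV (inclL (F t).fst) := by
  have h1 : Continuous fun t => (F t).fst := (WithLp.continuous_fst 2 (H1 d) (L2 d)).comp hF
  have h2 : Continuous fun t => inclL (F t).fst := (inclL (d := d)).continuous.comp h1
  exact (mulOp V hV).continuous.comp h2

theorem continuous_duhamelTerm (k : ℕ) (h : State d) : Continuous (duhamelTerm V hV k h) := by
  induction k with
  | zero =>
    rw [duhamelTerm_zero]
    exact continuous_freeWave_comp continuous_id continuous_const
  | succ k ih =>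
    have h1 := continuous_mulOp_inclL_fst hV ih
    have h2 : duhamelTerm V hV (k + 1) h = fun t => ∫ σ in (0 : ℝ)..t,
        sourceWave (t - σ) (mulOp V hV (inclL (duhamelTerm V hV k h σ).fst)) :=
      funext (duhamelTerm_succ hV k h)
    rw [h2]
    refine intervalIntegral.continuous_parametric_intervalIntegral_of_continuous
      (f := fun t σ => sourceWave (t - σ) (mulOp V hV (inclL (duhamelTerm V hV k h σ).fst)))
      ?_ continuous_id
    exact continuous_sourceWave (continuous_fst.sub continuous_snd) (h1.comp continuous_snd)

/-- The operator `V (p² - Δ)⁻¹` with `p = 1 - 2πis`. -/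
noncomputable def birman (s : ℝ) : L2 d →L[ℂ] L2 d := mulOp V hV ∘L resolvent s

/-- The potential only sees the first component of the state. The induction therefore tracks V times
the first component of the transform, and each Duhamel step multiplies it by VR. -/
theorem laplace_duhamelTerm (hd : 1 ≤ d) (s : ℝ) (k : ℕ) (h : State d) :
    IntegrableOn (fun t => lapWeight s t • duhamelTerm V hV (k + 1) h t) (Set.Ioi 0) ∧
      ∫ t in Set.Ioi (0 : ℝ), lapWeight s t • duhamelTerm V hV (k + 1) h t =
        waveOut s ((birman hV s ^ (k + 1)) (waveIn s h)) := by
  set L : State d →L[ℂ] L2 d := mulOp V hV ∘L inclL ∘L WithLp.fstL 2 ℂ (H1 d) (L2 d) with hL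
  have hLs : ∀ (t : ℝ) (F : ℝ → State d), lapWeight s t • mulOp V hV (inclL (F t).fst) =
      L (lapWeight s t • F t) := fun t F => by rw [map_smul]; rfl
  have key : ∀ k, IntegrableOn (fun t => lapWeight s t • duhamelTerm V hV k h t) (Set.Ioi 0) ∧
      L (∫ t in Set.Ioi (0 : ℝ), lapWeight s t • duhamelTerm V hV k h t) =
        (birman hV s ^ (k + 1)) (waveIn s h) := by
    intro k
    induction k with
    | zero =>
      refine ⟨integrableOn_lapWeight_freeWave s h, ?_⟩
      rw [zero_add, pow_one]
      exact congrArg (mulOp V hV) (laplace_freeWave hd s h)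
    | succ k ih =>
      have h1 := laplace_duhamel hd s
        (continuous_mulOp_inclL_fst hV (continuous_duhamelTerm hV k h)) (by
          simp_rw [hLs]; exact L.integrable_comp ih.1)
      simp_rw [← duhamelTerm_succ, hLs, ContinuousLinearMap.integral_comp_comm _ ih.1, ih.2] at h1
      refine ⟨h1.1, ?_⟩
      rw [h1.2, pow_succ' _ (k + 1), mul_apply_eq_comp]
      exact congrArg (mulOp V hV) (inclL_fst_waveOut s _)
  have h1 := laplace_duhamel hd s
    (continuous_mulOp_inclL_fst hV (continuous_duhamelTerm hV k h)) (by
      simp_rw [hLs]; exact L.integrable_comp (key k).1)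
  simp_rw [← duhamelTerm_succ, hLs, ContinuousLinearMap.integral_comp_comm _ (key k).1,
    (key k).2] at h1
  exact h1

end DuhamelLaplace

end WaveTrace

namespace WaveTrace

/-! ### Recovery of the half-line pairing from Laplace transforms -/

section HalfLine

open Filter Topology

theorem adjoint_l2Map_apply {H : Type} [NormedAddCommGroup H] [InnerProductSpace ℂ H]
    [CompleteSpace H] {Z : Type*} [MeasurableSpace Z] {μ : Measure Z} {x : Z → H}
    (hx : MemLp x 2 μ) (h : H) :
    ContinuousLinearMap.adjoint (l2Map hx) h = (memLp_inner_left hx h).toLp _ := by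
  refine ext_inner_left ℂ fun f => ?_
  rw [ContinuousLinearMap.adjoint_inner_right, inner_l2Map]

theorem exists_hasTrace_of_memLp {H : Type} [NormedAddCommGroup H] [InnerProductSpace ℂ H]
    [CompleteSpace H] {Z : Type*} [MeasurableSpace Z] {μ : Measure Z}
    [TopologicalSpace.SeparableSpace H] [TopologicalSpace.SeparableSpace (Lp ℂ 2 μ)] {x y : Z → H}
    (hx : MemLp x 2 μ) (hy : MemLp y 2 μ) :
    ∃ A : H →L[ℂ] H, (∀ h, A h = ∫ z, inner ℂ (x z) h • y z ∂μ) ∧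
      HasTrace A (∫ z, inner ℂ (x z) (y z) ∂μ) := by
  have hA : ∀ h, (l2Map hy ∘L ContinuousLinearMap.adjoint (l2Map hx)) h =
      ∫ z, inner ℂ (x z) h • y z ∂μ := fun h => by
    rw [ContinuousLinearMap.comp_apply, adjoint_l2Map_apply, l2Map_apply]
    apply integral_congr_ae
    filter_upwards [(memLp_inner_left hx h).coeFn_toLp] with z hz
    rw [hz]
  exact ⟨_, hA, hasTrace_of_integral hx hy hA⟩

instance separableSpace_Lp_two {Z : Type*} [MeasurableSpace Z] (μ : Measure Z) [IsSeparable μ] :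
    TopologicalSpace.SeparableSpace (Lp ℂ 2 μ) := by
  have : Fact ((2 : ℝ≥0∞) ≠ ∞) := ⟨by simp⟩
  infer_instance

instance separableSpace_state (d : ℕ) : TopologicalSpace.SeparableSpace (State d) := by
  have h1 : DenseRange (H1.japInvL (d := d)) := (H1.jap (d := d)).symm.surjective.denseRange
  have : TopologicalSpace.SeparableSpace (H1 d) :=
    h1.separableSpace (H1.japInvL (d := d)).continuous
  exact (WithLp.prodContinuousLinearEquiv 2 ℂ (H1 d) (L2 d)).symm.surjective
    |>.denseRange.separableSpace
    (WithLp.prodContinuousLinearEquiv 2 ℂ (H1 d) (L2 d)).symm.continuous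

/-! ### Inversion of the Laplace transform -/

/-- The function `t ↦ φ(t) e^t` as a Schwartz function. -/
noncomputable def expTest {φ : ℝ → ℂ} (hφ : ContDiff ℝ (⊤ : ℕ∞) φ) (hc : HasCompactSupport φ) :
    SchwartzMap ℝ ℂ :=
  HasCompactSupport.toSchwartzMap (f := fun t : ℝ => φ t * Complex.exp t) hc.mul_right
    (hφ.mul (Complex.contDiff_exp.comp Complex.ofRealCLM.contDiff))

/-- The Fourier transform of `t ↦ φ(t) e^t`. -/
noncomputable def expHat {φ : ℝ → ℂ} (hφ : ContDiff ℝ (⊤ : ℕ∞) φ) (hc : HasCompactSupport φ) :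
    SchwartzMap ℝ ℂ := 𝓕 (expTest hφ hc)

variable {φ : ℝ → ℂ} (hφ : ContDiff ℝ (⊤ : ℕ∞) φ) (hc : HasCompactSupport φ)

theorem lapWeight_eq (s t : ℝ) : lapWeight s t =
    Complex.exp (-t) * Complex.exp ((2 * Real.pi * inner ℝ s t : ℝ) * Complex.I) := by
  rw [lapWeight, ← Complex.exp_add]
  congr 1
  simp [pt]
  ring

/-- Fourier inversion for φ(t)e^t, multiplied by e^{-t}. -/
theorem integral_expHat_mul_lapWeight (t : ℝ) :
    ∫ s, expHat hφ hc s * lapWeight s t = φ t := by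
  have h1 : 𝓕⁻ (expHat hφ hc) = expTest hφ hc := FourierTransform.fourierInv_fourier_eq _
  have h2 := congrArg (fun f : SchwartzMap ℝ ℂ => f t) h1
  simp only [SchwartzMap.fourierInv_coe, Real.fourierInv_eq', smul_eq_mul] at h2
  have h3 : expTest hφ hc t = φ t * Complex.exp t := rfl
  rw [h3] at h2
  have h4 : ∀ s, expHat hφ hc s * lapWeight s t = Complex.exp (-t) *
      (Complex.exp ((2 * Real.pi * inner ℝ s t : ℝ) * Complex.I) * expHat hφ hc s) := fun s => by
    rw [lapWeight_eq]; ring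
  simp_rw [h4]
  rw [integral_const_mul, h2, mul_comm, mul_assoc, ← Complex.exp_add, add_neg_cancel,
    Complex.exp_zero, mul_one]

theorem continuous_lapWeight_uncurry : Continuous fun q : ℝ × ℝ => lapWeight q.1 q.2 := by
  have := continuous_pt
  unfold lapWeight
  fun_prop

/-- The modulus of the weight e^{-pt} does not depend on s, so integrability at s = 0 suffices for
Fubini. -/
theorem integral_expHat_smul_laplace {X : Type*} [NormedAddCommGroup X] [NormedSpace ℂ X]
    [CompleteSpace X] {F : ℝ → X} (hF : IntegrableOn (fun t => lapWeight 0 t • F t) (Set.Ioi 0)) :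
    ∫ s, expHat hφ hc s • ∫ t in Set.Ioi (0 : ℝ), lapWeight s t • F t =
      ∫ t in Set.Ioi (0 : ℝ), φ t • F t := by
  have hint : Integrable (fun q : ℝ × ℝ => expHat hφ hc q.1 • lapWeight q.1 q.2 • F q.2)
      (volume.prod (volume.restrict (Set.Ioi 0))) := by
    have h1 := Integrable.smul_prod ((expHat hφ hc).integrable (μ := volume)) hF
    have h2 : (fun q : ℝ × ℝ => expHat hφ hc q.1 • lapWeight q.1 q.2 • F q.2) =
        fun q : ℝ × ℝ => (lapWeight q.1 q.2 * (lapWeight 0 q.2)⁻¹) •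
          (expHat hφ hc q.1 • lapWeight 0 q.2 • F q.2) := by
      funext q
      have h0 : lapWeight 0 q.2 ≠ 0 := Complex.exp_ne_zero _
      simp only [smul_smul]
      congr 1
      field_simp
    rw [h2]
    refine h1.bdd_smul 1 (Continuous.aestronglyMeasurable ?_)
      (Eventually.of_forall fun q => ?_)
    · exact continuous_lapWeight_uncurry.mul
        (((continuous_lapWeight 0).comp continuous_snd).inv₀ fun q => Complex.exp_ne_zero _)
    · rw [norm_mul, norm_inv, norm_lapWeight, norm_lapWeight,
        mul_inv_cancel₀ (Real.exp_pos _).ne']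
  simp_rw [← integral_smul]
  rw [integral_integral_swap (f := fun s t => expHat hφ hc s • lapWeight s t • F t) hint]
  congr 1
  funext t
  simp_rw [smul_smul]
  rw [integral_smul_const, integral_expHat_mul_lapWeight]

theorem norm_expHat_le (N : ℕ) : ∃ C, 0 ≤ C ∧
    ∀ s, ‖expHat hφ hc s‖ * (1 + s ^ 2) ^ N ≤ C := by
  obtain ⟨C0, hC0⟩ := (expHat hφ hc).decay 0 0
  obtain ⟨C1, hC1⟩ := (expHat hφ hc).decay (2 * N) 0
  refine ⟨2 ^ (N - 1) * (C0 + C1), mul_nonneg (by positivity) (add_nonneg hC0.1.le hC1.1.le),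
    fun s => ?_⟩
  have h0 := hC0.2 s
  have h1 := hC1.2 s
  rw [norm_iteratedFDeriv_zero] at h0 h1
  rw [pow_zero, one_mul] at h0
  have h2 := add_pow_le (zero_le_one (α := ℝ)) (sq_nonneg s) N
  rw [one_pow, ← pow_mul] at h2
  rw [Real.norm_eq_abs, pow_mul, sq_abs, ← pow_mul] at h1
  calc ‖expHat hφ hc s‖ * (1 + s ^ 2) ^ N
      ≤ ‖expHat hφ hc s‖ * (2 ^ (N - 1) * (1 + s ^ (2 * N))) := by gcongr
    _ = 2 ^ (N - 1) * (‖expHat hφ hc s‖ + s ^ (2 * N) * ‖expHat hφ hc s‖) := by ring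
    _ ≤ _ := by gcongr

end HalfLine

/-! ### Bounds and adjoints for the resolvent and the outer factor -/

section RankOne

open Filter Topology

variable {d : ℕ}

theorem norm_resolvent_le (s : ℝ) (v : L2 d) : ‖resolvent s v‖ ≤ ‖v‖ := by
  have := norm_fourierMul_le (memLp_resSymbol_top s) (norm_resSymbol_le_one s) v
  rwa [one_mul] at this

theorem continuous_resolvent {X : Type*} [TopologicalSpace X] {f : X → ℝ} {g : X → L2 d}
    (hf : Continuous f) (hg : Continuous g) : Continuous fun x => resolvent (f x) (g x) := by
  have h := continuous_fourierMul (d := d) memLp_resSymbol_top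
    (fun ξ => continuous_const.div ((continuous_pt.pow 2).add continuous_const)
      fun s => pt_sq_add_ne_zero s _) (C := fun _ => 1) continuous_const norm_resSymbol_le_one
  have := Continuous.comp' (g := fun q : ℝ × L2 d => fourierMul _ (memLp_resSymbol_top q.1) q.2)
    (f := fun x => (f x, g x)) h (hf.prodMk hg)
  exact this

theorem continuous_waveOut {X : Type*} [TopologicalSpace X] {f : X → ℝ} {g : X → L2 d}
    (hf : Continuous f) (hg : Continuous g) : Continuous fun x => waveOut (f x) (g x) := by
  have h := continuous_fourierMul (d := d) memLp_japD_resSymbol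
    (fun ξ => continuous_const.mul (continuous_const.div
      ((continuous_pt.pow 2).add continuous_const) fun s => pt_sq_add_ne_zero s _))
    (C := fun s => 2 + ‖pt s‖ ^ 2) (by have := continuous_pt; fun_prop) norm_japD_resSymbol_le
  have h1 := Continuous.comp'
    (g := fun q : ℝ × L2 d => fourierMul _ (memLp_japD_resSymbol q.1) q.2)
    (f := fun x => (f x, g x)) h (hf.prodMk hg)
  have h2 := (H1.japInvL (d := d)).continuous.comp' h1
  have h3 : Continuous fun x => pt (f x) • resolvent (f x) (g x) :=
    (continuous_pt.comp hf).smul (continuous_resolvent hf hg)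
  have h4 := Continuous.comp' (WithLp.prod_continuous_toLp 2 (H1 d) (L2 d)) (h2.prodMk h3)
  exact h4

theorem norm_waveOut_le (s : ℝ) (v : L2 d) : ‖waveOut s v‖ ≤ 2 * (2 + ‖pt s‖ ^ 2) * ‖v‖ := by
  refine (norm_toLp_le _ _).trans ?_
  have h1 : ‖(H1.japInvL ∘L fourierMul _ (memLp_japD_resSymbol s)) v‖ ≤
      (2 + ‖pt s‖ ^ 2) * ‖v‖ := by
    rw [ContinuousLinearMap.comp_apply, norm_japInvL]
    exact norm_fourierMul_le _ (norm_japD_resSymbol_le s) v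
  have h2 : ‖(pt s • resolvent s) v‖ ≤ (2 + ‖pt s‖ ^ 2) * ‖v‖ := by
    rw [smul_apply, norm_smul]
    have h3 : ‖pt s‖ ≤ 2 + ‖pt s‖ ^ 2 := by nlinarith [sq_nonneg (‖pt s‖ - 1)]
    have := norm_resolvent_le s v
    gcongr
  exact (add_le_add h1 h2).trans (le_of_eq (by ring))

theorem inner_resolvent (s : ℝ) (u v : L2 d) :
    inner ℂ u (resolvent s v) = inner ℂ (resolvent (-s) u) v := by
  rw [← Lp.inner_fourier_eq, ← Lp.inner_fourier_eq (resolvent (-s) u), resolvent, resolvent,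
    fourier_fourierMul, fourier_fourierMul, L2.inner_def, L2.inner_def]
  apply integral_congr_ae
  filter_upwards [coeFn_mulOp _ (memLp_resSymbol_top s) (𝓕 v : L2 d),
    coeFn_mulOp _ (memLp_resSymbol_top (-s)) (𝓕 u : L2 d)] with ξ h1 h2
  rw [h1, h2, RCLike.inner_apply, RCLike.inner_apply, map_mul, conj_resSymbol, neg_neg]
  ring

end RankOne

end WaveTrace

namespace WaveTrace

/-! ### The half-line pairing as integral of rank one operators -/

section RankOneDecomposition

open Filter Topology

variable {d : ℕ}

theorem norm_pt_sq (s : ℝ) : ‖pt s‖ ^ 2 = 1 + (2 * Real.pi) ^ 2 * s ^ 2 := by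
  rw [← Complex.normSq_eq_norm_sq, Complex.normSq_apply]
  simp [pt]
  ring

theorem two_add_norm_pt_sq_le (s : ℝ) :
    2 + ‖pt s‖ ^ 2 ≤ (3 + (2 * Real.pi) ^ 2) * (1 + s ^ 2) := by
  rw [norm_pt_sq]
  nlinarith [sq_nonneg s, sq_nonneg (2 * Real.pi)]

theorem norm_pt_le (s : ℝ) : ‖pt s‖ ≤ 1 + ‖pt s‖ ^ 2 := by nlinarith [sq_nonneg (‖pt s‖ - 1)]

theorem norm_adjoint_waveIn_le : ∃ C, 0 ≤ C ∧ ∀ (s : ℝ) (g : L2 d),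
    ‖ContinuousLinearMap.adjoint (waveIn s) g‖ ≤ (2 + ‖pt s‖ ^ 2) * (C * ‖g‖) := by
  refine ⟨‖inclL ∘L WithLp.fstL 2 ℂ (H1 d) (L2 d)‖ + ‖WithLp.sndL 2 ℂ (H1 d) (L2 d)‖,
    by positivity, fun s g => ?_⟩
  refine (ContinuousLinearMap.le_opNorm _ _).trans ?_
  rw [LinearIsometryEquiv.norm_map, ← mul_assoc]
  gcongr
  refine (norm_add_le _ _).trans ?_
  rw [norm_smul, mul_add]
  have := norm_pt_le s
  gcongr
  · linarith
  · exact le_mul_of_one_le_left (norm_nonneg _) (by nlinarith [sq_nonneg ‖pt s‖])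

theorem continuous_adjoint_waveIn {X : Type*} [TopologicalSpace X] {f : X → ℝ} {g : X → L2 d}
    (hf : Continuous f) (hg : Continuous g) :
    Continuous fun x => ContinuousLinearMap.adjoint (waveIn (f x)) (g x) := by
  have h : ∀ x, ContinuousLinearMap.adjoint (waveIn (f x)) (g x) =
      (starRingEnd ℂ) (pt (f x)) •
        ContinuousLinearMap.adjoint (inclL ∘L WithLp.fstL 2 ℂ (H1 d) (L2 d)) (g x) +
        ContinuousLinearMap.adjoint (WithLp.sndL 2 ℂ (H1 d) (L2 d)) (g x) := fun x => by
    rw [waveIn, map_add, map_smulₛₗ, add_apply, smul_apply]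
  simp only [h]
  refine Continuous.add (Continuous.smul (Complex.continuous_conj.comp (continuous_pt.comp hf)) ?_)
    ?_
  · exact (ContinuousLinearMap.continuous _).comp hg
  · exact (ContinuousLinearMap.continuous _).comp hg

variable {V : E d → ℂ} (hV : MemLp V ∞ volume)

theorem norm_birman_pow_le {B : ℝ} (hB : ∀ y, ‖V y‖ ≤ B) (j : ℕ) (s : ℝ) (v : L2 d) :
    ‖(birman hV s ^ j) v‖ ≤ B ^ j * ‖v‖ := by
  have hB0 : 0 ≤ B := (norm_nonneg _).trans (hB 0)
  induction j with
  | zero => simp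
  | succ j ih =>
    rw [pow_succ', mul_apply_eq_comp, birman, ContinuousLinearMap.comp_apply, pow_succ', mul_assoc]
    refine (norm_mulOp_le _ (Eventually.of_forall hB) _).trans ?_
    gcongr
    exact (norm_resolvent_le _ _).trans ih

theorem continuous_birman_pow (j : ℕ) {X : Type*} [TopologicalSpace X] {f : X → ℝ} {g : X → L2 d}
    (hf : Continuous f) (hg : Continuous g) :
    Continuous fun x => (birman hV (f x) ^ j) (g x) := by
  induction j with
  | zero => exact hg
  | succ j ih =>
    simp_rw [pow_succ', mul_apply_eq_comp]
    have := (mulOp V hV).continuous.comp' (continuous_resolvent hf ih)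
    exact this

theorem integrableOn_mul_of_memLp {V : E d → ℂ} (hV : MemLp V ∞ volume)
    {S : Set (E d)} (hS : volume S ≠ ∞) (c : L2 d) :
    IntegrableOn (fun y => V y * c y) S := by
  have : IsFiniteMeasure (volume.restrict S) := ⟨by simpa using hS.lt_top⟩
  exact ((Lp.memLp c).restrict S |>.mul (hV.restrict S) : MemLp _ 2 _).integrable (by norm_num)

theorem integrableOn_smul_greenVec {V : E d → ℂ} (hV : MemLp V ∞ volume)
    {S : Set (E d)} (hS : volume S ≠ ∞) (hd : d ≤ 3) (s : ℝ) (c : L2 d) :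
    IntegrableOn (fun y => (V y * c y) • greenVec hd s y) S := by
  obtain ⟨h1, C, hC0, hC⟩ := exists_norm_greenVec_le hd
  refine (integrableOn_mul_of_memLp hV hS c).smul_bdd _ ?_
    (Eventually.of_forall (hC s))
  exact (h1.comp (Continuous.prodMk_right s)).aestronglyMeasurable

/-- Tested against u, the resolvent moves to the other side by `inner_resolvent`, where its values
at y are inner products with the Green function of pole y. -/
theorem resolvent_mulOp {S : Set (E d)} (hS : volume S ≠ ∞) (hVS : ∀ y, y ∉ S → V y = 0)
    (hd : d ≤ 3) (s : ℝ) (c : L2 d) :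
    resolvent s (mulOp V hV c) = ∫ y in S, (V y * c y) • greenVec hd s y := by
  refine ext_inner_left ℂ fun u => ?_
  rw [inner_resolvent, ← integral_inner (integrableOn_smul_greenVec hV hS hd s c),
    setIntegral_eq_integral_of_forall_compl_eq_zero fun y hy => by simp [hVS y hy], L2.inner_def]
  apply integral_congr_ae
  filter_upwards [resolvent_ae_eq_inner hd (-s) u, coeFn_mulOp V hV c] with y h1 h2
  rw [h1, h2, neg_neg, inner_smul_right, RCLike.inner_apply, inner_conj_symm]

theorem memLp_two_of_norm_le {H : Type} [NormedAddCommGroup H] {μ : Measure (E d)}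
    [IsFiniteMeasure μ] {f : ℝ × E d → H} {C : ℝ}
    (hf : AEStronglyMeasurable f ((volume : Measure ℝ).prod μ))
    (hC : ∀ q, ‖f q‖ * (1 + q.1 ^ 2) ≤ C) : MemLp f 2 ((volume : Measure ℝ).prod μ) := by
  rw [memLp_two_iff_integrable_sq_norm hf]
  have h1 := Integrable.mul_prod (integrable_inv_one_add_sq) (integrable_const (C ^ 2) (μ := μ))
  refine h1.mono' (hf.norm.pow 2) (Eventually.of_forall fun q => ?_)
  have h2 : 0 < 1 + q.1 ^ 2 := by positivity
  have h3 : ‖f q‖ ≤ C * (1 + q.1 ^ 2)⁻¹ := by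
    rw [← div_eq_mul_inv, le_div_iff₀ h2]; exact hC q
  have h4 : (1 + q.1 ^ 2)⁻¹ ≤ 1 := inv_le_one_of_one_le₀ (by nlinarith)
  have h5 : 0 < (1 + q.1 ^ 2)⁻¹ := inv_pos.2 h2
  rw [Real.norm_of_nonneg (by positivity)]
  calc ‖f q‖ ^ 2 ≤ (C * (1 + q.1 ^ 2)⁻¹) ^ 2 := by gcongr
    _ = ((1 + q.1 ^ 2)⁻¹ * (1 + q.1 ^ 2)⁻¹) * C ^ 2 := by ring
    _ ≤ ((1 + q.1 ^ 2)⁻¹ * 1) * C ^ 2 := by gcongr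
    _ = _ := by ring

variable {φ : ℝ → ℂ} (hφ : ContDiff ℝ (⊤ : ℕ∞) φ) (hc : HasCompactSupport φ)

/-- Two resolvents are needed to make the middle of Out (VR)^{j+2} In an integral of rank one
operators with square integrable vectors: the one left of some V supplies `greenVec`, and the one
right of it evaluates at y. This is why the order is at least 2. -/
theorem exists_hasTrace_integral_Ioi {m : ℕ} (hd : d + m = 3) (hd1 : 1 ≤ d) {S : Set (E d)}
    (hS : volume S ≠ ∞) (hVS : ∀ y, y ∉ S → V y = 0) {B : ℝ} (hB : ∀ y, ‖V y‖ ≤ B) (j : ℕ) :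
    ∃ A : State d →L[ℂ] State d,
      (∀ h, A h = ∫ t in Set.Ioi (0 : ℝ), φ t • duhamelTerm V hV (j + 2) h t) ∧
      Integrable (fun q : ℝ × E d => expHat hφ hc q.1 * (V q.2 * ∫ x, greenSq m (pt q.1) (q.2 - x) *
        (birman hV q.1 ^ j) (mulOp V hV (greenVec (by omega) q.1 q.2)) x))
          ((volume : Measure ℝ).prod (volume.restrict S)) ∧
      HasTrace A (∫ q : ℝ × E d, expHat hφ hc q.1 * (V q.2 * ∫ x, greenSq m (pt q.1) (q.2 - x) *
        (birman hV q.1 ^ j) (mulOp V hV (greenVec (by omega) q.1 q.2)) x)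
          ∂((volume : Measure ℝ).prod (volume.restrict S))) := by
  have hd3 : d ≤ 3 := by omega
  have hB0 : 0 ≤ B := (norm_nonneg _).trans (hB 0)
  have hfin : IsFiniteMeasure (volume.restrict S) := ⟨by simpa using hS.lt_top⟩
  obtain ⟨hgc, C, hC0, hC⟩ := exists_norm_greenVec_le hd3
  obtain ⟨D, hD0, hD⟩ := norm_adjoint_waveIn_le (d := d)
  -- The vectors u and w below both grow at most like (1 + s²)². The weight κ = (1 + s²)³ is moved
  -- from u to w, so that x decays like (1 + s²)⁻¹; the same decay of y requires 3 + 2 + 1 = 6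
  -- powers from `expHat`.
  obtain ⟨F, hF0, hF⟩ := norm_expHat_le hφ hc 6
  set P : ℝ := 3 + (2 * Real.pi) ^ 2 with hP
  have hP0 : 0 ≤ P := by positivity
  have hPs := two_add_norm_pt_sq_le
  set u : ℝ × E d → State d := fun q =>
    ContinuousLinearMap.adjoint (waveIn q.1) (greenVec hd3 (-q.1) q.2) with hu
  set b : ℝ × E d → L2 d := fun q =>
    (birman hV q.1 ^ j) (mulOp V hV (greenVec hd3 q.1 q.2)) with hb
  set w : ℝ × E d → State d := fun q => waveOut q.1 (b q) with hw
  have hgc' : Continuous fun q : ℝ × E d => greenVec hd3 (-q.1) q.2 := by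
    have := hgc.comp' ((continuous_neg.comp continuous_fst).prodMk continuous_snd :
      Continuous fun q : ℝ × E d => (-q.1, q.2))
    exact this
  have huc : Continuous u := continuous_adjoint_waveIn continuous_fst hgc'
  have hbc : Continuous b := by
    have := (mulOp V hV).continuous.comp' hgc
    exact continuous_birman_pow hV j continuous_fst this
  have hwc : Continuous w := continuous_waveOut continuous_fst hbc
  have hun : ∀ q, ‖u q‖ ≤ (P * (1 + q.1 ^ 2)) * (D * ((P * (1 + q.1 ^ 2)) * C)) := fun q => by
    refine (hD _ _).trans ?_
    have h1 := hC (-q.1) q.2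
    have h2 := hPs (-q.1)
    rw [neg_sq] at h2
    have h3 := hPs q.1
    calc (2 + ‖pt q.1‖ ^ 2) * (D * ‖greenVec hd3 (-q.1) q.2‖)
        ≤ (2 + ‖pt q.1‖ ^ 2) * (D * ((2 + ‖pt (-q.1)‖ ^ 2) * C)) := by gcongr
      _ ≤ _ := by gcongr
  have hbn : ∀ q, ‖b q‖ ≤ B ^ j * (B * ((P * (1 + q.1 ^ 2)) * C)) := fun q => by
    refine (norm_birman_pow_le hV hB j _ _).trans ?_
    gcongr
    refine (norm_mulOp_le _ (Eventually.of_forall hB) _).trans ?_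
    gcongr
    exact (hC _ _).trans (by have := hPs q.1; gcongr)
  have hwn : ∀ q, ‖w q‖ ≤ 2 * (P * (1 + q.1 ^ 2)) * (B ^ j * (B * ((P * (1 + q.1 ^ 2)) * C))) :=
    fun q => by
    refine (norm_waveOut_le _ _).trans ?_
    have h3 := hPs q.1
    have h4 := hbn q
    gcongr
  set κ : ℝ × E d → ℂ := fun q => (((1 + q.1 ^ 2) ^ 3 : ℝ) : ℂ) with hκ
  have hκ0 : ∀ q, κ q ≠ 0 := fun q => by
    rw [hκ]; exact Complex.ofReal_ne_zero.2 (by positivity)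
  have hκc : Continuous κ := by rw [hκ]; fun_prop
  have hκn : ∀ q, ‖κ q‖ = (1 + q.1 ^ 2) ^ 3 := fun q => by
    rw [hκ]; exact (Complex.norm_real _).trans (Real.norm_of_nonneg (by positivity))
  set x : ℝ × E d → State d := fun q => (κ q)⁻¹ • u q with hx
  set y : ℝ × E d → State d := fun q => (expHat hφ hc q.1 * κ q * V q.2) • w q with hy
  have hxm : MemLp x 2 ((volume : Measure ℝ).prod (volume.restrict S)) := by
    refine memLp_two_of_norm_le (C := P * (D * (P * C)))
      ((hκc.inv₀ hκ0).smul huc).aestronglyMeasurable fun q => ?_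
    have h2 : 0 < 1 + q.1 ^ 2 := by positivity
    rw [hx]
    simp only [norm_smul, norm_inv, hκn]
    calc ((1 + q.1 ^ 2) ^ 3)⁻¹ * ‖u q‖ * (1 + q.1 ^ 2)
        ≤ ((1 + q.1 ^ 2) ^ 3)⁻¹ * ((P * (1 + q.1 ^ 2)) * (D * ((P * (1 + q.1 ^ 2)) * C))) *
          (1 + q.1 ^ 2) := by gcongr; exact hun q
      _ = _ := by field_simp
  have hym : MemLp y 2 ((volume : Measure ℝ).prod (volume.restrict S)) := by
    refine memLp_two_of_norm_le (C := F * B * (2 * P * (B ^ j * (B * (P * C))))) ?_ fun q => ?_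
    · have h1 : Continuous fun q : ℝ × E d => expHat hφ hc q.1 * κ q :=
        ((expHat hφ hc).continuous.comp continuous_fst).mul hκc
      have h2 : AEStronglyMeasurable (fun q : ℝ × E d => expHat hφ hc q.1 * κ q * V q.2)
          ((volume : Measure ℝ).prod (volume.restrict S)) :=
        h1.aestronglyMeasurable.mul hV.1.restrict.comp_snd
      exact h2.smul hwc.aestronglyMeasurable
    · have h2 : 0 < 1 + q.1 ^ 2 := by positivity
      rw [hy]
      simp only [norm_smul, norm_mul, hκn]
      calc ‖expHat hφ hc q.1‖ * (1 + q.1 ^ 2) ^ 3 * ‖V q.2‖ * ‖w q‖ * (1 + q.1 ^ 2)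
          ≤ ‖expHat hφ hc q.1‖ * (1 + q.1 ^ 2) ^ 3 * B *
            (2 * (P * (1 + q.1 ^ 2)) * (B ^ j * (B * ((P * (1 + q.1 ^ 2)) * C)))) *
              (1 + q.1 ^ 2) := by gcongr; exacts [hB _, hwn q]
        _ = (‖expHat hφ hc q.1‖ * (1 + q.1 ^ 2) ^ 6) * B * (2 * P * (B ^ j * (B * (P * C)))) := by
          ring
        _ ≤ _ := by gcongr; exact hF _
  obtain ⟨A, hA, hA'⟩ := exists_hasTrace_of_memLp hxm hym
  have hinner : ∀ q, inner ℂ (x q) (y q) = expHat hφ hc q.1 * (V q.2 * ∫ x,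
      greenSq m (pt q.1) (q.2 - x) *
        (birman hV q.1 ^ j) (mulOp V hV (greenVec hd3 q.1 q.2)) x) := fun q => by
    have h1 : inner ℂ (x q) (y q) = (expHat hφ hc q.1 * V q.2) * inner ℂ (u q) (w q) := by
      have h1 : (starRingEnd ℂ) (κ q)⁻¹ = (κ q)⁻¹ := by
        rw [hκ]; simp only [← Complex.ofReal_inv, Complex.conj_ofReal]
      rw [hx, hy]
      simp only [inner_smul_left, inner_smul_right, h1]
      field_simp [hκ0 q]
    rw [h1, hu, hw]
    simp only [ContinuousLinearMap.adjoint_inner_left, waveIn_waveOut]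
    rw [inner_greenVec_resolvent hd, mul_assoc]
  have hinner' := funext hinner
  refine ⟨A, fun h => ?_, hinner' ▸ (hxm.norm.integrable_mul hym.norm).mono'
    (hxm.1.inner hym.1) (Eventually.of_forall fun q => norm_inner_le_norm _ _), hinner' ▸ hA'⟩
  · have hxy : ∀ q, inner ℂ (x q) h • y q =
        expHat hφ hc q.1 • ((V q.2 * inner ℂ (u q) h) • w q) := fun q => by
      have h1 : (starRingEnd ℂ) (κ q)⁻¹ = (κ q)⁻¹ := by
        rw [hκ]; simp only [← Complex.ofReal_inv, Complex.conj_ofReal]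
      rw [hx, hy]
      simp only [inner_smul_left, h1, smul_smul]
      congr 1
      field_simp [hκ0 q]
    have hint := integrable_smul_of_memLp_two (memLp_inner_left hxm h) hym
    have hAh : A h = ∫ q, inner ℂ (x q) h • y q ∂((volume : Measure ℝ).prod (volume.restrict S)) :=
      hA h
    simp_rw [hxy] at hint hAh
    rw [hAh]
    rw [integral_prod _ hint]
    refine Eq.trans ?_ (integral_expHat_smul_laplace hφ hc
      (laplace_duhamelTerm hV hd1 0 (j + 1) h).1)
    congr 1
    funext s
    dsimp only
    rw [integral_smul]
    refine congrArg (fun v => expHat hφ hc s • v)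
      (Eq.trans ?_ (laplace_duhamelTerm hV hd1 s (j + 1) h).2.symm)
    -- The factorization (VR)^{j+2} = (VR)^j V (RV) R isolates the factor RV that is decomposed.
    have h1 : (birman hV s ^ (j + 1 + 1)) (waveIn s h) = (birman hV s ^ j)
        (mulOp V hV (resolvent s (mulOp V hV (resolvent s (waveIn s h))))) := by
      rw [pow_add, pow_add, pow_one, mul_apply_eq_comp, mul_apply_eq_comp]
      rfl
    set L : L2 d →L[ℂ] State d := waveOut s ∘L (birman hV s ^ j) ∘L mulOp V hV with hL
    have h2 : waveOut s ((birman hV s ^ (j + 1 + 1)) (waveIn s h)) =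
        L (resolvent s (mulOp V hV (resolvent s (waveIn s h)))) := by rw [h1]; rfl
    rw [h2, resolvent_mulOp hV hS hVS hd3, ← ContinuousLinearMap.integral_comp_comm _
      (integrableOn_smul_greenVec hV hS hd3 s _)]
    apply integral_congr_ae
    filter_upwards [ae_restrict_of_ae (resolvent_ae_eq_inner hd3 s (waveIn s h))] with z hz
    rw [map_smul, hz]
    simp only [hu, ContinuousLinearMap.adjoint_inner_left]
    rfl

end RankOneDecomposition

end WaveTrace

namespace WaveTrace

/-! ### Time reversal and the negative half line -/

section TimeReversal

open Filter Topology

theorem HasTrace.conj {H : Type} [NormedAddCommGroup H] [InnerProductSpace ℂ H]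
    {A : H →L[ℂ] H} {τ : ℂ} (hA : HasTrace A τ) (U : H ≃ₗᵢ[ℂ] H) :
    HasTrace ((U.symm.toContinuousLinearEquiv : H →L[ℂ] H) ∘L A ∘L
      (U.toContinuousLinearEquiv : H →L[ℂ] H)) τ := by
  obtain ⟨⟨x, y, hxy, hs⟩, ht⟩ := hA
  refine ⟨⟨fun n => U.symm (x n), fun n => U.symm (y n), ?_, fun h => ?_⟩, fun ι b => ?_⟩
  · simpa only [LinearIsometryEquiv.norm_map] using hxy
  · have h1 := (hs (U h)).mapL (U.symm.toContinuousLinearEquiv : H →L[ℂ] H)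
    refine Eq.mp (congrArg (fun f => HasSum f _) (funext fun n => ?_)) h1
    symm
    have h2 : inner ℂ (U.symm (x n)) h = inner ℂ (x n) (U h) := by
      rw [← U.inner_map_map, U.apply_symm_apply]
    rw [h2, map_smul]
    rfl
  · have h1 := ht ι (HilbertBasis.ofRepr (U.symm.trans b.repr))
    convert h1 using 2 with i
    have h2 : (HilbertBasis.ofRepr (U.symm.trans b.repr) : HilbertBasis ι ℂ H) i = U (b i) := rfl
    have h3 : inner ℂ (b i) (U.symm (A (U (b i)))) = inner ℂ (U (b i)) (A (U (b i))) := by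
      rw [← U.inner_map_map, U.apply_symm_apply]
    rw [h2, ← h3]
    rfl

variable {d : ℕ}

/-- The reflection `(f, g) ↦ (f, -g)` of the state space. -/
noncomputable def reflect : State d ≃ₗᵢ[ℂ] State d where
  toLinearEquiv := LinearEquiv.ofInvolutive
    { toFun := fun h => WithLp.toLp 2 (h.fst, -h.snd)
      map_add' := fun g h => by
        refine (WithLp.ofLp_injective 2) (Prod.ext rfl ?_)
        exact neg_add _ _
      map_smul' := fun c h => by
        refine (WithLp.ofLp_injective 2) (Prod.ext rfl ?_)
        exact (smul_neg c _).symm }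
    fun h => (WithLp.ofLp_injective 2) (Prod.ext rfl (neg_neg _))
  norm_map' h := by
    rw [WithLp.prod_norm_eq_of_L2, WithLp.prod_norm_eq_of_L2]
    change √(‖h.fst‖ ^ 2 + ‖-h.snd‖ ^ 2) = _
    rw [norm_neg]

theorem reflect_apply (h : State d) : reflect h = WithLp.toLp 2 (h.fst, -h.snd) := rfl

theorem fourierMul_congr {a b : E d → ℂ} (ha : MemLp a ∞ volume) (hb : MemLp b ∞ volume)
    (h : ∀ ξ, a ξ = b ξ) : fourierMul a ha = fourierMul b hb := by
  obtain rfl : a = b := funext h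
  rfl

theorem fourierMul_neg {a b : E d → ℂ} (ha : MemLp a ∞ volume) (hb : MemLp b ∞ volume)
    (h : ∀ ξ, a ξ = -b ξ) (v : L2 d) : fourierMul a ha v = -fourierMul b hb v := by
  rw [← neg_one_smul ℂ (fourierMul b hb v), fourierMul_smul (c := -1) hb ha
    fun ξ => by rw [h]; ring]

theorem cosL2_neg (t : ℝ) : cosL2 (d := d) (-t) = cosL2 t :=
  fourierMul_congr _ _ fun ξ => by rw [neg_mul, Real.cos_neg]

theorem sinL2H1_neg (t : ℝ) (v : L2 d) : sinL2H1 (-t) v = -sinL2H1 t v := by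
  rw [sinL2H1, sinL2H1, ContinuousLinearMap.comp_apply, ContinuousLinearMap.comp_apply,
    fourierMul_neg _ (memLp_japD_sinc d t) (fun ξ => by
      rw [neg_mul t (absD ξ), Real.sinc_neg]; push_cast; ring) v, map_neg]

theorem lapSinH1L2_neg (t : ℝ) (f : H1 d) : lapSinH1L2 (-t) f = -lapSinH1L2 t f := by
  rw [lapSinH1L2, lapSinH1L2, ContinuousLinearMap.comp_apply, ContinuousLinearMap.comp_apply,
    fourierMul_neg _ (memLp_absD_sin d t) (fun ξ => by
      rw [neg_mul, Real.sin_neg]; push_cast; ring) _]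

theorem freeWave_neg (t : ℝ) (h : State d) : freeWave (-t) h =
    reflect (freeWave t (reflect h)) := by
  have h1 : (reflect h).fst = h.fst := rfl
  have h2 : (reflect h).snd = -h.snd := rfl
  rw [reflect_apply (freeWave t _), freeWave, freeWave, h1, h2, cosH1, cosH1, cosL2_neg,
    sinL2H1_neg, lapSinH1L2_neg, map_neg, map_neg]
  refine (WithLp.ofLp_injective 2) (Prod.ext rfl ?_)
  change -_ + _ = -(_ + -_)
  rw [neg_add, neg_neg]

theorem sourceWave_neg (t : ℝ) (v : L2 d) : sourceWave (-t) v = -reflect (sourceWave t v) := by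
  rw [sourceWave_eq, sourceWave_eq, sinL2H1_neg, cosL2_neg]
  exact (WithLp.ofLp_injective 2) (Prod.ext rfl (neg_neg _).symm)

variable {V : E d → ℂ} (hV : MemLp V ∞ volume)

/-- The reflection conjugates the free group at t to that at -t and does not affect the first
component, hence not the potential. For source data (0, v) the reflection costs a sign, which
cancels the sign from reversing the interval of integration. -/
theorem duhamelTerm_neg (k : ℕ) (h : State d) (t : ℝ) :
    duhamelTerm V hV k h (-t) = reflect (duhamelTerm V hV k (reflect h) t) := by
  induction k generalizing t with
  | zero =>
    rw [duhamelTerm_zero, duhamelTerm_zero]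
    exact freeWave_neg t h
  | succ k ih =>
    rw [duhamelTerm_succ, duhamelTerm_succ]
    have h1 := intervalIntegral.integral_comp_neg (a := 0) (b := t) (f := fun σ =>
      sourceWave (-t - σ) (mulOp V hV (inclL (duhamelTerm V hV k h σ).fst)))
    rw [neg_zero] at h1
    rw [intervalIntegral.integral_symm, ← h1, ← intervalIntegral.integral_neg]
    have h2 := (reflect (d := d)).toContinuousLinearEquiv.toContinuousLinearMap
      |>.intervalIntegral_comp_comm (a := 0) (b := t) (μ := volume) (f := fun σ =>
        sourceWave (t - σ) (mulOp V hV (inclL (duhamelTerm V hV k (reflect h) σ).fst)))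
        (Continuous.intervalIntegrable (continuous_sourceWave (continuous_const.sub continuous_id)
          (continuous_mulOp_inclL_fst hV (continuous_duhamelTerm hV k (reflect h)))) _ _)
    refine Eq.trans ?_ h2
    congr 1
    funext σ
    have h3 : -t - -σ = -(t - σ) := by ring
    rw [ih, h3, sourceWave_neg, neg_neg]
    rfl

/-- For even φ the contribution of t < 0 is the conjugate of the half-line operator by the
reflection. Conjugation by a unitary preserves the trace, so the full pairing has twice the
half-line trace. -/
theorem isPairing_add_conj {φ : ℝ → ℂ} (hφ : Continuous φ) (hc : HasCompactSupport φ)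
    (he : ∀ t, φ (-t) = φ t) (k : ℕ) {A : State d →L[ℂ] State d}
    (hA : ∀ h, A h = ∫ t in Set.Ioi (0 : ℝ), φ t • duhamelTerm V hV k h t) :
    IsPairing φ V hV k (A + ((reflect (d := d)).symm.toContinuousLinearEquiv :
      State d →L[ℂ] State d) ∘L A ∘L
        ((reflect (d := d)).toContinuousLinearEquiv : State d →L[ℂ] State d)) := by
  intro h
  have hi : ∀ h, Integrable (fun t => φ t • duhamelTerm V hV k h t) := fun h =>
    (hφ.smul (continuous_duhamelTerm hV k h)).integrable_of_hasCompactSupport hc.smul_right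
  refine ⟨hi h, ?_⟩
  have h1 : (A + ((reflect (d := d)).symm.toContinuousLinearEquiv :
      State d →L[ℂ] State d) ∘L A ∘L
        ((reflect (d := d)).toContinuousLinearEquiv : State d →L[ℂ] State d)) h =
      A h + reflect (A (reflect h)) := rfl
  have h2 : reflect (A (reflect h)) = ∫ t in Set.Iic (0 : ℝ), φ t • duhamelTerm V hV k h t := by
    have h3 := integral_comp_neg_Ioi (0 : ℝ) fun t => φ t • duhamelTerm V hV k h t
    rw [neg_zero] at h3
    rw [← h3, hA]
    have h4 := (reflect (d := d)).toContinuousLinearEquiv.toContinuousLinearMap.integral_comp_comm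
      (hi (reflect h)).integrableOn (μ := volume.restrict (Set.Ioi 0))
    refine h4.symm.trans ?_
    congr 1
    funext t
    rw [he, duhamelTerm_neg, map_smul]
    rfl
  rw [h1, h2, hA, add_comm, ← Set.compl_Ioi, add_comm,
    integral_add_compl measurableSet_Ioi (hi h)]

end TimeReversal

end WaveTrace

namespace WaveTrace

/-! ### Products of resolvents as integrals over paths -/

section Chain

open Filter Topology

variable {d m : ℕ}

theorem green_pt_zero (y : E d) :
    green m (pt 0) y = ((∫ z : E m, ‖yukawa (pt 0) (rho y z)‖ : ℝ) : ℂ) := by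
  rw [green, descent, ← integral_complex_ofReal]
  congr 1
  funext z
  rw [norm_yukawa _ (rho_nonneg y z), pt_zero, ← Complex.ofReal_one, yukawa_ofReal,
    Complex.ofReal_re]

/-- All p on the line Re p = 1 give |e^{-pr}| = e^{-r}, so the positive kernel at s = 0 dominates
every other one. -/
theorem norm_green_le (s : ℝ) (y : E d) : ‖green m (pt s) y‖ ≤ ‖green m (pt 0) y‖ := by
  rw [green_pt_zero, Complex.norm_real,
    Real.norm_of_nonneg (integral_nonneg fun _ => norm_nonneg _)]
  refine (norm_integral_le_integral_norm _).trans (le_of_eq ?_)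
  congr 1
  funext z
  rw [norm_yukawa _ (rho_nonneg y z), norm_yukawa _ (rho_nonneg y z), pt_re, pt_re]

theorem norm_green_pt_zero (y : E d) : (‖green m (pt 0) y‖ : ℂ) = green m (pt 0) y := by
  rw [green_pt_zero, Complex.norm_real,
    Real.norm_of_nonneg (integral_nonneg fun _ => norm_nonneg _)]

/-- The kernel is symmetric, so the resolvent is symmetric for the bilinear pairing. This follows
from the adjoint relation by conjugating a, which exchanges s and -s. -/
theorem integral_resolvent_mul (hd : d + m = 3) (s : ℝ) (a b : L2 d) :
    ∫ x, (resolvent s a : L2 d) x * b x = ∫ x, a x * (resolvent s b : L2 d) x := by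
  set c : L2 d := (Lp.memLp a).star.toLp _ with hc
  have h := inner_resolvent s c b
  rw [L2.inner_def, L2.inner_def] at h
  have hca : c =ᵐ[volume] star a := MemLp.coeFn_toLp _
  have h1 : ∀ y, ∫ x, green m (pt (-s)) (y - x) * c x =
      (starRingEnd ℂ) (∫ x, green m (pt s) (y - x) * a x) := fun y => by
    rw [← integral_conj]
    apply integral_congr_ae
    filter_upwards [hca] with x hx
    rw [hx, map_mul, conj_green, Pi.star_apply, RCLike.star_def]
  refine Eq.trans (integral_congr_ae ?_) (h.symm.trans (integral_congr_ae ?_))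
  · filter_upwards [resolvent_ae_eq hd (-s) c, resolvent_ae_eq hd s a] with y h2 h3
    rw [h2, h1, h3, RCLike.inner_apply, Complex.conj_conj, mul_comm]
  · filter_upwards [hca] with y h2
    rw [h2, RCLike.inner_apply, Pi.star_apply, RCLike.star_def, Complex.conj_conj, mul_comm]

theorem integral_mulOp_mul {V : E d → ℂ} (hV : MemLp V ∞ volume) (a b : L2 d) :
    ∫ x, (mulOp V hV a : L2 d) x * b x = ∫ x, a x * (mulOp V hV b : L2 d) x := by
  apply integral_congr_ae
  filter_upwards [coeFn_mulOp V hV a, coeFn_mulOp V hV b] with x h1 h2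
  rw [h1, h2]
  ring

/-- The product of the values of `V` and of the kernels of `(p² - Δ)⁻¹`, `p = 1 - 2πis`, along the
path `u, w_0, …, w_{n-1}`. -/
noncomputable def chain (m : ℕ) (V : E d → ℂ) (s : ℝ) (u : E d) {n : ℕ} (w : Fin n → E d) : ℂ :=
  ∏ i : Fin n, V (w i) *
    green m (pt s) (w i - (Fin.cons u w : Fin (n + 1) → E d) i.castSucc)

theorem chain_succ (V : E d → ℂ) (s : ℝ) (u : E d) {n : ℕ} (w : Fin (n + 2) → E d) :
    chain m V s u w = chain m V s u (fun i => w i.castSucc) *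
      (V (w (Fin.last _)) * green m (pt s) (w (Fin.last _) - w (Fin.last n).castSucc)) := by
  rw [chain, Fin.prod_univ_castSucc, chain]
  congr 1
  refine Finset.prod_congr rfl fun i _ => ?_
  congr 3
  cases i using Fin.cases with
  | zero => rfl
  | succ i => rfl

theorem norm_chain_le {V : E d → ℂ} (s : ℝ) (u : E d) {n : ℕ} (w : Fin n → E d) :
    ‖chain m V s u w‖ ≤ ‖chain m (fun x => (‖V x‖ : ℂ)) 0 u w‖ := by
  rw [chain, chain, norm_prod, norm_prod]
  refine Finset.prod_le_prod (fun _ _ => norm_nonneg _) fun i _ => ?_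
  rw [norm_mul, norm_mul, Complex.norm_real, norm_norm]
  gcongr
  exact norm_green_le s _

theorem measurable_cons_castSucc (u : E d) {n : ℕ} (i : Fin n) :
    Measurable fun w : Fin n → E d => (Fin.cons u w : Fin (n + 1) → E d) i.castSucc := by
  cases n with
  | zero => exact i.elim0
  | succ n =>
    cases i using Fin.cases with
    | zero => exact measurable_const
    | succ i => exact measurable_pi_apply i.castSucc

theorem measurable_chain {V : E d → ℂ} (hVm : Measurable V) (s : ℝ) (u : E d) (n : ℕ) :
    Measurable fun w : Fin n → E d => chain m V s u w :=
  Finset.measurable_prod _ fun i _ => (hVm.comp (measurable_pi_apply i)).mul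
    ((stronglyMeasurable_green (pt s)).measurable.comp
      ((measurable_pi_apply i).sub (measurable_cons_castSucc u i)))

theorem ae_eval {n : ℕ} (i : Fin n) {p : E d → Prop} (h : ∀ᵐ x, p x) :
    ∀ᵐ w : Fin n → E d, p (w i) :=
  (Measure.quasiMeasurePreserving_eval (fun _ : Fin n => (volume : Measure (E d))) i).ae h

/-- Induction by integrating out the last vertex: this replaces h by R(Vh), again in L², and
shortens the path by one edge. -/
theorem integral_mul_birman_pow (hd : d + m = 3) (j : ℕ) {V : E d → ℂ} (hVm : Measurable V)
    (hV : MemLp V ∞ volume) (s : ℝ) (h : L2 d) (u : E d) :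
    Integrable (fun w : Fin (j + 1) → E d => h (w (Fin.last j)) * chain m V s u w) ∧
      ∫ w : Fin (j + 1) → E d, h (w (Fin.last j)) * chain m V s u w =
        ∫ x, h x * (birman hV s ^ j) (mulOp V hV (greenVec (by omega) s u)) x := by
  induction j generalizing V s h with
  | zero =>
    set F : E d → ℂ := fun x => h x * (V x * green m (pt s) (x - u)) with hF
    have h1 : (fun w : Fin (0 + 1) → E d => h (w (Fin.last 0)) * chain m V s u w) =
        fun w => F (MeasurableEquiv.funUnique (Fin 1) (E d) w) := funext fun w => by
      exact congrArg (h (w (Fin.last 0)) * ·) (Fin.prod_univ_one _)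
    have h2 : F =ᵐ[volume] fun x => h x * mulOp V hV (greenVec (by omega) s u) x := by
      filter_upwards [coeFn_mulOp V hV (greenVec (by omega) s u), greenVec_ae_eq hd s u]
        with x h3 h4
      rw [h3, h4]
    have h3 := volume_preserving_funUnique (Fin 1) (E d)
    refine ⟨?_, ?_⟩
    · rw [h1]
      have h4 : Integrable F := ((Lp.memLp h).integrable_mul (Lp.memLp _)).congr h2.symm
      exact (h3.integrable_comp_emb (MeasurableEquiv.measurableEmbedding _)).2 h4
    · rw [h1]
      exact (h3.integral_comp' F).trans (integral_congr_ae h2)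
  | succ j ih =>
    set f : E d × (Fin (j + 1) → E d) → ℂ := fun q => chain m V s u q.2 *
      (h q.1 * V q.1 * green m (pt s) (q.2 (Fin.last j) - q.1)) with hf
    have h1 : ∀ w : Fin (j + 1 + 1) → E d, h (w (Fin.last (j + 1))) * chain m V s u w =
        f (MeasurableEquiv.piFinSuccAbove (fun _ => E d) (Fin.last (j + 1)) w) := fun w => by
      have h2 : MeasurableEquiv.piFinSuccAbove (fun _ => E d) (Fin.last (j + 1)) w =
          (w (Fin.last (j + 1)), fun i => w i.castSucc) := by
        refine Prod.ext rfl (funext fun i => ?_)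
        exact congrArg w (Fin.succAbove_last_apply i)
      rw [h2, hf, chain_succ, green_sub_comm]
      ring
    have hfm : AEStronglyMeasurable f (volume.prod volume) := by
      refine Measurable.aestronglyMeasurable ?_
      have h2 : Measurable fun q : E d × (Fin (j + 1) → E d) => chain m V s u q.2 :=
        (measurable_chain hVm s u (j + 1)).comp measurable_snd
      have h3 := (Lp.stronglyMeasurable h).measurable
      have h4 := (stronglyMeasurable_green (d := d) (m := m) (pt s)).measurable
      have h5 : Measurable fun q : E d × (Fin (j + 1) → E d) => q.2 (Fin.last j) - q.1 := by
        fun_prop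
      exact h2.mul (((h3.comp measurable_fst).mul (hVm.comp measurable_fst)).mul (h4.comp h5))
    have hhV : MemLp (fun x => h x * V x) 2 (volume : Measure (E d)) := by
      refine (Lp.memLp (mulOp V hV h)).ae_eq ?_
      filter_upwards [coeFn_mulOp V hV h] with x hx
      rw [hx, mul_comm]
    -- Absolute integrability comes from the induction hypothesis for the majorant: |V| instead of
    -- V, s = 0, and r = R|Vh| instead of h.
    set b : L2 d := hhV.norm.ofReal.toLp _ with hb
    have hbx : b =ᵐ[volume] fun x => (‖h x * V x‖ : ℂ) := MemLp.coeFn_toLp _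
    have hV' : MemLp (fun x => (‖V x‖ : ℂ)) ∞ volume := hV.norm.ofReal
    obtain ⟨r, hr⟩ : ∃ r : L2 d, r = resolvent 0 b := ⟨_, rfl⟩
    have hrb : r =ᵐ[volume] fun y => ∫ x, green m (pt 0) (y - x) * b x :=
      hr ▸ resolvent_ae_eq hd 0 b
    have ih1 := (ih (Complex.measurable_ofReal.comp hVm.norm) hV' 0 r).1
    have hint : Integrable f (volume.prod volume) := by
      rw [integrable_prod_iff' hfm]
      refine ⟨Eventually.of_forall fun w => ?_, ?_⟩
      · have h2 : Integrable fun x => h x * V x * green m (pt s) (w (Fin.last j) - x) :=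
          hhV.integrable_mul (memLp_green hd s (w (Fin.last j)))
        have h3 := h2.const_mul (chain m V s u w)
        exact h3
      · have hm : AEStronglyMeasurable (fun w => ∫ x, ‖f (x, w)‖) volume :=
          hfm.norm.prod_swap.integral_prod_right'
        refine ih1.mono hm ?_
        filter_upwards [ae_eval (Fin.last j) hrb] with w hw
        set y := w (Fin.last j) with hy
        have h3 : ∫ x, green m (pt 0) (y - x) * b x =
            ((∫ x, ‖h x * V x‖ * ‖green m (pt 0) (y - x)‖ : ℝ) : ℂ) := by
          rw [← integral_complex_ofReal]
          apply integral_congr_ae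
          filter_upwards [hbx] with x hx
          rw [hx, Complex.ofReal_mul, norm_green_pt_zero, mul_comm]
        have h4 : ‖r y‖ = ∫ x, ‖h x * V x‖ * ‖green m (pt 0) (y - x)‖ := by
          rw [hw, h3, Complex.norm_real]
          exact Real.norm_of_nonneg
            (integral_nonneg fun _ => mul_nonneg (norm_nonneg _) (norm_nonneg _))
        have h5 : ∀ x, ‖f (x, w)‖ = ‖chain m V s u w‖ * ‖h x * V x * green m (pt s) (y - x)‖ :=
          fun x => norm_mul _ _
        simp_rw [h5]
        rw [norm_mul, h4, integral_const_mul, norm_mul, norm_norm, Real.norm_of_nonneg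
          (integral_nonneg fun _ => norm_nonneg _), mul_comm]
        refine mul_le_mul ?_ (norm_chain_le s u w) (norm_nonneg _)
          (integral_nonneg fun _ => mul_nonneg (norm_nonneg _) (norm_nonneg _))
        refine integral_mono_of_nonneg (Eventually.of_forall fun _ => norm_nonneg _) ?_
          (Eventually.of_forall fun x => ?_)
        · exact hhV.norm.integrable_mul (memLp_green hd 0 y).norm
        · simp only [norm_mul]
          exact mul_le_mul_of_nonneg_left (norm_green_le s _) (by positivity)
    have h2 := volume_preserving_piFinSuccAbove (fun _ => E d) (Fin.last (j + 1))
    have h1' := funext h1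
    rw [h1']
    refine ⟨(h2.integrable_comp_emb (MeasurableEquiv.measurableEmbedding _)).2 hint,
      (h2.integral_comp' f).trans ?_⟩
    rw [Measure.volume_eq_prod, integral_prod_symm _ hint, pow_succ', mul_apply_eq_comp]
    set c : L2 d := (birman hV s ^ j) (mulOp V hV (greenVec (by omega) s u)) with hc
    obtain ⟨a, ha⟩ : ∃ a : L2 d, a = mulOp V hV h := ⟨_, rfl⟩
    have hax : a =ᵐ[volume] fun x => V x * h x := ha ▸ coeFn_mulOp V hV h
    obtain ⟨e, he⟩ : ∃ e : L2 d, e = resolvent s a := ⟨_, rfl⟩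
    have hex : e =ᵐ[volume] fun y => ∫ x, green m (pt s) (y - x) * a x :=
      he ▸ resolvent_ae_eq hd s a
    have h4 : ∫ x, h x * birman hV s c x = ∫ x, e x * c x := by
      rw [he, ha, integral_resolvent_mul hd, integral_mulOp_mul]
      rfl
    rw [h4, ← (ih hVm hV s e).2]
    apply integral_congr_ae
    filter_upwards [ae_eval (Fin.last j) hex] with w hw
    rw [hw, mul_comm, hf]
    simp only
    rw [integral_const_mul]
    congr 1
    apply integral_congr_ae
    filter_upwards [hax] with x hx
    rw [hx]
    ring

end Chain

end WaveTrace

namespace WaveTrace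

/-! ### The measure on closed polygons and its polar coordinates -/

section LoopMeasure

open Filter Topology

variable {d m n : ℕ}

instance (a b : ℕ) : ((volume : Measure (Fin a → E d)).prod
    (volume : Measure (Fin b → E m))).IsAddHaarMeasure :=
  Measure.prod.instIsAddHaarMeasure _ _

instance (a b : ℕ) : SigmaFinite ((volume : Measure (Fin a → E d)).prod
    (volume : Measure (Fin b → E m))) := Measure.prod.instSigmaFinite

/-- The pairs of a polygon with `n + 1` vertices in `ℝ^d`, starting at `0`, and of the additional
coordinates in `ℝ^m` of its edges. -/
abbrev Loop (d m n : ℕ) : Type := (Fin n → E d) × (Fin (n + 1) → E m)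

/-- The edges of the closed polygon `0, v_0, …, v_{n-1}, 0`. -/
def edge (v : Fin n → E d) (i : Fin (n + 1)) : E d :=
  (Fin.cons 0 v : Fin (n + 1) → E d) (i + 1) - (Fin.cons 0 v : Fin (n + 1) → E d) i

/-- The length of an edge. -/
noncomputable def leg (q : Loop d m n) (i : Fin (n + 1)) : ℝ := rho (edge q.1 i) (q.2 i)

/-- The length of the polygon. -/
noncomputable def len (q : Loop d m n) : ℝ := ∑ i, leg q i

/-- The product of the kernels `1 / (4πr)` along the edges. -/
noncomputable def loopDensity (q : Loop d m n) : ℝ := ∏ i, (4 * Real.pi * leg q i)⁻¹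

/-- The measure on polygons with the density `loopDensity`. -/
noncomputable def loopMeasure (d m n : ℕ) : Measure (Loop d m n) :=
  ((volume : Measure (Fin n → E d)).prod (volume : Measure (Fin (n + 1) → E m))).withDensity
    fun q => ENNReal.ofReal (loopDensity q)

theorem edge_smul (r : ℝ) (v : Fin n → E d) (i : Fin (n + 1)) :
    edge (r • v) i = r • edge v i := by
  have h : ∀ j, (Fin.cons 0 (r • v) : Fin (n + 1) → E d) j =
      r • (Fin.cons 0 v : Fin (n + 1) → E d) j := fun j => by
    cases j using Fin.cases with
    | zero => simp
    | succ j => simp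
  rw [edge, edge, h, h, smul_sub]

theorem rho_smul {r : ℝ} (hr : 0 ≤ r) (y : E d) (z : E m) : rho (r • y) (r • z) = r * rho y z := by
  rw [rho, rho, norm_smul, norm_smul, mul_pow, mul_pow, ← mul_add, Real.norm_of_nonneg hr,
    Real.sqrt_mul (sq_nonneg r), Real.sqrt_sq hr]

theorem leg_smul {r : ℝ} (hr : 0 ≤ r) (q : Loop d m n) (i : Fin (n + 1)) :
    leg (r • q) i = r * leg q i := by
  rw [leg, leg, ← rho_smul hr, ← edge_smul]
  rfl

theorem len_smul {r : ℝ} (hr : 0 ≤ r) (q : Loop d m n) : len (r • q) = r * len q := by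
  simp only [len, leg_smul hr, Finset.mul_sum]

theorem loopDensity_smul {r : ℝ} (hr : 0 ≤ r) (q : Loop d m n) :
    loopDensity (r • q) = (r ^ (n + 1))⁻¹ * loopDensity q := by
  have h : ∀ i, (4 * Real.pi * (r * leg q i))⁻¹ = r⁻¹ * (4 * Real.pi * leg q i)⁻¹ := fun i => by
    rw [mul_left_comm, mul_inv]
  simp only [loopDensity, leg_smul hr, h, Finset.prod_mul_distrib, Finset.prod_const,
    Finset.card_univ, Fintype.card_fin, inv_pow]

theorem leg_nonneg (q : Loop d m n) (i : Fin (n + 1)) : 0 ≤ leg q i := rho_nonneg _ _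

theorem len_nonneg (q : Loop d m n) : 0 ≤ len q := Finset.sum_nonneg fun i _ => leg_nonneg q i

theorem loopDensity_nonneg (q : Loop d m n) : 0 ≤ loopDensity q :=
  Finset.prod_nonneg fun i _ => inv_nonneg.2 (by have := leg_nonneg q i; positivity)

theorem continuous_edge (i : Fin (n + 1)) : Continuous fun v : Fin n → E d => edge v i := by
  have h : ∀ j, Continuous fun v : Fin n → E d => (Fin.cons 0 v : Fin (n + 1) → E d) j := by
    intro j
    cases j using Fin.cases with
    | zero => simpa using continuous_const
    | succ j => simpa using continuous_apply j
  exact (h _).sub (h _)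

theorem continuous_leg (i : Fin (n + 1)) : Continuous fun q : Loop d m n => leg q i := by
  have := continuous_rho.comp (((continuous_edge i).comp continuous_fst).prodMk
    ((continuous_apply i).comp continuous_snd) : Continuous fun q : Loop d m n =>
      (edge q.1 i, q.2 i))
  exact this

theorem continuous_len : Continuous (len : Loop d m n → ℝ) :=
  continuous_finsetSum _ fun i _ => continuous_leg i

theorem measurable_loopDensity : Measurable (loopDensity : Loop d m n → ℝ) :=
  Finset.measurable_prod _ fun i _ => (measurable_const.mul (continuous_leg i).measurable).inv

theorem loopMeasure_absolutelyContinuous : loopMeasure d m n ≪ volume.prod volume :=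
  withDensity_absolutelyContinuous _ _

/-- If the length vanishes then so do all legs, and since the inverse of 0 is 0 by convention, the
density is zero there. Such polygons are thus null even when Lebesgue measure has an atom. -/
theorem ae_len_pos : ∀ᵐ q ∂loopMeasure d m n, 0 < len q := by
  have h : Measurable fun q : Loop d m n => ENNReal.ofReal (loopDensity q) :=
    measurable_loopDensity.ennreal_ofReal
  rw [loopMeasure, ae_withDensity_iff h]
  refine Eventually.of_forall fun q hq => ?_
  refine lt_of_le_of_ne (len_nonneg q) fun h0 => hq ?_
  have h1 := (Finset.sum_eq_zero_iff_of_nonneg fun i _ => leg_nonneg q i).1 h0.symm 0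
    (Finset.mem_univ _)
  rw [loopDensity, Finset.prod_eq_zero (Finset.mem_univ 0) (by rw [h1]; simp), ENNReal.ofReal_zero]

/-- Lebesgue measure scales with exponent nd + (n+1)m and the density with exponent -(n+1); for m =
3 - d the sum is 2(n+1) - d. -/
theorem loopMeasure_smul (hd : d + m = 3) (hN : 0 < 2 * (n + 1) - d) {r : ℝ} (hr : 0 < r)
    (S : Set (Loop d m n)) :
    loopMeasure d m n {q | r⁻¹ • q ∈ S} =
      ENNReal.ofReal (r ^ (2 * (n + 1) - d)) * loopMeasure d m n S := by
  have hr' : 0 ≤ r⁻¹ := (inv_pos.2 hr).le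
  set F : Loop d m n → ℝ≥0∞ := fun q => ENNReal.ofReal (loopDensity q) with hF
  have hF' : ∀ q, F q = ENNReal.ofReal ((r⁻¹) ^ (n + 1)) * F (r⁻¹ • q) := fun q => by
    rw [hF]
    simp only [loopDensity_smul hr']
    rw [← ENNReal.ofReal_mul (by positivity), ← mul_assoc, mul_inv_cancel₀ (by positivity), one_mul]
  have hmap := Measure.map_addHaar_smul
    ((volume : Measure (Fin n → E d)).prod (volume : Measure (Fin (n + 1) → E m)))
      (inv_pos.2 hr).ne'
  have hrank : Module.finrank ℝ (Loop d m n) = n * d + (n + 1) * m := by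
    rw [Module.finrank_prod, Module.finrank_pi_fintype, Module.finrank_pi_fintype]
    simp
  have he : MeasurableEmbedding fun q : Loop d m n => r⁻¹ • q :=
    (Homeomorph.smulOfNeZero r⁻¹ (inv_pos.2 hr).ne').measurableEmbedding
  rw [loopMeasure, withDensity_apply', withDensity_apply']
  change ∫⁻ q in (fun q => r⁻¹ • q) ⁻¹' S, F q ∂(volume.prod volume) = _
  have hint : ∀ T : Set (Loop d m n), ∫⁻ q in T, F q ∂(volume.prod volume) =
      ENNReal.ofReal (r⁻¹ ^ (n + 1)) * ∫⁻ q in T, F (r⁻¹ • q) ∂(volume.prod volume) := fun T => by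
    rw [← lintegral_const_mul' _ _ ENNReal.ofReal_ne_top]
    exact lintegral_congr fun q => hF' q
  rw [hint ((fun q => r⁻¹ • q) ⁻¹' S), ← he.lintegral_map, ← he.restrict_map, hmap,
    Measure.restrict_smul, lintegral_smul_measure, smul_eq_mul, ← mul_assoc,
    ← ENNReal.ofReal_mul (by positivity), hrank, abs_of_nonneg (by positivity)]
  congr 2
  rw [inv_pow, inv_pow, inv_inv, inv_mul_eq_div, div_eq_iff (by positivity), ← pow_add]
  congr 1
  obtain ⟨rfl⟩ : m = 3 - d := by omega
  have : d = 0 ∨ d = 1 ∨ d = 2 ∨ d = 3 := by omega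
  rcases this with rfl | rfl | rfl | rfl <;> omega

theorem _root_.MeasureTheory.Measure.ext_of_Iic_of_ne_top {μ ν : Measure ℝ}
    (h : ∀ r, μ (Set.Iic r) = ν (Set.Iic r)) (hμ : ∀ r, μ (Set.Iic r) ≠ ∞) : μ = ν := by
  have : IsLocallyFiniteMeasure μ :=
    ⟨fun x => ⟨Set.Iic (x + 1), Iic_mem_nhds (by linarith), (hμ _).lt_top⟩⟩
  refine Measure.ext_of_Ioc _ _ fun a b hab => ?_
  have h1 : Set.Ioc a b = Set.Iic b \ Set.Iic a := by
    ext x; simp [and_comm]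
  have h2 : Set.Iic a ⊆ Set.Iic b := Set.Iic_subset_Iic.2 hab.le
  rw [h1, measure_sdiff h2 measurableSet_Iic.nullMeasurableSet (hμ a),
    measure_sdiff h2 measurableSet_Iic.nullMeasurableSet (h a ▸ hμ a), h, h]

/-- The measure `t^{N-1} dt` on `(0, ∞)`. -/
noncomputable def radialMeasure (N : ℕ) : Measure ℝ :=
  (volume.restrict (Set.Ioi 0)).withDensity fun t => ENNReal.ofReal (t ^ (N - 1))

instance (N : ℕ) : SigmaFinite (radialMeasure N) := SigmaFinite.withDensity_ofReal _

theorem radialMeasure_Iic {N : ℕ} (hN : 0 < N) {r : ℝ} (hr : 0 ≤ r) :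
    N * radialMeasure N (Set.Iic r) = ENNReal.ofReal (r ^ N) := by
  rw [radialMeasure, withDensity_apply _ measurableSet_Iic,
    Measure.restrict_restrict measurableSet_Iic]
  have h1 : Set.Iic r ∩ Set.Ioi 0 = Set.Ioc 0 r := by ext x; simp [and_comm]
  rw [h1, ← ofReal_integral_eq_lintegral_ofReal]
  · rw [← intervalIntegral.integral_of_le hr, integral_pow, Nat.sub_add_cancel hN,
      zero_pow hN.ne', sub_zero, ← ENNReal.ofReal_natCast, ← ENNReal.ofReal_mul (by positivity)]
    congr 1
    have : (N : ℝ) ≠ 0 := by exact_mod_cast hN.ne'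
    rw [Nat.cast_sub hN]
    push_cast
    rw [sub_add_cancel, mul_div_cancel₀ _ this]
  · exact (continuous_pow (N - 1)).integrableOn_Ioc
  · filter_upwards [ae_restrict_mem measurableSet_Ioc] with x hx
    exact pow_nonneg hx.1.le _

/-- The distribution of the normalized polygons. -/
noncomputable def shapeMeasure (d m n : ℕ) : Measure (Fin n → E d) :=
  (2 * (n + 1) - d : ℕ) •
    ((loopMeasure d m n).restrict {q | len q ≤ 1}).map fun q => (len q)⁻¹ • q.1

theorem measurable_shape : Measurable fun q : Loop d m n => (len q)⁻¹ • q.1 :=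
  (continuous_len (d := d) (m := m) (n := n)).measurable.inv.smul measurable_fst

theorem shapeMeasure_apply {B : Set (Fin n → E d)} (hB : MeasurableSet B) :
    shapeMeasure d m n B = (2 * (n + 1) - d : ℕ) *
      loopMeasure d m n {q | len q ≤ 1 ∧ (len q)⁻¹ • q.1 ∈ B} := by
  rw [shapeMeasure, Measure.smul_apply, Measure.map_apply measurable_shape hB,
    Measure.restrict_apply (measurable_shape hB), nsmul_eq_mul]
  congr 2
  ext q
  exact and_comm

theorem loopMeasure_len_le (hd : d + m = 3) (hN : 0 < 2 * (n + 1) - d) {r : ℝ} (hr : 0 < r)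
    (B : Set (Fin n → E d)) :
    loopMeasure d m n {q | len q ≤ r ∧ (len q)⁻¹ • q.1 ∈ B} =
      ENNReal.ofReal (r ^ (2 * (n + 1) - d)) *
        loopMeasure d m n {q | len q ≤ 1 ∧ (len q)⁻¹ • q.1 ∈ B} := by
  rw [← loopMeasure_smul hd hN hr]
  congr 1
  ext q
  have hr' := inv_pos.2 hr
  simp only [Set.mem_ofPred_eq, len_smul hr'.le, Prod.smul_fst, mul_inv, inv_inv, smul_smul]
  rw [mul_right_comm, mul_inv_cancel₀ hr.ne', one_mul, inv_mul_le_iff₀ hr, mul_one]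

variable (hd : d + m = 3) (hN : 0 < 2 * (n + 1) - d)
  (hfin : loopMeasure d m n {q | len q ≤ 1} ≠ ∞)
include hfin

theorem isFiniteMeasure_shapeMeasure : IsFiniteMeasure (shapeMeasure d m n) := by
  refine ⟨?_⟩
  rw [shapeMeasure_apply MeasurableSet.univ]
  refine ENNReal.mul_lt_top (ENNReal.natCast_lt_top _) ?_
  exact (measure_mono fun q hq => hq.1).trans_lt hfin.lt_top

include hd hN

/-- By homogeneity of degree N = 2(n+1) - d, polygons of length at most r with shape in B have r^N
times the measure of those of length at most 1. This is a product structure with radial part t^{N-1}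
dt; the factor N in `shapeMeasure` compensates the integral r^N/N. -/
theorem map_loopMeasure : (loopMeasure d m n).map (fun q => (len q, (len q)⁻¹ • q.1)) =
    (radialMeasure (2 * (n + 1) - d)).prod (shapeMeasure d m n) := by
  have := isFiniteMeasure_shapeMeasure hfin
  have hmeas : Measurable fun q : Loop d m n => (len q, (len q)⁻¹ • q.1) :=
    continuous_len.measurable.prodMk measurable_shape
  symm
  refine Measure.prod_eq fun s B hs hB => ?_
  have hfinB : ∀ r, loopMeasure d m n {q | len q ≤ r ∧ (len q)⁻¹ • q.1 ∈ B} ≠ ∞ := fun r => by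
    have h1 : loopMeasure d m n {q | len q ≤ max r 1 ∧ (len q)⁻¹ • q.1 ∈ B} ≠ ∞ := by
      rw [loopMeasure_len_le hd hN (by positivity)]
      refine ENNReal.mul_ne_top ENNReal.ofReal_ne_top ?_
      exact ne_top_of_le_ne_top hfin (measure_mono fun q hq => hq.1)
    exact ne_top_of_le_ne_top h1 (measure_mono fun q hq => ⟨hq.1.trans (le_max_left _ _), hq.2⟩)
  have hl : ∀ s, MeasurableSet s →
      (((loopMeasure d m n).restrict {q | (len q)⁻¹ • q.1 ∈ B}).map len) s =
        loopMeasure d m n {q | len q ∈ s ∧ (len q)⁻¹ • q.1 ∈ B} := fun s hs => by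
    rw [Measure.map_apply continuous_len.measurable hs,
      Measure.restrict_apply (continuous_len.measurable hs)]
    rfl
  have key : ((loopMeasure d m n).restrict {q | (len q)⁻¹ • q.1 ∈ B}).map len =
      (shapeMeasure d m n B) • radialMeasure (2 * (n + 1) - d) := by
    refine Measure.ext_of_Iic_of_ne_top (fun r => ?_) fun r => ?_
    · rw [hl _ measurableSet_Iic, Measure.smul_apply, smul_eq_mul]
      rcases le_or_gt r 0 with hr | hr
      · have h1 : radialMeasure (2 * (n + 1) - d) (Set.Iic r) = 0 := by
          refine withDensity_absolutelyContinuous _ _ ?_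
          rw [Measure.restrict_apply measurableSet_Iic]
          refine measure_mono_null (t := ∅) (fun x hx => ?_) measure_empty
          exact absurd (hx.1.trans hr) (not_le.2 hx.2)
        rw [h1, mul_zero]
        refine measure_mono_null (fun q hq => ?_) (ae_iff.1 ae_len_pos)
        exact not_lt.2 (hq.1.trans hr)
      · change loopMeasure d m n {q | len q ≤ r ∧ (len q)⁻¹ • q.1 ∈ B} = _
        rw [loopMeasure_len_le hd hN hr, shapeMeasure_apply hB, ← radialMeasure_Iic hN hr.le]
        ring
    · rw [hl _ measurableSet_Iic]
      exact hfinB r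
  rw [Measure.map_apply hmeas (hs.prod hB)]
  have h1 := hl s hs
  rw [key, Measure.smul_apply, smul_eq_mul, mul_comm] at h1
  exact h1.symm

end LoopMeasure

end WaveTrace

namespace WaveTrace

/-! ### The integral of exp(-length) over polygons -/

section LoopMass

open Filter Topology

variable {d m n : ℕ}

theorem edge_castSucc (v : Fin n → E d) (i : Fin n) :
    edge v i.castSucc = v i - (Fin.cons 0 v : Fin (n + 1) → E d) i.castSucc := by
  rw [edge, Fin.coeSucc_eq_succ, Fin.cons_succ]

theorem edge_last (v : Fin (n + 1) → E d) : edge v (Fin.last (n + 1)) = -v (Fin.last n) := by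
  rw [edge, Fin.last_add_one, Fin.cons_zero, zero_sub, ← Fin.succ_last, Fin.cons_succ]

theorem edge_add (v w : Fin n → E d) (i : Fin (n + 1)) : edge (v + w) i = edge v i + edge w i := by
  have h : ∀ j, (Fin.cons 0 (v + w) : Fin (n + 1) → E d) j =
      (Fin.cons 0 v : Fin (n + 1) → E d) j + (Fin.cons 0 w : Fin (n + 1) → E d) j := fun j => by
    cases j using Fin.cases with
    | zero => simp
    | succ j => simp
  rw [edge, edge, edge, h, h]
  abel

/-- An edge as linear function of the polygon. -/
def edgeLinear (d n : ℕ) (i : Fin (n + 1)) : (Fin n → E d) →ₗ[ℝ] E d where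
  toFun v := edge v i
  map_add' v w := edge_add v w i
  map_smul' r v := edge_smul r v i

theorem edgeLinear_surjective (i : Fin (n + 2)) : Function.Surjective (edgeLinear d (n + 1) i) := by
  intro y
  -- A polygon with equally spaced vertices on a line hits any y: all its edges are multiples of one
  -- vector, and c is 1, or -(n + 1) for the closing edge, where i + 1 wraps around to 0.
  set c : ℝ := ((i + 1 : Fin (n + 2)) : ℕ) - (i : ℕ) with hc
  have hc0 : c ≠ 0 := by
    rw [hc, sub_ne_zero]
    intro h
    have h1 : i + 1 = i := Fin.val_injective (by exact_mod_cast h)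
    simp at h1
  refine ⟨fun j => ((j : ℕ) + 1 : ℝ) • c⁻¹ • y, ?_⟩
  have h : ∀ j, (Fin.cons 0 (fun j : Fin (n + 1) => ((j : ℕ) + 1 : ℝ) • c⁻¹ • y) :
      Fin (n + 2) → E d) j = ((j : ℕ) : ℝ) • c⁻¹ • y := fun j => by
    cases j using Fin.cases with
    | zero => simp
    | succ j => simp
  change edge _ i = y
  rw [edge, h, h, ← sub_smul, ← hc, smul_inv_smul₀ hc0]

/-- Fubini gives integrability for almost every y; an edge is a surjective linear function of the
polygon, so the exceptional set pulls back to a null set. -/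
theorem ae_integrable_yukawa_edge (hd : d + m = 3) :
    ∀ᵐ v : Fin (n + 1) → E d, ∀ i, Integrable fun z : E m => yukawa (pt 0) (rho (edge v i) z) := by
  rw [ae_all_iff]
  intro i
  have hm : Measurable fun q : E d × E m => yukawa (pt 0) (rho q.1 q.2) :=
    (measurable_yukawa _).comp continuous_rho.measurable
  have h1 : MeasurableSet {y : E d | Integrable fun z : E m => yukawa (pt 0) (rho y z)} :=
    measurableSet_integrable hm.stronglyMeasurable
  exact (ae_comp_linearMap_mem_iff (edgeLinear d (n + 1) i) volume volume
    (edgeLinear_surjective i) h1).2 (integrable_yukawa_rho hd (pt_re_pos 0)).prod_right_ae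

theorem prod_edge (G : E d → ℂ) (hG : ∀ y, G (-y) = G y) (v : Fin (n + 1) → E d) :
    ∏ i, G (edge v i) = G (v (Fin.last n)) *
      ∏ i : Fin (n + 1), G (v i - (Fin.cons 0 v : Fin (n + 2) → E d) i.castSucc) := by
  rw [Fin.prod_univ_castSucc, edge_last, hG, mul_comm]
  simp_rw [edge_castSucc]

theorem mulOp_one (h : MemLp (fun _ : E d => (1 : ℂ)) ∞ volume) (v : L2 d) : mulOp _ h v = v := by
  apply Lp.ext
  filter_upwards [coeFn_mulOp _ h v] with x hx
  rw [hx, one_mul]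

theorem birman_one (h : MemLp (fun _ : E d => (1 : ℂ)) ∞ volume) (s : ℝ) :
    birman h s = resolvent s := by
  ext1 v
  rw [birman, ContinuousLinearMap.comp_apply, mulOp_one]

theorem fourier_resolvent_pow (s : ℝ) (j : ℕ) (v : L2 d) :
    (𝓕 ((resolvent s ^ j) v) : L2 d) =ᵐ[volume] fun ξ =>
      resSymbol (pt s) ξ ^ j * (𝓕 v : L2 d) ξ := by
  induction j with
  | zero => exact Eventually.of_forall fun ξ => by simp
  | succ j ih =>
    have h0 : (𝓕 (resolvent s ((resolvent s ^ j) v)) : L2 d) =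
        mulOp _ (memLp_resSymbol_top s) (𝓕 ((resolvent s ^ j) v)) := fourier_fourierMul _ _ _
    rw [pow_succ', mul_apply_eq_comp, h0]
    filter_upwards [coeFn_mulOp _ (memLp_resSymbol_top s) (𝓕 ((resolvent s ^ j) v) : L2 d), ih]
      with ξ h1 h2
    rw [h1, h2]
    ring

theorem resSymbol_pt_zero (ξ : E d) : resSymbol (pt 0) ξ = (((1 + absD ξ ^ 2)⁻¹ : ℝ) : ℂ) := by
  rw [resSymbol, pt_zero]
  push_cast
  ring

/-- The closed loop is the path integral with V = 1 whose end function is the Green function with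
pole 0, that is ⟨g, R^j g⟩ with g = green. By Plancherel this is the integral of the symbol to the
power j + 2. -/
theorem integral_prod_green (hd : d + m = 3) (j : ℕ) :
    (Integrable fun v : Fin (j + 1) → E d => ∏ i, green m (pt 0) (edge v i)) ∧
      ∫ v : Fin (j + 1) → E d, ∏ i, green m (pt 0) (edge v i) =
        ((∫ ξ : E d, ((1 + absD ξ ^ 2)⁻¹) ^ (j + 2) : ℝ) : ℂ) := by
  have hd3 : d ≤ 3 := by omega
  have h1 : MemLp (fun _ : E d => (1 : ℂ)) ∞ volume := memLp_top_const 1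
  obtain ⟨g, hg⟩ : ∃ g : L2 d, g = greenVec hd3 0 0 := ⟨_, rfl⟩
  have hgx : g =ᵐ[volume] green m (pt 0) := by
    rw [hg]
    filter_upwards [greenVec_ae_eq hd 0 (0 : E d)] with x hx
    rw [hx, sub_zero]
  have hchain := integral_mul_birman_pow hd j measurable_const h1 0 g 0
  have hae : (fun v : Fin (j + 1) → E d => g (v (Fin.last j)) * chain m (fun _ => 1) 0 0 v)
      =ᵐ[volume] fun v => ∏ i, green m (pt 0) (edge v i) := by
    filter_upwards [ae_eval (Fin.last j) hgx] with v hv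
    rw [hv, prod_edge (green m (pt 0)) (fun y => descent_neg _ y), chain]
    simp only [one_mul]
  refine ⟨hchain.1.congr hae, ?_⟩
  rw [← integral_congr_ae hae, hchain.2, birman_one, mulOp_one, ← hg]
  have h2 : ∫ x, g x * ((resolvent 0 ^ j) g : L2 d) x = inner ℂ g ((resolvent 0 ^ j) g) := by
    rw [L2.inner_def]
    apply integral_congr_ae
    filter_upwards [hgx] with x hx
    have := conj_green (m := m) 0 x
    rw [neg_zero] at this
    rw [RCLike.inner_apply, hx, this, mul_comm]
  rw [h2, ← Lp.inner_fourier_eq, L2.inner_def, ← integral_complex_ofReal]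
  have h3 : (𝓕 g : L2 d) =ᵐ[volume] resSymbol (pt 0) := by
    rw [hg, greenVec]
    filter_upwards [fourier_shiftVec (memLp_resSymbol_two hd3 0) 0] with ξ hξ
    rw [hξ]
    simp [phase]
  apply integral_congr_ae
  filter_upwards [h3, fourier_resolvent_pow 0 j g] with ξ h4 h5
  rw [h5, h4, RCLike.inner_apply, resSymbol_pt_zero, RCLike.star_def.symm]
  simp only [RCLike.star_def, Complex.conj_ofReal]
  push_cast
  ring

theorem prod_yukawa_leg (p : ℂ) (q : Loop d m n) :
    ∏ i, yukawa p (leg q i) = Complex.exp (-p * len q) * loopDensity q := by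
  have h : ∀ i, yukawa p (leg q i) =
      Complex.exp (-p * leg q i) * (((4 * Real.pi * leg q i)⁻¹ : ℝ) : ℂ) := fun i => by
    rw [yukawa, div_eq_mul_inv]; push_cast; rfl
  simp_rw [h]
  rw [Finset.prod_mul_distrib, ← Complex.exp_sum, ← Finset.mul_sum, len, loopDensity]
  push_cast
  rfl

theorem measurable_prod_yukawa (p : ℂ) :
    Measurable fun q : Loop d m n => ∏ i, yukawa p (leg q i) :=
  Finset.measurable_prod _ fun i _ => (measurable_yukawa p).comp (continuous_leg i).measurable

theorem integral_prod_yukawa (v : Fin n → E d) (p : ℂ) :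
    ∫ z : Fin (n + 1) → E m, ∏ i, yukawa p (leg (v, z) i) = ∏ i, green m p (edge v i) :=
  integral_fintype_prod_volume_eq_prod (fun i (z : E m) => yukawa p (rho (edge v i) z))

theorem integrable_prod_yukawa (hd : d + m = 3) (j : ℕ) :
    Integrable (fun q : Loop d m (j + 1) => ∏ i, yukawa (pt 0) (leg q i)) (volume.prod volume) := by
  rw [integrable_prod_iff (measurable_prod_yukawa _).aestronglyMeasurable]
  constructor
  · filter_upwards [ae_integrable_yukawa_edge (m := m) (n := j) hd] with v hv
    exact Integrable.fintype_prod_dep hv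
  · refine (integral_prod_green hd j).1.norm.congr (Eventually.of_forall fun v => ?_)
    have h1 : ∀ z : Fin (j + 2) → E m, ‖∏ i, yukawa (pt 0) (leg (v, z) i)‖ =
        ∏ i, ‖yukawa (pt 0) (rho (edge v i) (z i))‖ := fun z => norm_prod _ _
    simp_rw [h1]
    rw [integral_fintype_prod_volume_eq_prod
      (fun i (z : E m) => ‖yukawa (pt 0) (rho (edge v i) z)‖), norm_prod]
    refine Finset.prod_congr rfl fun i _ => ?_
    rw [green_pt_zero, Complex.norm_real, Real.norm_of_nonneg
      (integral_nonneg fun _ => norm_nonneg _)]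

theorem integral_loopMeasure {X : Type*} [NormedAddCommGroup X] [NormedSpace ℝ X]
    (f : Loop d m n → X) :
    ∫ q, f q ∂loopMeasure d m n = ∫ q, loopDensity q • f q ∂(volume.prod volume) := by
  rw [loopMeasure, integral_withDensity_eq_integral_toReal_smul
    measurable_loopDensity.ennreal_ofReal (Eventually.of_forall fun _ => ENNReal.ofReal_lt_top)]
  simp_rw [ENNReal.toReal_ofReal (loopDensity_nonneg _)]

theorem integrable_loopMeasure_iff {X : Type*} [NormedAddCommGroup X] [NormedSpace ℝ X]
    (f : Loop d m n → X) :
    Integrable f (loopMeasure d m n) ↔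
      Integrable (fun q => loopDensity q • f q) (volume.prod volume) := by
  rw [loopMeasure, integrable_withDensity_iff_integrable_smul'
    measurable_loopDensity.ennreal_ofReal (Eventually.of_forall fun _ => ENNReal.ofReal_lt_top)]
  simp_rw [ENNReal.toReal_ofReal (loopDensity_nonneg _)]

theorem integrable_exp_neg_len (hd : d + m = 3) (j : ℕ) :
    Integrable (fun q => Real.exp (-len q)) (loopMeasure d m (j + 1)) ∧
      ∫ q, Real.exp (-len q) ∂loopMeasure d m (j + 1) =
        ∫ ξ : E d, ((1 + absD ξ ^ 2)⁻¹) ^ (j + 2) := by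
  have h1 : ∀ q : Loop d m (j + 1), ∏ i, yukawa (pt 0) (leg q i) =
      ((loopDensity q • Real.exp (-len q) : ℝ) : ℂ) := fun q => by
    rw [prod_yukawa_leg, pt_zero, smul_eq_mul]
    push_cast
    ring_nf
  have h2 := integrable_prod_yukawa (m := m) hd j
  simp_rw [h1] at h2
  refine ⟨(integrable_loopMeasure_iff _).2 h2.re, ?_⟩
  rw [integral_loopMeasure]
  have h3 := integral_prod _ (integrable_prod_yukawa (m := m) hd j)
  simp_rw [integral_prod_yukawa, h1] at h3
  rw [(integral_prod_green hd j).2, integral_complex_ofReal] at h3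
  exact_mod_cast h3

theorem loopMeasure_len_le_one_ne_top (hd : d + m = 3) (j : ℕ) :
    loopMeasure d m (j + 1) {q | len q ≤ 1} ≠ ∞ := by
  have h1 := (integrable_exp_neg_len (m := m) hd j).1
  have h2 := h1.measure_ge_lt_top (Real.exp_pos (-1))
  refine ne_top_of_le_ne_top h2.ne (measure_mono fun q hq => ?_)
  exact Real.exp_le_exp.2 (neg_le_neg hq)

end LoopMass

end WaveTrace

namespace WaveTrace

/-! ### Gamma function evaluation of the total mass -/

section ShapeMass

open Filter Topology

variable {d m : ℕ}

theorem integral_exp_neg_absD {x : ℝ} (hx : 0 < x) :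
    ∫ ξ : E d, Real.exp (-x * absD ξ ^ 2) = (4 * Real.pi * x) ^ (-(d / 2 : ℝ)) := by
  have hπ := Real.pi_pos
  have h := GaussianFourier.integral_rexp_neg_mul_sq_norm (V := E d)
    (b := x * (2 * Real.pi) ^ 2) (by positivity)
  have h1 : ∀ ξ : E d, -x * absD ξ ^ 2 = -(x * (2 * Real.pi) ^ 2) * ‖ξ‖ ^ 2 := fun ξ => by
    rw [absD]; ring
  simp_rw [h1]
  rw [h, finrank_euclideanSpace_fin, Real.rpow_neg (by positivity), ← Real.inv_rpow (by positivity)]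
  congr 1
  field_simp
  ring

theorem integrable_exp_neg_absD {x : ℝ} (hx : 0 < x) :
    Integrable fun ξ : E d => Real.exp (-x * absD ξ ^ 2) := by
  refine Integrable.of_integral_ne_zero ?_
  rw [integral_exp_neg_absD hx]
  have := Real.pi_pos
  positivity

/-- The representation Γ(k)a^{-k} = ∫ x^{k-1} e^{-ax} dx turns the integral over ξ into a Gaussian
one, and the remaining integral over x is Γ(k - d/2). -/
theorem integral_resSymbol_pow {k : ℕ} (hk : d < 2 * k) :
    Real.Gamma k * ∫ ξ : E d, ((1 + absD ξ ^ 2)⁻¹) ^ k =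
      (4 * Real.pi) ^ (-(d / 2 : ℝ)) * Real.Gamma (k - d / 2) := by
  have hπ := Real.pi_pos
  have hk0 : (0 : ℝ) < k := by exact_mod_cast (by omega : 0 < k)
  have hs : (0 : ℝ) < k - d / 2 := by
    have : (d : ℝ) < 2 * k := by exact_mod_cast hk
    linarith
  set f : E d → ℝ → ℝ := fun ξ x => x ^ ((k : ℝ) - 1) * Real.exp (-((1 + absD ξ ^ 2) * x)) with hf
  have h1 : ∀ ξ : E d, ∫ x in Set.Ioi (0 : ℝ), f ξ x = ((1 + absD ξ ^ 2)⁻¹) ^ k * Real.Gamma k := by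
    intro ξ
    rw [hf, Real.integral_rpow_mul_exp_neg_mul_Ioi hk0 (by positivity), one_div, Real.rpow_natCast]
  have hfx : ∀ x ∈ Set.Ioi (0 : ℝ), ∀ ξ : E d, f ξ x =
      x ^ ((k : ℝ) - 1) * Real.exp (-x) * Real.exp (-x * absD ξ ^ 2) := fun x hx ξ => by
    rw [mul_assoc, ← Real.exp_add, hf]
    simp only
    congr 2
    ring
  have h2 : ∀ x ∈ Set.Ioi (0 : ℝ), ∫ ξ : E d, f ξ x =
      (4 * Real.pi) ^ (-(d / 2 : ℝ)) * (Real.exp (-x) * x ^ ((k - d / 2 : ℝ) - 1)) := fun x hx => by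
    have hx' : 0 < x := hx
    simp_rw [hfx x hx]
    rw [integral_const_mul, integral_exp_neg_absD hx', Real.mul_rpow (by positivity) hx'.le]
    have : x ^ ((k - d / 2 : ℝ) - 1) = x ^ ((k : ℝ) - 1) * x ^ (-(d / 2 : ℝ)) := by
      rw [← Real.rpow_add hx']; congr 1; ring
    rw [this]
    ring
  have hmeas : Measurable (Function.uncurry f) := by
    have := (continuous_absD (d := d)).measurable
    rw [hf]
    unfold Function.uncurry
    fun_prop
  have hint : Integrable (Function.uncurry f) (volume.prod (volume.restrict (Set.Ioi 0))) := by
    rw [integrable_prod_iff' hmeas.aestronglyMeasurable]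
    constructor
    · filter_upwards [ae_restrict_mem measurableSet_Ioi] with x hx
      exact ((integrable_exp_neg_absD hx).const_mul _).congr
        (Eventually.of_forall fun ξ => (hfx x hx ξ).symm)
    · refine ((Real.GammaIntegral_convergent hs).const_mul
        ((4 * Real.pi) ^ (-(d / 2 : ℝ)))).congr ?_
      filter_upwards [ae_restrict_mem measurableSet_Ioi] with x hx
      rw [← h2 x hx]
      congr 1
      funext ξ
      have hx' : 0 < x := hx
      refine (Real.norm_of_nonneg ?_).symm
      rw [hfx x hx]
      positivity
  have h3 := integral_integral_swap hint
  simp_rw [h1] at h3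
  rw [integral_mul_const, setIntegral_congr_fun measurableSet_Ioi h2, integral_const_mul,
    ← Real.Gamma_eq_integral hs] at h3
  rw [mul_comm, h3]

theorem integral_radialMeasure {X : Type*} [NormedAddCommGroup X] [NormedSpace ℝ X] (N : ℕ)
    (f : ℝ → X) : ∫ t, f t ∂radialMeasure N = ∫ t in Set.Ioi (0 : ℝ), t ^ (N - 1) • f t := by
  rw [radialMeasure, integral_withDensity_eq_integral_toReal_smul (by fun_prop)
    (Eventually.of_forall fun _ => ENNReal.ofReal_lt_top)]
  refine setIntegral_congr_fun measurableSet_Ioi fun t ht => ?_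
  have ht' : (0 : ℝ) < t := ht
  simp only [ENNReal.toReal_ofReal (pow_nonneg ht'.le _)]

theorem integrable_radialMeasure_iff {X : Type*} [NormedAddCommGroup X] [NormedSpace ℝ X] (N : ℕ)
    (f : ℝ → X) : Integrable f (radialMeasure N) ↔
      IntegrableOn (fun t => t ^ (N - 1) • f t) (Set.Ioi 0) := by
  rw [radialMeasure, integrable_withDensity_iff_integrable_smul' (by fun_prop)
    (Eventually.of_forall fun _ => ENNReal.ofReal_lt_top), IntegrableOn]
  refine integrable_congr ?_
  filter_upwards [ae_restrict_mem measurableSet_Ioi] with t ht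
  have ht' : (0 : ℝ) < t := ht
  rw [ENNReal.toReal_ofReal (pow_nonneg ht'.le _)]

theorem isFiniteMeasure_shape (hd : d + m = 3) (j : ℕ) :
    IsFiniteMeasure (shapeMeasure d m (j + 1)) :=
  isFiniteMeasure_shapeMeasure (loopMeasure_len_le_one_ne_top hd j)

theorem map_loopMeasure_eq (hd : d + m = 3) (j : ℕ) :
    (loopMeasure d m (j + 1)).map (fun q => (len q, (len q)⁻¹ • q.1)) =
      (radialMeasure (2 * (j + 2) - d)).prod (shapeMeasure d m (j + 1)) :=
  map_loopMeasure hd (by omega) (loopMeasure_len_le_one_ne_top hd j)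

theorem measurable_len_shape {n : ℕ} :
    Measurable fun q : Loop d m n => (len q, (len q)⁻¹ • q.1) :=
  continuous_len.measurable.prodMk measurable_shape

/-- The integral of e^{-len} is evaluated twice: in polar coordinates, where the radial factor is a
factorial, and by Plancherel. -/
theorem shapeMeasure_real_univ (hd : d + m = 3) (j : ℕ) :
    ((2 * (j + 2) - d - 1).factorial : ℝ) * (shapeMeasure d m (j + 1)).real Set.univ *
      Real.Gamma ((j + 2 : ℕ) : ℝ) =
      (4 * Real.pi) ^ (-(d / 2 : ℝ)) * Real.Gamma ((j + 2 : ℕ) - d / 2) := by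
  have := isFiniteMeasure_shape hd j
  rw [← integral_resSymbol_pow (by omega), ← (integrable_exp_neg_len (m := m) hd j).2, mul_comm]
  congr 1
  have h1 := integral_map (μ := loopMeasure d m (j + 1)) measurable_len_shape.aemeasurable
    (f := fun p : ℝ × (Fin (j + 1) → E d) => Real.exp (-p.1))
    (by fun_prop : Measurable fun p : ℝ × (Fin (j + 1) → E d) =>
      Real.exp (-p.1)).aestronglyMeasurable
  rw [← h1, map_loopMeasure_eq hd]
  have h2 := integral_prod_mul (μ := radialMeasure (2 * (j + 2) - d))
    (ν := shapeMeasure d m (j + 1)) (fun t => Real.exp (-t)) fun _ => (1 : ℝ)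
  simp only [mul_one] at h2
  rw [h2, integral_const, smul_eq_mul, mul_one, integral_radialMeasure]
  congr 1
  have h3 : ((2 * (j + 2) - d - 1 : ℕ) : ℝ) + 1 = ((2 * (j + 2) - d : ℕ) : ℝ) := by
    exact_mod_cast (by omega : 2 * (j + 2) - d - 1 + 1 = 2 * (j + 2) - d)
  rw [← Real.Gamma_nat_eq_factorial, Real.Gamma_eq_integral (by positivity)]
  refine setIntegral_congr_fun measurableSet_Ioi fun t ht => ?_
  simp only [add_sub_cancel_right, Real.rpow_natCast, smul_eq_mul]
  ring

/-- For odd d the value Γ(k - d/2) at a half-integer is eliminated by the duplication formula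
(`h1`), which leaves factorials, a power of 2 and √π. -/
theorem shapeMass_one (hd : 1 + m = 3) (j : ℕ) :
    2 / ((j + 2 : ℕ) : ℝ) * (shapeMeasure 1 m (j + 1)).real Set.univ =
      1 / (2 ^ (2 * (j + 2) - 2) * ((j + 2).factorial : ℝ) * ((j + 2 - 1).factorial : ℝ)) := by
  have h := shapeMeasure_real_univ hd j
  have h1 := Real.Gamma_mul_Gamma_add_half ((j + 2 : ℕ) - (1 : ℕ) / 2 : ℝ)
  have e1 : ((j + 2 : ℕ) - (1 : ℕ) / 2 : ℝ) + 1 / 2 = (j + 1 : ℕ) + 1 := by push_cast; ring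
  have e2 : (2 * ((j + 2 : ℕ) - (1 : ℕ) / 2) : ℝ) = (2 * j + 2 : ℕ) + 1 := by push_cast; ring
  have e3 : (1 - (((2 * j + 2 : ℕ) : ℝ) + 1)) = -((2 * j + 2 : ℕ) : ℝ) := by ring
  have e4 : ((j + 2 : ℕ) : ℝ) = (j + 1 : ℕ) + 1 := by push_cast; ring
  have e5 : 2 * (j + 2) - 1 - 1 = 2 * j + 2 := by omega
  have e6 : 2 * (j + 2) - 2 = 2 * j + 2 := by omega
  have e7 : (4 * Real.pi) ^ (-((1 : ℕ) / 2 : ℝ)) = (2 * √Real.pi)⁻¹ := by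
    rw [Real.rpow_neg (by positivity), Nat.cast_one, ← Real.sqrt_eq_rpow,
      Real.sqrt_mul (by norm_num), show (4 : ℝ) = 2 ^ 2 by norm_num, Real.sqrt_sq (by norm_num)]
  rw [e1, e2, e3, Real.Gamma_nat_eq_factorial, Real.Gamma_nat_eq_factorial,
    Real.rpow_neg (by norm_num), Real.rpow_natCast] at h1
  rw [e7, e5] at h
  set G := Real.Gamma ((j + 2 : ℕ) - (1 : ℕ) / 2 : ℝ)
  rw [e4, Real.Gamma_nat_eq_factorial] at h
  rw [e6, show j + 2 - 1 = j + 1 by omega, Nat.factorial_succ (j + 1)]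
  push_cast
  have hπ : 0 < √Real.pi := Real.sqrt_pos.2 Real.pi_pos
  have f1 : ((j + 1).factorial : ℝ) ≠ 0 := by positivity
  have f2 : ((2 * j + 2).factorial : ℝ) ≠ 0 := by positivity
  have f3 : (j : ℝ) + 2 ≠ 0 := by positivity
  have hG : G = 2 * √Real.pi * (((2 * j + 2).factorial : ℝ) *
      (shapeMeasure 1 m (j + 1)).real Set.univ * ((j + 1).factorial : ℝ)) := by
    rw [h]; field_simp
  have h2 : (2 : ℝ) ^ (2 * j + 2) * (G * (j + 1).factorial) = (2 * j + 2).factorial * √Real.pi := by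
    rw [h1]; field_simp
  have key : 2 * 2 ^ (2 * j + 2) * ((j + 1).factorial : ℝ) ^ 2 *
      (shapeMeasure 1 m (j + 1)).real Set.univ = 1 := by
    apply mul_left_cancel₀ (mul_ne_zero f2 hπ.ne')
    rw [hG] at h2
    linear_combination h2
  field_simp
  linear_combination ((j : ℝ) + 2) * key

theorem shapeMass_two (hd : 2 + m = 3) (j : ℕ) :
    2 / ((j + 2 : ℕ) : ℝ) * (shapeMeasure 2 m (j + 1)).real Set.univ =
      1 / (Real.pi * ((j + 2 : ℕ) : ℝ) * ((2 * (j + 2) - 2).factorial : ℝ)) := by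
  have h := shapeMeasure_real_univ hd j
  have e1 : ((j + 2 : ℕ) - (2 : ℕ) / 2 : ℝ) = (j : ℝ) + 1 := by push_cast; ring
  have e4 : ((j + 2 : ℕ) : ℝ) = (j + 1 : ℕ) + 1 := by push_cast; ring
  have e5 : 2 * (j + 2) - 2 - 1 = 2 * j + 1 := by omega
  have e6 : 2 * (j + 2) - 2 = 2 * j + 1 + 1 := by omega
  have e7 : (4 * Real.pi) ^ (-((2 : ℕ) / 2 : ℝ)) = (4 * Real.pi)⁻¹ := by
    rw [Real.rpow_neg (by positivity)]; norm_num
  rw [e7, e5, e1, Real.Gamma_nat_eq_factorial, e4, Real.Gamma_nat_eq_factorial,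
    Nat.factorial_succ j] at h
  rw [e6, Nat.factorial_succ (2 * j + 1)]
  push_cast at h ⊢
  have f1 : (j.factorial : ℝ) ≠ 0 := by positivity
  have f2 : ((2 * j + 1).factorial : ℝ) ≠ 0 := by positivity
  have f3 : (j : ℝ) + 2 ≠ 0 := by positivity
  have f4 : (j : ℝ) + 1 ≠ 0 := by positivity
  have hπ := Real.pi_pos
  have key : (2 * (j + 1) * (2 * Real.pi * ((2 * j + 1).factorial : ℝ))) *
      (shapeMeasure 2 m (j + 1)).real Set.univ = 1 := by
    apply mul_left_cancel₀ f1
    have h2 := congrArg (fun x => 4 * Real.pi * x) h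
    simp only [← mul_assoc, mul_inv_cancel₀ (show 4 * Real.pi ≠ 0 by positivity)] at h2
    linear_combination h2
  field_simp
  linear_combination key

theorem shapeMass_three (hd : 3 + m = 3) (j : ℕ) :
    2 / ((j + 2 : ℕ) : ℝ) * (shapeMeasure 3 m (j + 1)).real Set.univ =
      1 / (2 ^ (2 * (j + 2) - 2) * Real.pi * ((j + 2).factorial : ℝ) *
        ((j + 2 - 2).factorial : ℝ)) := by
  have h := shapeMeasure_real_univ hd j
  have h1 := Real.Gamma_mul_Gamma_add_half ((j + 2 : ℕ) - (3 : ℕ) / 2 : ℝ)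
  have e1 : ((j + 2 : ℕ) - (3 : ℕ) / 2 : ℝ) + 1 / 2 = (j : ℕ) + 1 := by push_cast; ring
  have e2 : (2 * ((j + 2 : ℕ) - (3 : ℕ) / 2) : ℝ) = (2 * j : ℕ) + 1 := by push_cast; ring
  have e3 : (1 - (((2 * j : ℕ) : ℝ) + 1)) = -((2 * j : ℕ) : ℝ) := by ring
  have e4 : ((j + 2 : ℕ) : ℝ) = (j + 1 : ℕ) + 1 := by push_cast; ring
  have e5 : 2 * (j + 2) - 3 - 1 = 2 * j := by omega
  have e6 : 2 * (j + 2) - 2 = 2 * j + 2 := by omega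
  have e7 : (4 * Real.pi) ^ (-((3 : ℕ) / 2 : ℝ)) = (8 * Real.pi * √Real.pi)⁻¹ := by
    have : ((3 : ℕ) / 2 : ℝ) = 1 + 1 / 2 := by norm_num
    have hp := Real.pi_pos
    rw [Real.rpow_neg (by positivity), this, Real.rpow_add (by positivity), Real.rpow_one,
      ← Real.sqrt_eq_rpow, Real.sqrt_mul (by norm_num), show √(4 : ℝ) = 2 by
        rw [show (4 : ℝ) = 2 ^ 2 by norm_num, Real.sqrt_sq (by norm_num)]]
    ring
  rw [e1, e2, e3, Real.Gamma_nat_eq_factorial, Real.Gamma_nat_eq_factorial,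
    Real.rpow_neg (by norm_num), Real.rpow_natCast] at h1
  rw [e7, e5] at h
  set G := Real.Gamma ((j + 2 : ℕ) - (3 : ℕ) / 2 : ℝ)
  rw [e4, Real.Gamma_nat_eq_factorial] at h
  rw [e6, show j + 2 - 2 = j by omega, Nat.factorial_succ (j + 1), pow_add]
  push_cast
  have hπ : 0 < √Real.pi := Real.sqrt_pos.2 Real.pi_pos
  have hπ' := Real.pi_pos
  have f1 : ((j + 1).factorial : ℝ) ≠ 0 := by positivity
  have f2 : ((2 * j).factorial : ℝ) ≠ 0 := by positivity
  have f3 : (j : ℝ) + 2 ≠ 0 := by positivity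
  have hG : G = 8 * Real.pi * √Real.pi * (((2 * j).factorial : ℝ) *
      (shapeMeasure 3 m (j + 1)).real Set.univ * ((j + 1).factorial : ℝ)) := by
    rw [h]; field_simp
  have h2 : (2 : ℝ) ^ (2 * j) * (G * j.factorial) = (2 * j).factorial * √Real.pi := by
    rw [h1]; field_simp
  have key : 8 * Real.pi * 2 ^ (2 * j) * ((j + 1).factorial : ℝ) * j.factorial *
      (shapeMeasure 3 m (j + 1)).real Set.univ = 1 := by
    apply mul_left_cancel₀ (mul_ne_zero f2 hπ.ne')
    rw [hG] at h2
    linear_combination h2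
  field_simp
  linear_combination ((j : ℝ) + 2) * key

end ShapeMass

end WaveTrace

namespace WaveTrace

/-! ### Cyclic relabelling of the vertices of a polygon -/

section CyclicSymmetry

open Filter Topology

variable {d m n : ℕ}

/-- The vertices of the polygon with first vertex `u`, together with the additional coordinates of
its edges. -/
def place (p : E d × Loop d m n) : (Fin (n + 1) → E d) × (Fin (n + 1) → E m) :=
  (Fin.cons p.1 fun i => p.1 + p.2.1 i, p.2.2)

/-- The product of the values of `V` at the vertices of a polygon and of the kernels along its
edges, with the additional factor of the length of an edge. -/
noncomputable def cyclicProduct (V : E d → ℂ) (s : ℝ) (a : Fin (n + 1))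
    (y : (Fin (n + 1) → E d) × (Fin (n + 1) → E m)) : ℂ :=
  (∏ i, V (y.1 i)) * (rho (y.1 (a + 1) - y.1 a) (y.2 a) : ℂ) *
    ∏ i, yukawa (pt s) (rho (y.1 (i + 1) - y.1 i) (y.2 i))

theorem measurable_cyclicProduct {V : E d → ℂ} (hV : Measurable V) (s : ℝ) (a : Fin (n + 1)) :
    Measurable (cyclicProduct V s a (m := m)) := by
  have h1 : ∀ i : Fin (n + 1), Measurable fun y : (Fin (n + 1) → E d) × (Fin (n + 1) → E m) =>
      rho (y.1 (i + 1) - y.1 i) (y.2 i) := fun i => by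
    have h2 : Continuous fun y : (Fin (n + 1) → E d) × (Fin (n + 1) → E m) =>
      (y.1 (i + 1) - y.1 i, y.2 i) := by fun_prop
    exact (continuous_rho.comp h2).measurable
  have h3 : Measurable fun y : (Fin (n + 1) → E d) × (Fin (n + 1) → E m) => ∏ i, V (y.1 i) :=
    Finset.measurable_prod _ fun i _ => hV.comp ((measurable_pi_apply i).comp measurable_fst)
  exact (h3.mul (Complex.measurable_ofReal.comp (h1 a))).mul
    (Finset.measurable_prod _ fun i _ => (measurable_yukawa _).comp (h1 i))

theorem cons_add (u : E d) (v : Fin n → E d) (i : Fin (n + 1)) :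
    (Fin.cons u fun i => u + v i : Fin (n + 1) → E d) i =
      u + (Fin.cons 0 v : Fin (n + 1) → E d) i := by
  cases i using Fin.cases with
  | zero => simp
  | succ i => simp

theorem cyclicProduct_place (V : E d → ℂ) (s : ℝ) (a : Fin (n + 1)) (p : E d × Loop d m n) :
    cyclicProduct V s a (place p) =
      potentialProduct V 1 (p.1, p.2.1) * leg p.2 a * ∏ i, yukawa (pt s) (leg p.2 i) := by
  have h : ∀ i, (place p).1 (i + 1) - (place p).1 i = edge p.2.1 i := fun i => by
    change (Fin.cons p.1 fun i => p.1 + p.2.1 i : Fin (n + 1) → E d) (i + 1) -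
      (Fin.cons p.1 fun i => p.1 + p.2.1 i : Fin (n + 1) → E d) i = _
    rw [cons_add, cons_add, add_sub_add_left_eq_sub, edge]
  have h1 : ∏ i, V ((place p).1 i) = potentialProduct V 1 (p.1, p.2.1) := by
    rw [Fin.prod_univ_succ, potentialProduct]
    simp only [place, Fin.cons_zero, Fin.cons_succ, one_smul]
  rw [cyclicProduct, h1]
  simp_rw [h]
  rfl

theorem measurePreserving_place : MeasurePreserving (place (d := d) (m := m) (n := n))
    (volume.prod (volume.prod volume)) (volume.prod volume) := by
  have h1 : MeasurePreserving (fun p : E d × (Fin n → E d) => (p.1, fun i => p.1 + p.2 i))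
      (volume.prod volume) (volume.prod volume) := by
    refine (MeasurePreserving.id volume).skew_product
      (g := fun (u : E d) (v : Fin n → E d) => fun i => u + v i)
      (by unfold Function.uncurry; fun_prop) (Eventually.of_forall fun u => ?_)
    exact map_add_left_eq_self volume fun _ => u
  have h2 := (volume_preserving_piFinSuccAbove (fun _ : Fin (n + 1) => E d) 0).symm
  have h3 := (h2.comp h1).prod (MeasurePreserving.id (volume : Measure (Fin (n + 1) → E m)))
  have h4 := (measurePreserving_prodAssoc (volume : Measure (E d))
    (volume : Measure (Fin n → E d)) (volume : Measure (Fin (n + 1) → E m))).symm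
  have h5 := h3.comp h4
  have h6 : place (d := d) (m := m) (n := n) = Prod.map
      ((MeasurableEquiv.piFinSuccAbove (fun _ : Fin (n + 1) => E d) 0).symm ∘
        fun p : E d × (Fin n → E d) => (p.1, fun i => p.1 + p.2 i)) id ∘
      MeasurableEquiv.prodAssoc.symm := by
    funext p
    refine Prod.ext (funext fun i => ?_) rfl
    cases i using Fin.cases with
    | zero => rfl
    | succ i => rfl
  rw [h6]
  exact h5

/-- The cyclic shift of the vertices of a polygon. -/
def rotate (a : Fin (n + 1)) : (Fin (n + 1) → E d) × (Fin (n + 1) → E m) ≃ᵐ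
    (Fin (n + 1) → E d) × (Fin (n + 1) → E m) :=
  MeasurableEquiv.prodCongr (MeasurableEquiv.piCongrLeft (fun _ => E d) (Equiv.addRight a))
    (MeasurableEquiv.piCongrLeft (fun _ => E m) (Equiv.addRight a))

theorem measurePreserving_rotate (a : Fin (n + 1)) :
    MeasurePreserving (rotate (d := d) (m := m) a) (volume.prod volume) (volume.prod volume) :=
  (volume_measurePreserving_piCongrLeft (fun _ => E d) (Equiv.addRight a)).prod
    (volume_measurePreserving_piCongrLeft (fun _ => E m) (Equiv.addRight a))

theorem cyclicProduct_rotate (V : E d → ℂ) (s : ℝ) (a b : Fin (n + 1))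
    (y : (Fin (n + 1) → E d) × (Fin (n + 1) → E m)) :
    cyclicProduct V s (b + a) (rotate a y) = cyclicProduct V s b y := by
  have h1 : ∀ i, (rotate a y).1 (i + a) = y.1 i := fun i =>
    Equiv.piCongrLeft_apply_apply (fun _ => E d) (Equiv.addRight a) y.1 i
  have h2 : ∀ i, (rotate a y).2 (i + a) = y.2 i := fun i =>
    Equiv.piCongrLeft_apply_apply (fun _ => E m) (Equiv.addRight a) y.2 i
  have h3 : ∀ i, (rotate a y).1 (i + a + 1) = y.1 (i + 1) := fun i => by
    rw [add_right_comm, h1]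
  rw [cyclicProduct, cyclicProduct, h1, h2, h3]
  congr 1
  · congr 1
    rw [← Equiv.prod_comp (Equiv.addRight a)]
    exact Finset.prod_congr rfl fun i _ => congrArg V (h1 i)
  · rw [← Equiv.prod_comp (Equiv.addRight a)]
    refine Finset.prod_congr rfl fun i _ => ?_
    rw [Equiv.coe_addRight, h1, h2, h3]

/-- With absolute vertices in place of those relative to the first one, cyclic shifts preserve the
measure and the integrand up to moving the distinguished edge. Hence it does not matter which edge
carries the length factor. -/
theorem integral_cyclicProduct_place {V : E d → ℂ} (hV : Measurable V) (s : ℝ)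
    (a b : Fin (n + 1)) :
    ∫ p : E d × Loop d m n, cyclicProduct V s a (place p) ∂(volume.prod (volume.prod volume)) =
      ∫ p : E d × Loop d m n,
        cyclicProduct V s b (place p) ∂(volume.prod (volume.prod volume)) := by
  have h1 : ∀ c : Fin (n + 1), ∫ p : E d × Loop d m n, cyclicProduct V s c (place p)
      ∂(volume.prod (volume.prod volume)) = ∫ y, cyclicProduct V s c y
        ∂((volume : Measure (Fin (n + 1) → E d)).prod (volume : Measure (Fin (n + 1) → E m))) :=
    fun c => by
    rw [← (measurePreserving_place (d := d) (m := m) (n := n)).map_eq,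
      integral_map measurePreserving_place.measurable.aemeasurable
        (measurable_cyclicProduct hV s c).aestronglyMeasurable]
  rw [h1, h1, ← (measurePreserving_rotate (b - a)).integral_comp' (g := cyclicProduct V s b)]
  congr 1
  funext y
  have := cyclicProduct_rotate V s (b - a) a y
  rw [add_sub_cancel] at this
  exact this.symm

end CyclicSymmetry

/-! ### Integrability over polygons -/

section LoopExpansion

open Filter Topology

variable {d m : ℕ}

theorem integrable_comp_len (hd : d + m = 3) (j : ℕ) {f : ℝ → ℝ}
    (hf : IntegrableOn (fun t => t ^ (2 * (j + 2) - d - 1) * f t) (Set.Ioi 0)) :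
    Integrable (fun q => f (len q)) (loopMeasure d m (j + 1)) := by
  have := isFiniteMeasure_shape hd j
  have h1 := ((integrable_radialMeasure_iff (2 * (j + 2) - d) f).2 hf).comp_fst
    (shapeMeasure d m (j + 1))
  rw [← map_loopMeasure_eq hd] at h1
  exact h1.comp_measurable measurable_len_shape

theorem integrable_len_mul_exp (hd : d + m = 3) (j : ℕ) :
    Integrable (fun q => len q * Real.exp (-len q)) (loopMeasure d m (j + 1)) := by
  refine integrable_comp_len hd j (f := fun t => t * Real.exp (-t)) ?_
  refine (Real.GammaIntegral_convergent (s := (2 * (j + 2) - d : ℕ) + 1)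
    (by positivity)).congr_fun (fun t ht => ?_) measurableSet_Ioi
  simp only [add_sub_cancel_right, Real.rpow_natCast]
  have : t ^ (2 * (j + 2) - d) = t ^ (2 * (j + 2) - d - 1) * t := by
    rw [← pow_succ]; congr 1; omega
  rw [this]
  ring

theorem integrable_of_bounded_support {V : E d → ℂ} (hVm : Measurable V) {S : Set (E d)}
    (hS : volume S ≠ ∞) (hVS : ∀ y, y ∉ S → V y = 0) {B : ℝ} (hB : ∀ y, ‖V y‖ ≤ B) :
    Integrable V := by
  have h1 : IntegrableOn V S :=
    Measure.integrableOn_of_bounded hS hVm.aestronglyMeasurable (Eventually.of_forall hB)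
  exact (integrableOn_iff_integrable_of_support_subset fun y hy => by
    by_contra h; exact hy (hVS y h)).1 h1

theorem norm_potentialProduct_le {V : E d → ℂ} {B : ℝ} (hB : ∀ y, ‖V y‖ ≤ B) {n : ℕ} (t : ℝ)
    (p : E d × (Fin n → E d)) : ‖potentialProduct V t p‖ ≤ ‖V p.1‖ * B ^ n := by
  rw [potentialProduct, norm_mul, norm_prod]
  gcongr
  refine (Finset.prod_le_prod (fun _ _ => norm_nonneg _) fun i _ => hB _).trans (le_of_eq ?_)
  simp

theorem measurable_potentialProduct {V : E d → ℂ} (hVm : Measurable V) {n : ℕ} :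
    Measurable fun q : ℝ × (E d × (Fin n → E d)) => potentialProduct V q.1 q.2 := by
  refine (hVm.comp (measurable_fst.comp measurable_snd)).mul (Finset.measurable_prod _ fun i _ =>
    hVm.comp ?_)
  fun_prop

instance (j : ℕ) : SFinite (loopMeasure d m j) := by
  rw [loopMeasure]; infer_instance

theorem integrable_potentialProduct_mul {V : E d → ℂ} (hVm : Measurable V) (hVi : Integrable V)
    {B : ℝ} (hB : ∀ y, ‖V y‖ ≤ B) {n : ℕ} {g : Loop d m n → ℂ} {G : Loop d m n → ℝ}
    (hg : Measurable g) (hgG : ∀ q, ‖g q‖ ≤ G q) {μ : Measure (Loop d m n)} [SFinite μ]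
    (hG : Integrable G μ) :
    Integrable (fun p : E d × Loop d m n => potentialProduct V 1 (p.1, p.2.1) * g p.2)
      ((volume : Measure (E d)).prod μ) := by
  have h1 := Integrable.mul_prod (hVi.norm.mul_const (B ^ n)) hG
  refine h1.mono' ?_ (Eventually.of_forall fun p => ?_)
  · have h2 : Measurable fun p : E d × Loop d m n => potentialProduct V 1 (p.1, p.2.1) :=
      (measurable_potentialProduct hVm).comp (g := fun q : ℝ × (E d × (Fin n → E d)) =>
        potentialProduct V q.1 q.2) (f := fun p : E d × Loop d m n => ((1 : ℝ), (p.1, p.2.1)))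
        (by fun_prop)
    exact (h2.mul (hg.comp measurable_snd)).aestronglyMeasurable
  · rw [norm_mul]
    exact mul_le_mul (norm_potentialProduct_le hB 1 _) (hgG _) (norm_nonneg _)
      (mul_nonneg (norm_nonneg _) (pow_nonneg ((norm_nonneg _).trans (hB 0)) _))

end LoopExpansion

end WaveTrace

namespace WaveTrace

/-! ### The half-line trace as integral over polygons -/

section LoopTrace

open Filter Topology

variable {d m : ℕ}

/-- The product of the kernels along the edges of a polygon, with the additional factor of the
length of an edge. -/
noncomputable def loopKernel {n : ℕ} (s : ℝ) (a : Fin (n + 1)) (q : Loop d m n) : ℂ :=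
  leg q a * ∏ i, yukawa (pt s) (leg q i)

theorem measurable_loopKernel {n : ℕ} (s : ℝ) (a : Fin (n + 1)) :
    Measurable (loopKernel (d := d) (m := m) s a) :=
  (Complex.measurable_ofReal.comp (continuous_leg a).measurable).mul (measurable_prod_yukawa _)

theorem norm_loopKernel_le {n : ℕ} (s : ℝ) (a : Fin (n + 1)) (q : Loop d m n) :
    ‖loopKernel s a q‖ ≤ loopDensity q • (len q * Real.exp (-len q)) := by
  have h1 : leg q a ≤ len q :=
    Finset.single_le_sum (f := leg q) (fun i _ => leg_nonneg q i) (Finset.mem_univ a)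
  have h2 : ‖Complex.exp (-pt s * len q)‖ = Real.exp (-len q) := norm_lapWeight s (len q)
  rw [loopKernel, prod_yukawa_leg, norm_mul, norm_mul, h2, Complex.norm_real, Complex.norm_real,
    Real.norm_of_nonneg (leg_nonneg q a), Real.norm_of_nonneg (loopDensity_nonneg q), smul_eq_mul]
  have := loopDensity_nonneg q
  calc leg q a * (Real.exp (-len q) * loopDensity q)
      ≤ len q * (Real.exp (-len q) * loopDensity q) := by gcongr
    _ = _ := by ring

/-- The factor r cancels the denominator of e^{-pr}/(4πr). The condition on y keeps r away from 0,
where division by zero would give 0 instead. -/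
theorem integral_yukawa_mul_rho {y : E d} (hy : y ≠ 0) (p : ℂ) :
    ∫ z : E m, (rho y z : ℂ) * yukawa p (rho y z) = greenSq m p y := by
  rw [greenSq, descent]
  congr 1
  funext z
  have h : (rho y z : ℂ) ≠ 0 := by
    have h1 := norm_pos_iff.2 hy
    exact Complex.ofReal_ne_zero.2 (h1.trans_le (norm_le_rho y z)).ne'
  rw [yukawa]
  field_simp

theorem integral_loopKernel_last {j : ℕ} {v : Fin (j + 1) → E d} (hv : v (Fin.last j) ≠ 0) (s : ℝ) :
    ∫ z : Fin (j + 1 + 1) → E m, loopKernel s (Fin.last (j + 1)) (v, z) =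
      greenSq m (pt s) (v (Fin.last j)) * ∏ i : Fin (j + 1),
        green m (pt s) (v i - (Fin.cons 0 v : Fin (j + 2) → E d) i.castSucc) := by
  set f : Fin (j + 1 + 1) → E m → ℂ := fun i z =>
    (if i = Fin.last (j + 1) then (rho (edge v i) z : ℂ) else 1) * yukawa (pt s) (rho (edge v i) z)
    with hf
  have h1 : ∀ z : Fin (j + 1 + 1) → E m, loopKernel s (Fin.last (j + 1)) (v, z) =
      ∏ i, f i (z i) := fun z => by
    rw [hf]
    simp only [Finset.prod_mul_distrib]
    rw [Finset.prod_ite_eq' Finset.univ (Fin.last (j + 1)) fun i => (rho (edge v i) (z i) : ℂ),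
      if_pos (Finset.mem_univ _)]
    rfl
  simp_rw [h1]
  rw [integral_fintype_prod_volume_eq_prod, Fin.prod_univ_castSucc, mul_comm]
  congr 1
  · rw [hf]
    simp only [if_true]
    rw [integral_yukawa_mul_rho (by rw [edge_last]; exact neg_ne_zero.2 hv), edge_last]
    exact descent_neg _ _
  · refine Finset.prod_congr rfl fun i _ => ?_
    rw [hf]
    simp only [(Fin.castSucc_lt_last i).ne, if_false, one_mul, edge_castSucc]
    rfl

variable {V : E d → ℂ} (hVm : Measurable V) (hVi : Integrable V)
  {B : ℝ} (hB : ∀ y, ‖V y‖ ≤ B)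

include hVm hVi hB in
theorem integrable_potentialProduct_loopKernel (hd : d + m = 3) (j : ℕ) (s : ℝ)
    (a : Fin (j + 2)) :
    Integrable (fun p : E d × Loop d m (j + 1) =>
      potentialProduct V 1 (p.1, p.2.1) * loopKernel s a p.2)
      (volume.prod (volume.prod volume)) :=
  integrable_potentialProduct_mul hVm hVi hB (measurable_loopKernel s a) (norm_loopKernel_le s a)
    ((integrable_loopMeasure_iff _).1 (integrable_len_mul_exp hd j))

include hVm hVi hB in
-- Integrating out the extra coordinates turns the last edge into `greenSq` and the others into
-- `green`. After translation by the first vertex u, the polygon is a path of resolvents closed by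
-- `greenSq`.
theorem integral_potentialProduct_loopKernel_last [NeZero d] (hd : d + m = 3)
    (hV : MemLp V ∞ volume) (j : ℕ) (s : ℝ) :
    ∫ p : E d × Loop d m (j + 1), potentialProduct V 1 (p.1, p.2.1) *
      loopKernel s (Fin.last (j + 1)) p.2 ∂(volume.prod (volume.prod volume)) =
      ∫ u, V u * ∫ x, greenSq m (pt s) (u - x) *
        (birman hV s ^ j) (mulOp V hV (greenVec (by omega) s u)) x := by
  have hint := integrable_potentialProduct_loopKernel hVm hVi hB hd j s (Fin.last (j + 1))
  rw [integral_prod _ hint]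
  apply integral_congr_ae
  filter_upwards [hint.prod_right_ae] with u hu
  rw [integral_prod _ hu]
  dsimp only
  obtain ⟨h, hh⟩ : ∃ h : L2 d, h = (memLp_greenSq hd s u).toLp _ := ⟨_, rfl⟩
  have hhx : h =ᵐ[volume] fun x => greenSq m (pt s) (u - x) := by
    rw [hh]; exact MemLp.coeFn_toLp _
  set H : (Fin (j + 1) → E d) → ℂ := fun w =>
    V u * (greenSq m (pt s) (u - w (Fin.last j)) * chain m V s u w) with hH
  have h1 : ∀ᵐ v : Fin (j + 1) → E d,
      ∫ z : Fin (j + 1 + 1) → E m, potentialProduct V 1 (u, v) *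
        loopKernel s (Fin.last (j + 1)) (v, z) = H ((fun _ => u) + v) := by
    filter_upwards [ae_eval (Fin.last j) (Measure.ae_ne volume (0 : E d))] with v hv
    rw [integral_const_mul, integral_loopKernel_last hv, potentialProduct, hH]
    dsimp only
    rw [chain]
    have h2 : ∀ i : Fin (j + 1), ((fun _ => u) + v : Fin (j + 1) → E d) i -
        (Fin.cons u ((fun _ => u) + v) : Fin (j + 2) → E d) i.castSucc =
          v i - (Fin.cons 0 v : Fin (j + 2) → E d) i.castSucc := fun i => by
      have h3 := cons_add u v i.castSucc
      have h4 : (Fin.cons u ((fun _ => u) + v) : Fin (j + 2) → E d) i.castSucc =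
        u + (Fin.cons 0 v : Fin (j + 2) → E d) i.castSucc := h3
      rw [h4, Pi.add_apply, add_sub_add_left_eq_sub]
    have h5 : u - ((fun _ => u) + v : Fin (j + 1) → E d) (Fin.last j) = -v (Fin.last j) := by
      rw [Pi.add_apply, sub_add_cancel_left]
    have h6 : greenSq m (pt s) (-v (Fin.last j)) = greenSq m (pt s) (v (Fin.last j)) :=
      descent_neg _ _
    simp_rw [h2]
    rw [h5, h6, Finset.prod_mul_distrib]
    simp only [one_smul, Pi.add_apply]
    ring
  rw [integral_congr_ae h1, integral_add_left_eq_self H, hH, integral_const_mul]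
  congr 1
  have h2 := (integral_mul_birman_pow hd j hVm hV s h u).2
  refine Eq.trans (integral_congr_ae ?_) (h2.trans (integral_congr_ae ?_))
  · filter_upwards [ae_eval (Fin.last j) hhx] with w hw
    rw [hw]
  · filter_upwards [hhx] with x hx
    rw [hx]

include hVm hVi hB in
-- The j + 2 choices of the distinguished edge give equal integrals, and their sum replaces the
-- length of one edge by the total length.
theorem integral_potentialProduct_len_mul [NeZero d] (hd : d + m = 3) (hV : MemLp V ∞ volume)
    (j : ℕ) (s : ℝ) :
    ((j + 2 : ℕ) : ℂ) * ∫ u, V u * ∫ x, greenSq m (pt s) (u - x) *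
        (birman hV s ^ j) (mulOp V hV (greenVec (by omega) s u)) x =
      ∫ p : E d × Loop d m (j + 1), potentialProduct V 1 (p.1, p.2.1) *
        (len p.2 * lapWeight s (len p.2)) ∂((volume : Measure (E d)).prod
          (loopMeasure d m (j + 1))) := by
  have h1 : ∀ a : Fin (j + 2), ∫ p : E d × Loop d m (j + 1), potentialProduct V 1 (p.1, p.2.1) *
      loopKernel s a p.2 ∂(volume.prod (volume.prod volume)) =
      ∫ p : E d × Loop d m (j + 1), potentialProduct V 1 (p.1, p.2.1) *
      loopKernel s (Fin.last (j + 1)) p.2 ∂(volume.prod (volume.prod volume)) := fun a => by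
    have h2 := integral_cyclicProduct_place (m := m) hVm s a (Fin.last (j + 1))
    simp_rw [cyclicProduct_place, mul_assoc] at h2
    exact h2
  have h2 : ∑ a : Fin (j + 2), ∫ p : E d × Loop d m (j + 1), potentialProduct V 1 (p.1, p.2.1) *
      loopKernel s a p.2 ∂(volume.prod (volume.prod volume)) =
      ((j + 2 : ℕ) : ℂ) * ∫ p : E d × Loop d m (j + 1), potentialProduct V 1 (p.1, p.2.1) *
      loopKernel s (Fin.last (j + 1)) p.2 ∂(volume.prod (volume.prod volume)) := by
    rw [Finset.sum_congr rfl fun a _ => h1 a, Finset.sum_const, Finset.card_univ, Fintype.card_fin,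
      nsmul_eq_mul]
  rw [← integral_potentialProduct_loopKernel_last hVm hVi hB hd hV, ← h2,
    ← integral_finsetSum _ fun a _ =>
      integrable_potentialProduct_loopKernel hVm hVi hB hd j s a]
  have h3 : (volume : Measure (E d)).prod (loopMeasure d m (j + 1)) =
      (volume.prod (volume.prod volume)).withDensity
        fun p : E d × Loop d m (j + 1) => ENNReal.ofReal (loopDensity p.2) := by
    rw [loopMeasure, prod_withDensity_right measurable_loopDensity.ennreal_ofReal]
  have h5 : Measurable fun p : E d × Loop d m (j + 1) => ENNReal.ofReal (loopDensity p.2) :=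
    (measurable_loopDensity.comp measurable_snd).ennreal_ofReal
  rw [h3, integral_withDensity_eq_integral_toReal_smul h5
    (Eventually.of_forall fun _ => ENNReal.ofReal_lt_top)]
  congr 1
  funext p
  simp only [loopKernel]
  rw [ENNReal.toReal_ofReal (loopDensity_nonneg _), ← Finset.mul_sum, ← Finset.sum_mul,
    prod_yukawa_leg, lapWeight, Complex.real_smul]
  have h4 : (len p.2 : ℂ) = ∑ a, (leg p.2 a : ℂ) := by rw [len]; push_cast; rfl
  rw [h4]
  ring

theorem potentialProduct_inv_smul {n : ℕ} (V : E d → ℂ) {t : ℝ} (ht : t ≠ 0) (u : E d)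
    (v : Fin n → E d) : potentialProduct V t (u, t⁻¹ • v) = potentialProduct V 1 (u, v) := by
  simp only [potentialProduct, Pi.smul_apply, smul_inv_smul₀ ht, one_smul]

variable {φ : ℝ → ℂ} (hφ : ContDiff ℝ (⊤ : ℕ∞) φ) (hc : HasCompactSupport φ)

include hVm hVi hB in
-- The parameter s enters only through e^{-p len}, so after Fubini the integral over s undoes the
-- Laplace transform and leaves φ at the length.
theorem integral_expHat_mul_loop [NeZero d] (hd : d + m = 3) (hV : MemLp V ∞ volume) (j : ℕ)
    {S : Set (E d)} (hVS : ∀ y, y ∉ S → V y = 0)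
    (hint : Integrable (fun q : ℝ × E d => expHat hφ hc q.1 * (V q.2 * ∫ x,
      greenSq m (pt q.1) (q.2 - x) *
        (birman hV q.1 ^ j) (mulOp V hV (greenVec (by omega) q.1 q.2)) x))
          ((volume : Measure ℝ).prod (volume.restrict S))) :
    ((j + 2 : ℕ) : ℂ) * ∫ q : ℝ × E d, expHat hφ hc q.1 * (V q.2 * ∫ x,
      greenSq m (pt q.1) (q.2 - x) *
        (birman hV q.1 ^ j) (mulOp V hV (greenVec (by omega) q.1 q.2)) x)
          ∂((volume : Measure ℝ).prod (volume.restrict S)) =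
      ∫ p : E d × Loop d m (j + 1), potentialProduct V 1 (p.1, p.2.1) *
        (len p.2 * φ (len p.2)) ∂((volume : Measure (E d)).prod (loopMeasure d m (j + 1))) := by
  set f : ℝ → E d × Loop d m (j + 1) → ℂ := fun s p => expHat hφ hc s *
    (potentialProduct V 1 (p.1, p.2.1) * (len p.2 * lapWeight s (len p.2))) with hf
  have hlen : Measurable fun p : E d × Loop d m (j + 1) => len p.2 :=
    (continuous_len (d := d) (m := m)).measurable.comp measurable_snd
  have hPP : Measurable fun p : E d × Loop d m (j + 1) => potentialProduct V 1 (p.1, p.2.1) :=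
    (measurable_potentialProduct hVm).comp (g := fun q : ℝ × (E d × (Fin (j + 1) → E d)) =>
      potentialProduct V q.1 q.2) (f := fun p : E d × Loop d m (j + 1) => ((1 : ℝ), (p.1, p.2.1)))
      (by fun_prop)
  have hfm : Measurable (Function.uncurry f) := by
    have h0 : Measurable fun q : ℝ × (E d × Loop d m (j + 1)) => (q.1, len q.2.2) :=
      measurable_fst.prodMk (hlen.comp measurable_snd)
    have h1 : Measurable fun q : ℝ × (E d × Loop d m (j + 1)) => lapWeight q.1 (len q.2.2) :=
      continuous_lapWeight_uncurry.measurable.comp (g := fun q : ℝ × ℝ => lapWeight q.1 q.2)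
        (f := fun q : ℝ × (E d × Loop d m (j + 1)) => (q.1, len q.2.2)) h0
    have h2 : Measurable fun q : ℝ × (E d × Loop d m (j + 1)) => expHat hφ hc q.1 :=
      (expHat hφ hc).continuous.measurable.comp measurable_fst
    exact h2.mul ((hPP.comp measurable_snd).mul
      ((Complex.measurable_ofReal.comp (hlen.comp measurable_snd)).mul h1))
  have hfi : Integrable (Function.uncurry f) ((volume : Measure ℝ).prod
      ((volume : Measure (E d)).prod (loopMeasure d m (j + 1)))) := by
    have h1 := Integrable.mul_prod (hVi.norm.mul_const (B ^ (j + 1)))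
      (integrable_len_mul_exp (m := m) hd j)
    have h2 := Integrable.mul_prod ((expHat hφ hc).integrable (μ := volume)).norm h1
    refine h2.mono' hfm.aestronglyMeasurable (Eventually.of_forall fun q => ?_)
    rw [Function.uncurry, hf]
    simp only [norm_mul, norm_lapWeight, Complex.norm_real, Real.norm_of_nonneg (len_nonneg _)]
    have := len_nonneg q.2.2
    have h3 := norm_potentialProduct_le hB 1 (q.2.1, q.2.2.1)
    gcongr
  rw [integral_prod _ hint, ← integral_const_mul]
  have h1 : ∀ s, ((j + 2 : ℕ) : ℂ) * ∫ u in S, expHat hφ hc s * (V u * ∫ x,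
      greenSq m (pt s) (u - x) *
        (birman hV s ^ j) (mulOp V hV (greenVec (by omega) s u)) x) =
      ∫ p, f s p ∂((volume : Measure (E d)).prod (loopMeasure d m (j + 1))) := fun s => by
    rw [integral_const_mul, setIntegral_eq_integral_of_forall_compl_eq_zero fun y hy => by
      rw [hVS y hy, zero_mul], mul_left_comm, integral_potentialProduct_len_mul hVm hVi hB hd,
      ← integral_const_mul]
  rw [integral_congr_ae (Eventually.of_forall h1), integral_integral_swap hfi]
  congr 1
  funext p
  have h2 : ∀ s, f s p = potentialProduct V 1 (p.1, p.2.1) * len p.2 *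
      (expHat hφ hc s * lapWeight s (len p.2)) := fun s => by rw [hf]; ring
  simp_rw [h2]
  rw [integral_const_mul, integral_expHat_mul_lapWeight, mul_assoc]

include hVm hVi hB in
theorem integrable_potentialProduct {n : ℕ} {σ : Measure (Fin n → E d)} [IsFiniteMeasure σ]
    (t : ℝ) : Integrable (potentialProduct V t) ((volume : Measure (E d)).prod σ) := by
  refine (Integrable.mul_prod hVi.norm (integrable_const (B ^ n) (μ := σ))).mono' ?_
    (Eventually.of_forall fun p => norm_potentialProduct_le hB t p)
  exact ((measurable_potentialProduct hVm).comp (g := fun q : ℝ × (E d × (Fin n → E d)) =>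
    potentialProduct V q.1 q.2) measurable_prodMk_left).aestronglyMeasurable

include hVm hVi hB in
-- In polar coordinates t = len the vertices are t times the shape, and the factor len raises the
-- radial power from 2k - d - 1 to 2k - d, for k = j + 2.
theorem integral_loop_eq_integral_Ioi (hd : d + m = 3) (j : ℕ) (hφ : Continuous φ)
    (hc : HasCompactSupport φ) :
    IntegrableOn (fun t : ℝ => (t : ℂ) ^ (2 * (j + 2) - d) * φ t * ∫ p, potentialProduct V t p
        ∂((volume : Measure (E d)).prod (shapeMeasure d m (j + 1)))) (Set.Ioi 0) ∧
      ∫ p : E d × Loop d m (j + 1), potentialProduct V 1 (p.1, p.2.1) *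
        (len p.2 * φ (len p.2)) ∂((volume : Measure (E d)).prod (loopMeasure d m (j + 1))) =
        ∫ t in Set.Ioi (0 : ℝ), (t : ℂ) ^ (2 * (j + 2) - d) * φ t * ∫ p, potentialProduct V t p
          ∂((volume : Measure (E d)).prod (shapeMeasure d m (j + 1))) := by
  have := isFiniteMeasure_shape hd j
  set R := radialMeasure (2 * (j + 2) - d)
  set σ := shapeMeasure d m (j + 1)
  set F : E d × (ℝ × (Fin (j + 1) → E d)) → ℂ := fun x =>
    potentialProduct V x.2.1 (x.1, x.2.2) * (x.2.1 * φ x.2.1) with hF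
  have hFm : Measurable F := by
    have h1 : Measurable fun x : E d × (ℝ × (Fin (j + 1) → E d)) =>
        potentialProduct V x.2.1 (x.1, x.2.2) :=
      (measurable_potentialProduct hVm).comp (g := fun q : ℝ × (E d × (Fin (j + 1) → E d)) =>
        potentialProduct V q.1 q.2)
        (f := fun x : E d × (ℝ × (Fin (j + 1) → E d)) => (x.2.1, (x.1, x.2.2))) (by fun_prop)
    have h2 := hφ.measurable
    rw [hF]
    fun_prop
  have hR : Integrable (fun t : ℝ => (t : ℂ) * φ t) R := by
    rw [integrable_radialMeasure_iff]
    refine Integrable.integrableOn (Continuous.integrable_of_hasCompactSupport (by fun_prop) ?_)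
    exact HasCompactSupport.smul_left (f := fun t : ℝ => t ^ (2 * (j + 2) - d - 1)) hc.mul_left
  have hFi : Integrable F ((volume : Measure (E d)).prod (R.prod σ)) := by
    have h1 := Integrable.mul_prod (hVi.norm.mul_const (B ^ (j + 1))) (hR.norm.comp_fst σ)
    refine h1.mono' hFm.aestronglyMeasurable (Eventually.of_forall fun x => ?_)
    rw [hF]
    simp only [norm_mul]
    have h3 := norm_potentialProduct_le hB x.2.1 (x.1, x.2.2)
    gcongr
  have h1 : ∀ t, ∫ v, (∫ u, F (u, (t, v))) ∂σ = (t * φ t) * ∫ p, potentialProduct V t p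
      ∂((volume : Measure (E d)).prod σ) := fun t => by
    rw [integral_prod_symm _ (integrable_potentialProduct hVm hVi hB t), ← integral_const_mul]
    congr 1
    funext v
    rw [hF]
    simp only
    rw [integral_mul_const, mul_comm]
  have h2 : ∀ t : ℝ, t ^ (2 * (j + 2) - d - 1) • ((t * φ t) * ∫ p, potentialProduct V t p
      ∂((volume : Measure (E d)).prod σ)) = (t : ℂ) ^ (2 * (j + 2) - d) * φ t *
        ∫ p, potentialProduct V t p ∂((volume : Measure (E d)).prod σ) := fun t => by
    have h3 : (t : ℂ) ^ (2 * (j + 2) - d) = (t : ℂ) ^ (2 * (j + 2) - d - 1) * t := by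
      rw [← pow_succ]; congr 1; omega
    rw [h3, Complex.real_smul]
    push_cast
    ring
  have h3 := hFi.integral_prod_right
  have h4 := h3.integral_prod_left
  simp_rw [h1] at h4
  rw [integrable_radialMeasure_iff] at h4
  simp_rw [h2] at h4
  refine ⟨h4, ?_⟩
  have hmap : ((volume : Measure (E d)).prod (loopMeasure d m (j + 1))).map
      (Prod.map id fun q => (len q, (len q)⁻¹ • q.1)) =
        (volume : Measure (E d)).prod (R.prod σ) := by
    rw [← map_loopMeasure_eq hd, ← Measure.map_prod_map _ _ measurable_id measurable_len_shape,
      Measure.map_id]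
  have h5 : ∫ p : E d × Loop d m (j + 1), potentialProduct V 1 (p.1, p.2.1) *
        (len p.2 * φ (len p.2)) ∂((volume : Measure (E d)).prod (loopMeasure d m (j + 1))) =
      ∫ x, F x ∂((volume : Measure (E d)).prod (R.prod σ)) := by
    rw [← hmap, integral_map (measurable_id.prodMap measurable_len_shape).aemeasurable
      hFm.aestronglyMeasurable]
    apply integral_congr_ae
    -- Rescaling the vertices by the inverse length loses information only at length 0, which is a
    -- null set.
    have h6 : ∀ᵐ p ∂((volume : Measure (E d)).prod (loopMeasure d m (j + 1))), 0 < len p.2 :=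
      Measure.quasiMeasurePreserving_snd.ae ae_len_pos
    filter_upwards [h6] with p hp
    rw [hF]
    simp only [Prod.map_fst, Prod.map_snd, id]
    rw [potentialProduct_inv_smul V hp.ne']
  rw [h5, integral_prod_symm _ hFi, integral_prod _ h3]
  simp_rw [h1]
  rw [integral_radialMeasure]
  simp_rw [h2]

end LoopTrace

end WaveTrace

namespace WaveTrace

/-! ### Support and absolute continuity of the shape measure -/

section Support

open Filter Topology

variable {d m n : ℕ}

theorem loopLength_eq (v : Fin n → E d) : loopLength v = ∑ i, ‖edge v i‖ := by
  rw [loopLength]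
  refine Finset.sum_congr rfl fun i _ => ?_
  rw [edge, Fin.snoc_castSucc]
  congr 2
  cases i using Fin.lastCases with
  | last => rw [Fin.succ_last, Fin.snoc_last, Fin.last_add_one, Fin.cons_zero]
  | cast i => rw [Fin.succ_castSucc, Fin.snoc_castSucc, Fin.coeSucc_eq_succ]

theorem loopLength_le_len (q : Loop d m n) : loopLength q.1 ≤ len q := by
  rw [loopLength_eq]
  exact Finset.sum_le_sum fun i _ => norm_le_rho _ _

theorem loopLength_smul {r : ℝ} (hr : 0 ≤ r) (v : Fin n → E d) :
    loopLength (r • v) = r * loopLength v := by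
  simp only [loopLength_eq, edge_smul, norm_smul, Real.norm_of_nonneg hr, Finset.mul_sum]

theorem continuous_loopLength : Continuous (loopLength : (Fin n → E d) → ℝ) := by
  have h : (loopLength : (Fin n → E d) → ℝ) = fun v => ∑ i, ‖edge v i‖ := funext loopLength_eq
  rw [h]
  exact continuous_finsetSum _ fun i _ => (continuous_edge i).norm

/-- The extra coordinates only lengthen the edges, so dividing by the full length makes the polygon
in ℝ^d no longer than 1. -/
theorem shapeMeasure_loopLength : shapeMeasure d m n {u | loopLength u ≤ 1}ᶜ = 0 := by
  rw [shapeMeasure_apply (measurableSet_le continuous_loopLength.measurable measurable_const).compl]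
  have h : {q : Loop d m n | len q ≤ 1 ∧ (len q)⁻¹ • q.1 ∈ {u | loopLength u ≤ 1}ᶜ} = ∅ := by
    refine Set.eq_empty_of_forall_notMem fun q hq => hq.2 ?_
    change loopLength ((len q)⁻¹ • q.1) ≤ 1
    rw [loopLength_smul (inv_nonneg.2 (len_nonneg q))]
    exact (mul_le_mul_of_nonneg_left (loopLength_le_len q) (inv_nonneg.2 (len_nonneg q))).trans
      inv_mul_le_one
  rw [h, measure_empty, mul_zero]

theorem hasDerivAt_sqrt_sq_add (b c : ℝ) {a : ℝ} (ha : 0 < a) :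
    HasDerivAt (fun a => √(c ^ 2 + (a * b) ^ 2)) (a * b ^ 2 / √(c ^ 2 + (a * b) ^ 2)) a := by
  rcases eq_or_ne b 0 with rfl | hb
  · simpa using hasDerivAt_const a (√(c ^ 2))
  · have h1 : HasDerivAt (fun a => c ^ 2 + (a * b) ^ 2) (2 * (a * b) * b) a := by
      refine ((((hasDerivAt_id' a).mul_const b).fun_pow 2).const_add (c ^ 2)).congr_deriv ?_
      norm_num
    have h2 : c ^ 2 + (a * b) ^ 2 ≠ 0 := by positivity
    convert h1.sqrt h2 using 1
    field_simp

/-- By change of variables the integral of f' over the preimage is the measure of a subset of T,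
hence zero; as f' > 0 the preimage is null. -/
theorem volume_preimage_of_deriv_pos {f : ℝ → ℝ} (hf : ∀ a, 0 < a → 0 < deriv f a) {T : Set ℝ}
    (hfT : MeasurableSet (f ⁻¹' T)) (hT : volume T = 0) :
    volume (Set.Ioi 0 ∩ f ⁻¹' T) = 0 := by
  have hd : ∀ a, 0 < a → HasDerivAt f (deriv f a) a := fun a ha =>
    (differentiableAt_of_deriv_ne_zero (hf a ha).ne').hasDerivAt
  have hmono : StrictMonoOn f (Set.Ioi 0) := by
    refine strictMonoOn_of_deriv_pos (convex_Ioi 0)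
      (fun a ha => (hd a ha).continuousAt.continuousWithinAt) fun a ha => ?_
    rw [interior_Ioi] at ha
    exact hf a ha
  have hs : MeasurableSet (Set.Ioi 0 ∩ f ⁻¹' T) := measurableSet_Ioi.inter hfT
  have h1 := lintegral_image_eq_lintegral_abs_deriv_mul hs
    (fun a ha => (hd a ha.1).hasDerivWithinAt) (hmono.injOn.mono Set.inter_subset_left) fun _ => 1
  have h2 : volume (f '' (Set.Ioi 0 ∩ f ⁻¹' T)) = 0 :=
    measure_mono_null (Set.image_subset_iff.2 Set.inter_subset_right) hT
  rw [setLIntegral_one, h2] at h1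
  simp only [mul_one] at h1
  have h3 := (setLIntegral_eq_zero_iff hs (measurable_deriv f).abs.ennreal_ofReal).1 h1.symm
  refine measure_eq_zero_iff_ae_notMem.2 ?_
  filter_upwards [h3] with a ha has
  exact absurd (ha has) (ENNReal.ofReal_pos.2 (abs_pos.2 (hf a has.1).ne')).ne'

theorem deriv_len_smul_pos (v : Fin n → E d) {z : Fin (n + 1) → E m} (hz : z ≠ 0) {a : ℝ}
    (ha : 0 < a) : 0 < deriv (fun a : ℝ => len (v, a • z)) a := by
  have h1 : (fun a : ℝ => len (v, a • z)) =ᶠ[𝓝 a]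
      fun a => ∑ i, √(‖edge v i‖ ^ 2 + (a * ‖z i‖) ^ 2) := by
    filter_upwards [lt_mem_nhds ha] with b hb
    refine Finset.sum_congr rfl fun i _ => ?_
    have h2 : ‖(b • z) i‖ = b * ‖z i‖ := by
      rw [Pi.smul_apply, norm_smul, Real.norm_of_nonneg hb.le]
    rw [leg, rho, h2]
  have h2 := HasDerivAt.fun_sum (u := Finset.univ) fun i _ =>
    hasDerivAt_sqrt_sq_add ‖z i‖ ‖edge v i‖ ha
  rw [h1.deriv_eq, h2.deriv]
  obtain ⟨i, hi⟩ := Function.ne_iff.1 hz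
  have hi' : 0 < ‖z i‖ := norm_pos_iff.2 hi
  refine Finset.sum_pos' (fun i _ => by positivity) ⟨i, Finset.mem_univ i, ?_⟩
  have : 0 < √(‖edge v i‖ ^ 2 + (a * ‖z i‖) ^ 2) := Real.sqrt_pos.2 (by positivity)
  positivity

/-- Along a ray a ↦ az the length has positive derivative, so almost every ray meets the set in a
null set of a. Fubini in (a, z) then gives a single a > 0 for which the dilated set is null, and
undoing the dilation finishes. -/
theorem volume_len_mem [NeZero m] (v : Fin n → E d) {T : Set ℝ} (hTm : MeasurableSet T)
    (hT : volume T = 0) : volume {z : Fin (n + 1) → E m | len (v, z) ∈ T} = 0 := by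
  have hlen : Measurable fun x : ℝ × (Fin (n + 1) → E m) => len (v, x.1 • x.2) := by
    have h : Continuous fun x : ℝ × (Fin (n + 1) → E m) => (v, x.1 • x.2) := by fun_prop
    exact (continuous_len.comp h).measurable
  set X : Set (ℝ × (Fin (n + 1) → E m)) := {x | len (v, x.1 • x.2) ∈ T} with hX
  have hXm : MeasurableSet X := hlen hTm
  have h1 : ((volume.restrict (Set.Ioi (0 : ℝ))).prod volume) X = 0 := by
    rw [Measure.prod_apply_symm hXm, lintegral_eq_zero_iff (measurable_measure_prodMk_right hXm)]
    filter_upwards [ae_eval 0 (Measure.ae_ne volume (0 : E m))] with z hz0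
    have hz : z ≠ 0 := fun h => hz0 (congrFun h 0)
    have h2 : MeasurableSet ((fun a : ℝ => (a, z)) ⁻¹' X) := measurable_prodMk_right hXm
    rw [Pi.zero_apply, Measure.restrict_apply h2, Set.inter_comm]
    exact volume_preimage_of_deriv_pos (fun a ha => deriv_len_smul_pos v hz ha) h2 hT
  rw [Measure.measure_prod_null hXm] at h1
  have h2 : (volume.restrict (Set.Ioi (0 : ℝ))) ≠ 0 := by
    rw [Ne, Measure.restrict_eq_zero, Real.volume_Ioi]
    exact ENNReal.top_ne_zero
  have : NeBot (ae (volume.restrict (Set.Ioi (0 : ℝ)))) := ae_neBot.2 h2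
  obtain ⟨a, h3, ha⟩ := (h1.and (ae_restrict_mem measurableSet_Ioi)).exists
  have ha' : 0 < a := ha
  have h4 := Measure.addHaar_preimage_smul (volume : Measure (Fin (n + 1) → E m)) ha'.ne'
    {z | len (v, z) ∈ T}
  have h5 : ((a • ·) ⁻¹' {z : Fin (n + 1) → E m | len (v, z) ∈ T}) = Prod.mk a ⁻¹' X := rfl
  have h6 : volume (Prod.mk a ⁻¹' X) = 0 := h3
  rw [h5, h6] at h4
  refine (mul_eq_zero.1 h4.symm).resolve_left ?_
  exact (ENNReal.ofReal_pos.2 (by positivity)).ne'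

/-- For fixed r > 0 the dilate of a null set is null; Fubini exchanges the roles of r and v. -/
theorem ae_volume_scale {B : Set (Fin n → E d)} (hBm : MeasurableSet B) (hB : volume B = 0) :
    ∀ᵐ v : Fin n → E d, volume {r : ℝ | 0 < r ∧ r⁻¹ • v ∈ B} = 0 := by
  set X : Set ((Fin n → E d) × ℝ) := {x | 0 < x.2 ∧ x.2⁻¹ • x.1 ∈ B} with hX
  have hXm : MeasurableSet X :=
    (measurableSet_lt measurable_const measurable_snd).inter
      ((measurable_snd.inv.smul measurable_fst) hBm)
  have h1 : ((volume : Measure (Fin n → E d)).prod (volume : Measure ℝ)) X = 0 := by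
    rw [Measure.prod_apply_symm hXm, lintegral_eq_zero_iff (measurable_measure_prodMk_right hXm)]
    refine Eventually.of_forall fun r => ?_
    rcases le_or_gt r 0 with hr | hr
    · refine measure_mono_null (t := ∅) (fun v hv => ?_) measure_empty
      exact absurd hv.1 (not_lt.2 hr)
    · refine measure_mono_null (t := (r⁻¹ • ·) ⁻¹' B) (fun v hv => hv.2) ?_
      rw [Measure.addHaar_preimage_smul _ (inv_pos.2 hr).ne', hB, mul_zero]
  exact (Measure.measure_prod_null hXm).1 h1

/-- For almost every v the lengths r with v/r in B form a null set, and the extra coordinates reach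
such lengths only on a null set. With m = 0 there are no coordinates left to vary. -/
theorem shapeMeasure_absolutelyContinuous [NeZero m] : shapeMeasure d m n ≪ volume := by
  refine Measure.AbsolutelyContinuous.mk fun B hBm hB => ?_
  rw [shapeMeasure_apply hBm]
  refine mul_eq_zero_of_right _ ?_
  set X : Set (Loop d m n) := {q | 0 < len q ∧ (len q)⁻¹ • q.1 ∈ B} with hX
  have hXm : MeasurableSet X :=
    (measurableSet_lt measurable_const continuous_len.measurable).inter (measurable_shape hBm)
  have h1 : (volume.prod volume) X = 0 := by
    rw [Measure.measure_prod_null hXm]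
    filter_upwards [ae_volume_scale hBm hB] with v hv
    have hTm : MeasurableSet {r : ℝ | 0 < r ∧ r⁻¹ • v ∈ B} :=
      measurableSet_Ioi.inter ((measurable_id.inv.smul measurable_const) hBm)
    exact volume_len_mem v hTm hv
  refine measure_mono_null (t := X ∪ {q | ¬ 0 < len q}) (fun q hq => ?_)
    (measure_union_null (loopMeasure_absolutelyContinuous h1) (ae_iff.1 ae_len_pos))
  rcases (em (0 < len q)) with h | h
  · exact Or.inl ⟨h, hq.2⟩
  · exact Or.inr h

end Support

end WaveTrace

namespace WaveTrace

/-! ### Independence of the representative of V -/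

section Representative

open Filter Topology

variable {d : ℕ}

/-- The path integrals need a Borel function bounded everywhere; a measurable version of V is cut
off outside the support and where it exceeds the essential bound. -/
theorem exists_bounded_representative {V : E d → ℂ} (hV : MemLp V ∞ volume)
    (hc : HasCompactSupport V) : ∃ (W : E d → ℂ) (S : Set (E d)) (B : ℝ), Measurable W ∧
      V =ᵐ[volume] W ∧ volume S ≠ ∞ ∧ (∀ y, y ∉ S → W y = 0) ∧ ∀ y, ‖W y‖ ≤ B := by
  classical
  set g := hV.1.mk V with hg
  have hgm : Measurable g := hV.1.stronglyMeasurable_mk.measurable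
  set B : ℝ := (eLpNorm V ∞ volume).toReal with hB
  have hBV : ∀ᵐ x, ‖V x‖ ≤ B := by
    filter_upwards [ae_le_eLpNormEssSup (f := V) (μ := volume)] with x hx
    rw [← eLpNorm_exponent_top] at hx
    rw [hB, ← toReal_enorm]
    exact ENNReal.toReal_mono hV.2.ne hx
  set D : Set (E d) := tsupport V ∩ {x | ‖g x‖ ≤ B} with hD
  have hDm : MeasurableSet D :=
    (isClosed_tsupport V).measurableSet.inter (measurableSet_le hgm.norm measurable_const)
  refine ⟨D.indicator g, tsupport V, B, hgm.indicator hDm, ?_, hc.measure_lt_top.ne,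
    fun y hy => Set.indicator_of_notMem (fun h => hy h.1) _, fun y => ?_⟩
  · filter_upwards [hV.1.ae_eq_mk, hBV] with x h1 h2
    rcases em (x ∈ tsupport V) with hx | hx
    · rw [Set.indicator_of_mem (show x ∈ D from ⟨hx,
        by rw [Set.mem_ofPred_eq, hg, ← h1]; exact h2⟩),
        h1]
    · rw [Set.indicator_of_notMem (fun h => hx h.1), image_eq_zero_of_notMem_tsupport hx]
  · rcases em (y ∈ D) with hy | hy
    · rw [Set.indicator_of_mem hy]; exact hy.2
    · rw [Set.indicator_of_notMem hy, norm_zero]; exact ENNReal.toReal_nonneg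

theorem mulOp_congr {V W : E d → ℂ} (hV : MemLp V ∞ volume) (hW : MemLp W ∞ volume)
    (h : V =ᵐ[volume] W) : mulOp V hV = mulOp W hW := by
  rw [mulOp, mulOp, MemLp.toLp_congr hV hW h]

theorem duhamelTerm_congr {V W : E d → ℂ} (hV : MemLp V ∞ volume) (hW : MemLp W ∞ volume)
    (h : V =ᵐ[volume] W) : duhamelTerm V hV = duhamelTerm W hW := by
  have h1 : potential V hV = potential W hW := by
    funext f
    rw [potential, potential, mulOp_congr hV hW h]
  funext k f
  rw [duhamelTerm, duhamelTerm, h1]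

/-- No absolute continuity of σ is used, which matters for d = 3: for each fixed second coordinate
the exceptional set is a translate of a null set in the first. -/
theorem ae_prod_shift {Y : Type*} [MeasurableSpace Y] {σ : Measure Y} [SFinite σ] {f : Y → E d}
    (hf : Measurable f) {P : E d → Prop} (h : ∀ᵐ x, P x) :
    ∀ᵐ p ∂((volume : Measure (E d)).prod σ), P (p.1 + f p.2) := by
  obtain ⟨N, hN, hNm, hN0⟩ := exists_measurable_superset_of_null (ae_iff.1 h)
  have hXm : MeasurableSet {p : E d × Y | p.1 + f p.2 ∈ N} :=
    (measurable_fst.add (hf.comp measurable_snd)) hNm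
  refine ae_iff.2 (measure_mono_null (t := {p : E d × Y | p.1 + f p.2 ∈ N}) (fun p hp => hN hp) ?_)
  rw [Measure.prod_apply_symm hXm]
  have h1 : ∀ y, volume ((fun x => (x, y)) ⁻¹' {p : E d × Y | p.1 + f p.2 ∈ N}) = 0 := fun y => by
    have := measure_preimage_add_right volume (f y) N
    rw [hN0] at this
    exact this
  simp_rw [h1]
  exact lintegral_zero

theorem potentialProduct_congr {V W : E d → ℂ} (h : V =ᵐ[volume] W) {n : ℕ}
    (σ : Measure (Fin n → E d)) [SFinite σ] (t : ℝ) :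
    potentialProduct V t =ᵐ[(volume : Measure (E d)).prod σ] potentialProduct W t := by
  have h1 : ∀ᵐ p ∂((volume : Measure (E d)).prod σ), ∀ j, V (p.1 + t • p.2 j) =
      W (p.1 + t • p.2 j) :=
    ae_all_iff.2 fun j => ae_prod_shift (f := fun v : Fin n → E d => t • v j) (by fun_prop) h
  have h2 : ∀ᵐ p ∂((volume : Measure (E d)).prod σ), V p.1 = W p.1 :=
    Measure.quasiMeasurePreserving_fst.ae h
  filter_upwards [h1, h2] with p h3 h4
  rw [potentialProduct, potentialProduct, h4]
  simp_rw [h3]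

end Representative

/-! ### Assembly of the trace formula -/

section TraceFormula

variable {d m : ℕ}

/-- The measure in the trace formula for the Duhamel term of order `j + 2`. -/
noncomputable def traceMeasure (d m j : ℕ) : Measure (Fin (j + 1) → E d) :=
  ENNReal.ofReal (2 / (j + 2 : ℕ)) • shapeMeasure d m (j + 1)

theorem isFiniteMeasure_traceMeasure (hd : d + m = 3) (j : ℕ) :
    IsFiniteMeasure (traceMeasure d m j) := by
  have := isFiniteMeasure_shape hd j
  exact Measure.smul_finite _ ENNReal.ofReal_ne_top

theorem traceMeasure_real_univ (d m j : ℕ) : (traceMeasure d m j).real Set.univ =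
    2 / (j + 2 : ℕ) * (shapeMeasure d m (j + 1)).real Set.univ := by
  rw [traceMeasure, measureReal_ennreal_smul_apply, ENNReal.toReal_ofReal (by positivity)]

theorem integral_prod_traceMeasure (hd : d + m = 3) (j : ℕ) (f : E d × (Fin (j + 1) → E d) → ℂ) :
    ∫ p, f p ∂((volume : Measure (E d)).prod (traceMeasure d m j)) =
      (2 / (j + 2 : ℕ) : ℂ) *
        ∫ p, f p ∂((volume : Measure (E d)).prod (shapeMeasure d m (j + 1))) := by
  have := isFiniteMeasure_shape hd j
  rw [traceMeasure, Measure.prod_smul_right, integral_smul_measure,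
    ENNReal.toReal_ofReal (by positivity), Complex.real_smul]
  push_cast
  rfl

variable {V : E d → ℂ} (hVm : Measurable V) (hV : MemLp V ∞ volume) {S : Set (E d)}
  (hS : volume S ≠ ∞) (hVS : ∀ y, y ∉ S → V y = 0) {B : ℝ} (hB : ∀ y, ‖V y‖ ≤ B)
  {φ : ℝ → ℂ} (hφ : ContDiff ℝ (⊤ : ℕ∞) φ) (hc : HasCompactSupport φ)

include hVm hS hVS hB hφ hc in
theorem integrableOn_traceFormula (hd : d + m = 3) (j : ℕ) :
    IntegrableOn (fun t : ℝ => (t : ℂ) ^ (2 * (j + 2) - d) * φ t * ∫ p, potentialProduct V t p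
      ∂((volume : Measure (E d)).prod (traceMeasure d m j))) (Set.Ioi 0) := by
  have hVi := integrable_of_bounded_support hVm hS hVS hB
  simp_rw [integral_prod_traceMeasure hd, mul_left_comm _ (2 / _ : ℂ)]
  exact (integral_loop_eq_integral_Ioi hVm hVi hB hd j hφ.continuous hc).1.const_mul _

include hVm hS hVS hB hφ hc in
-- The constant 2/(j + 2) in `traceMeasure` comes from two half lines with equal traces and from the
-- average over the j + 2 edges.
theorem exists_isPairing_hasTrace [NeZero d] (hd : d + m = 3) (he : ∀ t, φ (-t) = φ t) (j : ℕ) :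
    ∃ A : State d →L[ℂ] State d, IsPairing φ V hV (j + 2) A ∧
      HasTrace A (∫ t in Set.Ioi (0 : ℝ), (t : ℂ) ^ (2 * (j + 2) - d) * φ t *
        ∫ p, potentialProduct V t p ∂((volume : Measure (E d)).prod (traceMeasure d m j))) := by
  have hVi := integrable_of_bounded_support hVm hS hVS hB
  obtain ⟨A, hA, hint, htr⟩ := exists_hasTrace_integral_Ioi hV hφ hc hd (NeZero.one_le) hS hVS hB j
  refine ⟨_, isPairing_add_conj hV hφ.continuous hc he (j + 2) hA, ?_⟩
  convert htr.add (htr.conj reflect) using 1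
  have h1 := integral_expHat_mul_loop hVm hVi hB hφ hc hd hV j hVS hint
  rw [(integral_loop_eq_integral_Ioi hVm hVi hB hd j hφ.continuous hc).2] at h1
  simp_rw [integral_prod_traceMeasure hd, mul_left_comm _ (2 / _ : ℂ)]
  rw [integral_const_mul, ← h1, ← two_mul, ← mul_assoc]
  congr 1
  have : ((j + 2 : ℕ) : ℂ) ≠ 0 := by exact_mod_cast (by omega : j + 2 ≠ 0)
  field_simp

end TraceFormula

end WaveTrace

open WaveTrace in
theorem mainTheorem6 (d k : ℕ) (hd : d = 1 ∨ d = 2 ∨ d = 3) (hk : 2 ≤ k) :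
    ∃ σ : Measure (Fin (k - 1) → E d),
      IsFiniteMeasure σ ∧
      σ {u | loopLength u ≤ 1}ᶜ = 0 ∧
      (d = 1 → σ.real Set.univ =
        1 / (2 ^ (2 * k - 2) * (k.factorial : ℝ) * ((k - 1).factorial : ℝ))) ∧
      (d = 2 → σ.real Set.univ =
        1 / (Real.pi * (k : ℝ) * ((2 * k - 2).factorial : ℝ))) ∧
      (d = 3 → σ.real Set.univ =
        1 / (2 ^ (2 * k - 2) * Real.pi * (k.factorial : ℝ) * ((k - 2).factorial : ℝ))) ∧
      (d = 1 ∨ d = 2 → σ ≪ volume) ∧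
      ∀ (V : E d → ℂ) (hV : MemLp V ∞ volume), HasCompactSupport V →
        ∀ φ : ℝ → ℂ, ContDiff ℝ (⊤ : ℕ∞) φ → HasCompactSupport φ → (∀ t, φ (-t) = φ t) →
          (∀ t : ℝ, 0 < t → Integrable (potentialProduct V t) (volume.prod σ)) ∧
          IntegrableOn (fun t : ℝ => (t : ℂ) ^ (2 * k - d) * φ t *
            ∫ p, potentialProduct V t p ∂(volume.prod σ)) (Set.Ioi 0) ∧
          ∃ A : State d →L[ℂ] State d, IsPairing φ V hV k A ∧
            HasTrace A (∫ t in Set.Ioi (0 : ℝ), (t : ℂ) ^ (2 * k - d) * φ t *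
              ∫ p, potentialProduct V t p ∂(volume.prod σ)) := by
  obtain ⟨j, rfl⟩ : ∃ j, k = j + 2 := ⟨k - 2, by omega⟩
  -- The number of extra coordinates for the descent from dimension 3.
  obtain ⟨m, hm⟩ : ∃ m, d + m = 3 := ⟨3 - d, by omega⟩
  have : NeZero d := ⟨by omega⟩
  have hfin := isFiniteMeasure_traceMeasure hm j
  refine ⟨traceMeasure d m j, hfin, ?_, ?_, ?_, ?_, fun hd' => ?_,
    fun V hV hVc φ hφ hc he => ?_⟩
  · exact mul_eq_zero_of_right _ shapeMeasure_loopLength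
  · rintro rfl
    exact (traceMeasure_real_univ 1 m j).trans (shapeMass_one hm j)
  · rintro rfl
    exact (traceMeasure_real_univ 2 m j).trans (shapeMass_two hm j)
  · rintro rfl
    exact (traceMeasure_real_univ 3 m j).trans (shapeMass_three hm j)
  -- In dimensions 1 and 2 at least one extra coordinate is present.
  · have : NeZero m := ⟨by omega⟩
    exact Measure.AbsolutelyContinuous.smul_left shapeMeasure_absolutelyContinuous _
  · obtain ⟨W, S, B, hWm, hVW, hS, hWS, hB⟩ := exists_bounded_representative hV hVc
    have hW : MemLp W ∞ volume := hV.ae_eq hVW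
    have hPP := potentialProduct_congr hVW (traceMeasure d m j)
    have hI : ∀ t, ∫ p, potentialProduct V t p ∂(volume.prod (traceMeasure d m j)) =
        ∫ p, potentialProduct W t p ∂(volume.prod (traceMeasure d m j)) := fun t =>
      integral_congr_ae (hPP t)
    have hWi := integrable_of_bounded_support hWm hS hWS hB
    refine ⟨fun t _ => (integrable_potentialProduct hWm hWi hB t).congr (hPP t).symm, ?_, ?_⟩
    · refine (integrableOn_traceFormula hWm hS hWS hB hφ hc hm j).congr_fun (fun t _ => ?_)
        measurableSet_Ioi
      exact congrArg _ (hI t).symm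
    · obtain ⟨A, hA, hA'⟩ := exists_isPairing_hasTrace hWm hW hS hWS hB hφ hc hm he j
      refine ⟨A, ?_, ?_⟩
      · intro h
        rw [duhamelTerm_congr hV hW hVW]
        exact hA h
      · convert hA' using 1
        refine setIntegral_congr_fun measurableSet_Ioi fun t _ => ?_
        exact congrArg _ (hI t)
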